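/- Inner products are linear in the second variable. Let $\mathcal H$ be a finite-dimensional complex Hilbert space and $H\subset\mathcal H$ a standard subspace, i.e. a real subspace with $H\cap iH=0$ and $H+iH=\mathcal H$. Let $S(h+ih')=h-ih'$ ($h,h'\in H$) be its Tomita operator, $\Delta=S^*S$ its modular operator and $J=S\Delta^{-1/2}$ its modular conjugation. **Twist.** For $T\in B(\mathcal H\otimes\mathcal H)$ put $T_k=1^{\otimes(k-1)}\otimes T\otimes 1^{\otimes(n-k-1)}$ on $\mathcal H^{\otimes n}$, $R_{T,n}=1+T_1+T_1T_2+\dots+T_1\cdots T_{n-1}$, $P_{T,0}=P_{T,1}=1$ and $P_{T,n}=(1\otimes P_{T,n-1})R_{T,n}$. Let $T$ be self-adjoint with $\|T\|<1$ and with all $P_{T,n}$ strictly positive. Suppose also that $T$ is * *braided*: $T_1T_2T_1=T_2T_1T_2$; * *compatible with $H$*: $[\Delta^{it}\otimes\Delta^{it},T]=0$ for all $t\in\mathbb R$; * *crossing symmetric*: for all $\psi_1,\dots,\psi_4\in\mathcal H$, the function $t\mapsto\langle\psi_2\otimes\psi_1,(\Delta^{it}\otimes1)T(1\otimes\Delta^{-it})(\psi_3\otimes\psi_4)\rangle$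 on $\mathbb R$ extends to a bounded continuous function on $\{0\le\operatorname{Im}z\le\frac12\}$ that is analytic in the interior and takes at $t+\frac i2$ the value $\langle\psi_1\otimes J\psi_4,(1\otimes\Delta^{it})T(\Delta^{-it}\otimes1)(J\psi_2\otimes\psi_3)\rangle$. **Algebra.** Let $\mathcal F_T(\mathcal H)=\bigoplus_{n\ge0}\mathcal H^{\otimes n}$ be the Hilbert space direct sum in which $\mathcal H^{\otimes n}$ has the inner product $\langle v,P_{T,n}w\rangle$, with vacuum vector $\Omega\in\mathcal H^{\otimes0}=\mathbb C$. Let $a_T^*(\xi)v=\xi\otimes v$ be the left creation operators, $a_T(\xi)$ their adjoints, and $X_T(\xi)=a_T^*(\xi)+a_T(S\xi)$. Let $M=\mathcal L_T(H)=\{X_T(\xi):\xi\in H\}''$ and $\varphi(a)=\langle\Omega,a\Omega\rangle$, and identify $L^2(M,\varphi)$ with $\overline{M\Omega}\subseteq\mathcal F_T(\mathcal H)$. **Quasi-free difference quotients.** Let $e_1,\dots,e_d$ be an orthonormal basis of the real Hilbert space $(H,\operatorname{Re}\langle\cdot,\cdot\rangle)$. It is also a complex basis of $\mathcal H$. Put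 $X_i=X_T(e_i)$ and let $A$ be the matrix of $\Delta^{-1}$ in the basis $(e_i)$, i.e. $\Delta^{-1}e_j=\sum_kA_{kj}e_k$. On noncommutative polynomials the free difference quotients are the linear maps with $$\partial_i(x_{j_1}\cdots x_{j_k})=\sum_{m=1}^k\delta_{i,j_m}\,x_{j_1}\cdots x_{j_{m-1}}\otimes x_{j_{m+1}}\cdots x_{j_k},$$ and the quasi-free difference quotients are $\eth_i=\sum_{k=1}^d\big[\tfrac2{1+A}\big]_{ki}\partial_k$. A conjugate system of $(X_1,\dots,X_d)$ with respect to $(\eth_i)$ is a family $\Theta_1,\dots,\Theta_d\in L^2(M,\varphi)$ with $\Theta_i=\eth_i^*(1\otimes1)$, i.e. $$\langle\Theta_i,p(X_1,\dots,X_d)\Omega\rangle=(\varphi\otimes\varphi^{op})\big((\eth_ip)(X_1,\dots,X_d)\big)\qquad\text{for all noncommutative polynomials }p,$$ where $\varphi\otimes\varphi^{op}$ sends $p_1(X)\otimes p_2(X)$ to $\varphi(p_1(X))\varphi(p_2(X))$. **Twisted contractions.** On $\mathcal H^{\otimes k}$ let $C_i(\xi_1\otimes\dots\otimes\xi_k)=\langle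 S\xi_i,\xi_{i+1}\rangle\,\xi_1\otimes\dots\otimes\xi_{i-1}\otimes\xi_{i+2}\otimes\dots\otimes\xi_k$, and put $T_{a,b}=T_aT_{a+1}\cdots T_{b-1}$ (with $T_{a,a}=1$). Let $\pi$ be an incomplete matching of $\{1,\dots,n\}$, i.e. a partition into singletons and pairs, with pairs $\{i_1,j_1\},\dots,\{i_s,j_s\}$, where $i_m<j_m$ and $i_1<\dots<i_s$. Let $r_k(m)$ be the number of elements less than $m$ of $\{i_t,j_t:t<k\}$, and set $$W^T_\pi=C_{i_s-r_s(i_s)}T_{i_s-r_s(i_s)+1,\,j_s-r_s(j_s)}\cdots C_{i_1-r_1(i_1)}T_{i_1-r_1(i_1)+1,\,j_1-r_1(j_1)}:\mathcal H^{\otimes n}\to\mathcal H^{\otimes(n-2s)}$$ ($W^T_\pi=1$ if there are no pairs). Let $B(2n+1)$ be the set of incomplete matchings of $\{1,\dots,2n+1\}$ in which $n+1$ is a singleton and each $k\le n$ is paired with an element of $\{n+2,\dots,2n+1\}$. The adjoints $(W^T_\pi)^*$ below are taken for the undeformed inner products of the tensor powers. **Statement.** The $X_i$ are self-adjoint elements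 of $M$, the matrix $A$ is positive definite, and $\varphi(X_kX_j)=\big[\tfrac2{1+A}\big]_{jk}=\big[\tfrac{2A}{1+A}\big]_{kj}$ for all $j,k$. The conjugate system $(\Theta_1,\dots,\Theta_d)$ of $(X_1,\dots,X_d)$ with respect to the quasi-free difference quotients exists, and (being unique) it is given by the norm-convergent series in $\mathcal F_T(\mathcal H)$ $$\Theta_i=\sum_{n=0}^\infty(-1)^n\,P_{T,2n+1}^{-1}\sum_{\pi\in B(2n+1)}(W_\pi^T)^*e_i,\qquad 1\le i\le d.$$ -/

import Mathlib

open scoped TensorProduct InnerProductSpace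

namespace TwistedFock

noncomputable section

universe u

/-- A complex inner product space together with its carrier. -/
structure InnerSpaceBundle : Type (u + 1) where
  carrier : Type u
  [normed : NormedAddCommGroup carrier]
  [inner : InnerProductSpace ℂ carrier]

/-- The operator `f⁻¹ A e`. -/
def isometryConj {V V' W W' : Type*} [NormedAddCommGroup V] [InnerProductSpace ℂ V]
    [NormedAddCommGroup V'] [InnerProductSpace ℂ V'] [NormedAddCommGroup W]
    [InnerProductSpace ℂ W] [NormedAddCommGroup W'] [InnerProductSpace ℂ W']
    (e : V ≃ₗᵢ[ℂ] V') (f : W ≃ₗᵢ[ℂ] W') (A : V' →L[ℂ] W') : V →L[ℂ] W :=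
  f.symm.toContinuousLinearEquiv.toContinuousLinearMap ∘L A ∘L
    e.toContinuousLinearEquiv.toContinuousLinearMap

section TensorPower

variable (E : Type u) [NormedAddCommGroup E] [InnerProductSpace ℂ E]

/-- The tensor powers `ℂ, E ⊗ ℂ, E ⊗ (E ⊗ ℂ), …` with their Hilbert space tensor product
structure. -/
def tpowBundle : ℕ → InnerSpaceBundle.{u}
  | 0 => { carrier := EuclideanSpace ℂ PUnit.{u + 1} }
  | n + 1 =>
    letI := (tpowBundle n).normed
    letI := (tpowBundle n).inner
    { carrier := E ⊗[ℂ] (tpowBundle n).carrier }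

/-- The `n`-th tensor power `E^{⊗ n}`, with inner product
`⟪ξ₁ ⊗ ⋯ ⊗ ξₙ, η₁ ⊗ ⋯ ⊗ ηₙ⟫ = ⟪ξ₁, η₁⟫ ⋯ ⟪ξₙ, ηₙ⟫`. -/
def TPow (n : ℕ) : Type u := (tpowBundle E n).carrier

instance tpowNormed (n : ℕ) : NormedAddCommGroup (TPow E n) := (tpowBundle E n).normed

instance tpowInner (n : ℕ) : InnerProductSpace ℂ (TPow E n) := (tpowBundle E n).inner

/-- `E^{⊗ 0} = ℂ`. -/
def tpowZero : TPow E 0 ≃ₗᵢ[ℂ] ℂ := (OrthonormalBasis.singleton PUnit.{u + 1} ℂ).repr.symm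

/-- `E^{⊗ (n + 1)} = E ⊗ E^{⊗ n}`. -/
def tpowSucc (n : ℕ) : TPow E (n + 1) ≃ₗᵢ[ℂ] E ⊗[ℂ] TPow E n := LinearIsometryEquiv.refl ℂ _

attribute [irreducible] TPow tpowNormed tpowInner tpowZero tpowSucc

instance [FiniteDimensional ℂ E] (n : ℕ) : FiniteDimensional ℂ (TPow E n) := by
  induction n with
  | zero => exact (tpowZero E).symm.toLinearEquiv.finiteDimensional
  | succ n ih => exact (tpowSucc E n).symm.toLinearEquiv.finiteDimensional

instance [FiniteDimensional ℂ E] (n : ℕ) : CompleteSpace (TPow E n) :=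
  FiniteDimensional.complete ℂ _

/-- The unit vector spanning `E^{⊗ 0}`. -/
def tpowOne : TPow E 0 := (tpowZero E).symm 1

variable {E}

/-- `ξ ⊗ v ∈ E^{⊗ (n + 1)}` for `v ∈ E^{⊗ n}`. -/
def tcons (n : ℕ) (ξ : E) : TPow E n →ₗ[ℂ] TPow E (n + 1) :=
  (tpowSucc E n).symm.toLinearEquiv.toLinearMap ∘ₗ TensorProduct.mk ℂ E (TPow E n) ξ

/-- The vector `ξ` as an element of `E^{⊗ 1}`. -/
def tone (ξ : E) : TPow E 1 := tcons 0 ξ (tpowOne E)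

/-- `1 ⊗ A : E^{⊗ (n + 1)} → E^{⊗ (m + 1)}` for `A : E^{⊗ n} → E^{⊗ m}`. -/
def idTensor {n m : ℕ} (A : TPow E n →L[ℂ] TPow E m) : TPow E (n + 1) →L[ℂ] TPow E (m + 1) :=
  isometryConj (tpowSucc E n) (tpowSucc E m) (A.lTensor E)

/-- The vector `ξ ⊗ η` as an element of `E^{⊗ 2}`. -/
def ttwo (ξ η : E) : TPow E 2 := tcons 1 ξ (tone η)

variable (E) in
/-- `E^{⊗ 1} = E`. -/
def tpowOneEquiv : TPow E 1 ≃ₗᵢ[ℂ] E :=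
  ((tpowSucc E 0).trans ((tpowZero E).lTensor E)).trans (TensorProduct.ridIsometry ℂ E)

variable (E) in
/-- `E^{⊗ (n + 2)} = E^{⊗ 2} ⊗ E^{⊗ n}`. -/
def tpowSplit (n : ℕ) : TPow E (n + 2) ≃ₗᵢ[ℂ] TPow E 2 ⊗[ℂ] TPow E n :=
  ((tpowSucc E (n + 1)).trans
    (((tpowSucc E n).lTensor E).trans (TensorProduct.assocIsometry ℂ E E (TPow E n)).symm)).trans
      (((tpowSucc E 1).trans ((tpowOneEquiv E).lTensor E)).symm.rTensor (TPow E n))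

theorem tpowSplit_tcons (n : ℕ) (ξ η : E) (v : TPow E n) :
    tpowSplit E n (tcons (n + 1) ξ (tcons n η v)) = ttwo ξ η ⊗ₜ[ℂ] v := by
  simp [tpowSplit, tcons, ttwo, tone, tpowOneEquiv, tpowOne]

/-- `T_{i+1} = 1^{⊗ i} ⊗ T ⊗ 1^{⊗ (n - i - 2)}` on `E^{⊗ n}`, for `i + 2 ≤ n`
(positions are counted from `0`; the value is `0` if `i + 2 > n`). -/
def twistAt (T : TPow E 2 →L[ℂ] TPow E 2) : (i n : ℕ) → (TPow E n →L[ℂ] TPow E n)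
  | 0, n + 2 => isometryConj (tpowSplit E n) (tpowSplit E n) (T.rTensor (TPow E n))
  | i + 1, n + 1 => idTensor (twistAt T i n)
  | _, _ => 0

/-- The product `T_{a+1} T_{a+2} ⋯ T_b` on `E^{⊗ n}` (the identity if `b ≤ a`); its factors act at
the positions `a, a + 1, …, b - 1` counted from `0`. -/
def twistProd (T : TPow E 2 →L[ℂ] TPow E 2) (a b n : ℕ) : TPow E n →L[ℂ] TPow E n :=
  ((List.range' a (b - a)).map fun i => twistAt T i n).prod

/-- `R_{T,n} = 1 + T_1 + T_1 T_2 + ⋯ + T_1 ⋯ T_{n-1}`. -/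
def twistR (T : TPow E 2 →L[ℂ] TPow E 2) (n : ℕ) : TPow E n →L[ℂ] TPow E n :=
  ∑ k ∈ Finset.range n, twistProd T 0 k n

/-- `P_{T,0} = 1` and `P_{T,n+1} = (1 ⊗ P_{T,n}) R_{T,n+1}`; in particular `P_{T,1} = 1`. -/
def twistP (T : TPow E 2 →L[ℂ] TPow E 2) : (n : ℕ) → (TPow E n →L[ℂ] TPow E n)
  | 0 => 1
  | n + 1 => idTensor (twistP T n) * twistR T (n + 1)

end TensorPower

/-- Strict twists `T` on a finite dimensional Hilbert space with `‖T‖ < 1`: self-adjoint operators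
on `E ⊗ E` such that all the operators `P_{T,n}` are strictly positive. -/
structure StrictTwist (E : Type u) [NormedAddCommGroup E] [InnerProductSpace ℂ E]
    [FiniteDimensional ℂ E] where
  op : TPow E 2 →L[ℂ] TPow E 2
  isSymmetric : (op : TPow E 2 →ₗ[ℂ] TPow E 2).IsSymmetric
  norm_lt_one : ‖op‖ < 1
  strictlyPositive : ∀ n : ℕ, IsStrictlyPositive (twistP op n)

variable {E : Type u} [NormedAddCommGroup E] [InnerProductSpace ℂ E]

/-! ### Norm bounds -/

section Bounds

theorem norm_isometryConj_le {V V' W W' : Type*} [NormedAddCommGroup V] [InnerProductSpace ℂ V]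
    [NormedAddCommGroup V'] [InnerProductSpace ℂ V'] [NormedAddCommGroup W]
    [InnerProductSpace ℂ W] [NormedAddCommGroup W'] [InnerProductSpace ℂ W']
    (e : V ≃ₗᵢ[ℂ] V') (f : W ≃ₗᵢ[ℂ] W') (A : V' →L[ℂ] W') : ‖isometryConj e f A‖ ≤ ‖A‖ := by
  refine ContinuousLinearMap.opNorm_le_bound _ (norm_nonneg _) fun x => ?_
  calc _ = ‖A (e x)‖ := f.symm.norm_map _
    _ ≤ ‖A‖ * ‖e x‖ := A.le_opNorm _
    _ = _ := by rw [e.norm_map]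

theorem norm_idTensor_le {n m : ℕ} (A : TPow E n →L[ℂ] TPow E m) : ‖idTensor A‖ ≤ ‖A‖ :=
  (norm_isometryConj_le (tpowSucc E n) (tpowSucc E m) (A.lTensor E)).trans
    (ContinuousLinearMap.norm_lTensor_le E A)

theorem norm_twistAt_le (T : TPow E 2 →L[ℂ] TPow E 2) (i n : ℕ) : ‖twistAt T i n‖ ≤ ‖T‖ := by
  induction i generalizing n with
  | zero =>
    rcases n with _ | _ | n
    · simp [twistAt]
    · simp [twistAt]
    · rw [twistAt]
      exact (norm_isometryConj_le (tpowSplit E n) (tpowSplit E n) _).trans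
        (ContinuousLinearMap.norm_rTensor_le _ T)
  | succ i ih =>
    rcases n with _ | n
    · simp [twistAt]
    · rw [twistAt]
      exact (norm_idTensor_le _).trans (ih n)

theorem norm_twistProd_le (T : TPow E 2 →L[ℂ] TPow E 2) (a b n : ℕ) :
    ‖twistProd T a b n‖ ≤ ‖T‖ ^ (b - a) := by
  have key : ∀ l : List ℕ, ‖(l.map fun i => twistAt T i n).prod‖ ≤ ‖T‖ ^ l.length := by
    intro l
    induction l with
    | nil => exact ContinuousLinearMap.norm_id_le
    | cons i l ih =>
      rw [List.map_cons, List.prod_cons, List.length_cons, pow_succ']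
      exact (ContinuousLinearMap.opNorm_comp_le _ _).trans
        (mul_le_mul (norm_twistAt_le T i n) ih (norm_nonneg _) (norm_nonneg T))
  simpa [twistProd] using key (List.range' a (b - a))

theorem norm_twistR_le (T : TPow E 2 →L[ℂ] TPow E 2) (hT : ‖T‖ < 1) (n : ℕ) :
    ‖twistR T n‖ ≤ (1 - ‖T‖)⁻¹ := by
  calc ‖twistR T n‖ ≤ ∑ k ∈ Finset.range n, ‖T‖ ^ k := by
        refine norm_sum_le_of_le _ fun k _ => ?_
        exact norm_twistProd_le T 0 k n
    _ ≤ ∑' k, ‖T‖ ^ k :=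
        (summable_geometric_of_lt_one (norm_nonneg _) hT).sum_le_tsum _
          fun k _ => pow_nonneg (norm_nonneg _) _
    _ = _ := tsum_geometric_of_lt_one (norm_nonneg _) hT

end Bounds

theorem isometryConj_mul {V V' : Type*} [NormedAddCommGroup V] [InnerProductSpace ℂ V]
    [NormedAddCommGroup V'] [InnerProductSpace ℂ V']
    (e : V ≃ₗᵢ[ℂ] V') (A B : V' →L[ℂ] V') :
    isometryConj e e (A * B) = isometryConj e e A * isometryConj e e B := by
  ext x
  simp [isometryConj]

theorem idTensor_mul {n : ℕ} (A B : TPow E n →L[ℂ] TPow E n) :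
    idTensor (A * B) = idTensor A * idTensor B := by
  rw [idTensor, ContinuousLinearMap.lTensor_mul, isometryConj_mul]; rfl

theorem idTensor_tcons {n m : ℕ} (A : TPow E n →L[ℂ] TPow E m) (ξ : E) (v : TPow E n) :
    idTensor A (tcons n ξ v) = tcons m ξ (A v) := by
  simp [idTensor, isometryConj, tcons]

theorem inner_tcons {n : ℕ} (ξ η : E) (v w : TPow E n) :
    ⟪tcons n ξ v, tcons n η w⟫_ℂ = ⟪ξ, η⟫_ℂ * ⟪v, w⟫_ℂ := by
  simp [tcons]

theorem twist_inequality {A : Type*} [CStarAlgebra A] [PartialOrder A] [StarOrderedRing A]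
    (P Q R : A) (hP : 0 ≤ P) (hQ : 0 ≤ Q) (h : P = Q * R) : P ≤ ‖R‖ • Q := by
  have h1 : P * P ≤ (‖R‖ • Q) * (‖R‖ • Q) := by
    have h2 : P * P = star Q * (R * star R) * Q := by
      have : star P = P := hP.isSelfAdjoint
      calc P * P = P * star P := by rw [this]
        _ = _ := by rw [h, star_mul, hQ.isSelfAdjoint.star_eq]; simp only [mul_assoc]
    have h3 := CStarAlgebra.star_left_conjugate_le_norm_smul (a := Q) (b := R * star R) (by cfc_tac)
    rw [h2]
    refine h3.trans (le_of_eq ?_)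
    rw [hQ.isSelfAdjoint.star_eq, CStarRing.norm_self_mul_star, smul_mul_smul_comm]
  have := CFC.sqrt_le_sqrt _ _ h1
  rwa [CFC.sqrt_mul_self P hP, CFC.sqrt_mul_self _ (smul_nonneg (norm_nonneg _) hQ)] at this

theorem isometryConj_nonneg {V V' : Type*} [NormedAddCommGroup V] [InnerProductSpace ℂ V]
    [NormedAddCommGroup V'] [InnerProductSpace ℂ V'] [CompleteSpace V] [CompleteSpace V']
    (e : V ≃ₗᵢ[ℂ] V') {A : V' →L[ℂ] V'} (hA : 0 ≤ A) : 0 ≤ isometryConj e e A := by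
  rw [ContinuousLinearMap.nonneg_iff_isPositive] at *
  have key : ∀ x y, ⟪isometryConj e e A x, y⟫_ℂ = ⟪A (e x), e y⟫_ℂ := fun x y => by
    rw [← e.inner_map_map]; simp [isometryConj]
  refine ContinuousLinearMap.isPositive_def.2 ⟨fun x y => ?_, fun x => ?_⟩
  · change ⟪isometryConj e e A x, y⟫_ℂ = ⟪x, isometryConj e e A y⟫_ℂ
    rw [key, ← inner_conj_symm x, key, inner_conj_symm]
    exact hA.isSymmetric _ _
  · rw [ContinuousLinearMap.reApplyInnerSelf_apply, key]
    exact hA.re_inner_nonneg_left _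

theorem idTensor_nonneg [FiniteDimensional ℂ E] {n : ℕ} {A : TPow E n →L[ℂ] TPow E n}
    (hA : 0 ≤ A) : 0 ≤ idTensor A := by
  have : CompleteSpace E := FiniteDimensional.complete ℂ E
  have : CompleteSpace (E ⊗[ℂ] TPow E n) := FiniteDimensional.complete ℂ _
  obtain ⟨B, rfl⟩ := CStarAlgebra.nonneg_iff_eq_star_mul_self.1 hA
  refine isometryConj_nonneg _ ?_
  rw [ContinuousLinearMap.lTensor_mul, ContinuousLinearMap.star_eq_adjoint,
    ← ContinuousLinearMap.adjoint_lTensor, ← ContinuousLinearMap.star_eq_adjoint]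
  exact star_mul_self_nonneg _

section Fock

variable [FiniteDimensional ℂ E] (T : StrictTwist E)

theorem twistP_le (n : ℕ) :
    twistP T.op (n + 1) ≤ (1 - ‖T.op‖)⁻¹ • idTensor (twistP T.op n) := by
  have h1 := twist_inequality _ (idTensor (twistP T.op n)) (twistR T.op (n + 1))
    (T.strictlyPositive (n + 1)).1 (idTensor_nonneg (T.strictlyPositive n).1) rfl
  exact h1.trans (smul_le_smul_of_nonneg_right (norm_twistR_le _ T.norm_lt_one _)
    (idTensor_nonneg (T.strictlyPositive n).1))

/-- `E^{⊗ n}` with the deformed inner product `⟪v, P_{T,n} w⟫`. -/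
def FockFiber (_T : StrictTwist E) (n : ℕ) : Type u := TPow E n

instance fiberAddCommGroup (n : ℕ) : AddCommGroup (FockFiber T n) :=
  inferInstanceAs (AddCommGroup (TPow E n))

instance fiberModule (n : ℕ) : Module ℂ (FockFiber T n) :=
  inferInstanceAs (Module ℂ (TPow E n))

/-- The identity map `E^{⊗ n} → E^{⊗ n}`, onto `E^{⊗ n}` with the deformed inner product. -/
def toFiber (n : ℕ) : TPow E n ≃ₗ[ℂ] FockFiber T n := LinearEquiv.refl ℂ _

/-- The deformed inner product `⟪v, w⟫_T = ⟪v, P_{T,n} w⟫` on `E^{⊗ n}`. -/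
@[reducible] def fiberCore (n : ℕ) : InnerProductSpace.Core ℂ (FockFiber T n) where
  inner v w := ⟪(toFiber T n).symm v, twistP T.op n ((toFiber T n).symm w)⟫_ℂ
  conj_inner_symm v w := by
    have h := ((ContinuousLinearMap.nonneg_iff_isPositive _).1 (T.strictlyPositive n).1)
    rw [inner_conj_symm]
    exact h.isSymmetric _ _
  re_inner_nonneg v :=
    ((ContinuousLinearMap.nonneg_iff_isPositive _).1
      (T.strictlyPositive n).1).re_inner_nonneg_right _
  add_left v w z := by simp
  smul_left v w c := by simp [mul_comm]
  definite v hv := by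
    obtain ⟨h0, hu⟩ := T.strictlyPositive n
    obtain ⟨B, hB⟩ := CStarAlgebra.nonneg_iff_eq_star_mul_self.1 h0
    obtain ⟨u, hu⟩ := hu
    have h1 : B ((toFiber T n).symm v) = 0 := by
      rw [← inner_self_eq_zero (𝕜 := ℂ), ← ContinuousLinearMap.adjoint_inner_right,
        ← ContinuousLinearMap.star_eq_adjoint]
      rw [hB] at hv
      exact hv
    have h2 : (u : TPow E n →L[ℂ] TPow E n) ((toFiber T n).symm v) = 0 := by
      rw [hu, hB]
      change star B (B ((toFiber T n).symm v)) = 0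
      rw [h1, map_zero]
    have h3 : ((↑u⁻¹ : TPow E n →L[ℂ] TPow E n) * ↑u) ((toFiber T n).symm v) = 0 := by
      change (↑u⁻¹ : TPow E n →L[ℂ] TPow E n) (u.val ((toFiber T n).symm v)) = 0
      rw [h2, map_zero]
    rw [Units.inv_mul] at h3
    exact (toFiber T n).symm.map_eq_zero_iff.1 h3

instance fiberNormed (n : ℕ) : NormedAddCommGroup (FockFiber T n) :=
  (fiberCore T n).toNormedAddCommGroup

instance fiberInner (n : ℕ) : InnerProductSpace ℂ (FockFiber T n) :=
  InnerProductSpace.ofCore (fiberCore T n).toCore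

theorem fiber_inner (n : ℕ) (v w : TPow E n) :
    ⟪toFiber T n v, toFiber T n w⟫_ℂ = ⟪v, twistP T.op n w⟫_ℂ := rfl

attribute [irreducible] FockFiber fiberAddCommGroup fiberModule toFiber

instance (n : ℕ) : FiniteDimensional ℂ (FockFiber T n) := (toFiber T n).finiteDimensional

instance (n : ℕ) : CompleteSpace (FockFiber T n) := FiniteDimensional.complete ℂ _

/-- The `T`-twisted Fock space `⨁ₙ E^{⊗ n}`, a Hilbert space direct sum for the deformed inner
products. -/
abbrev Fock : Type u := lp (FockFiber T) 2

/-- The inclusion of `E^{⊗ n}` in the twisted Fock space. -/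
def toFock (n : ℕ) : TPow E n →ₗ[ℂ] Fock T := lp.lsingle 2 n ∘ₗ (toFiber T n).toLinearMap

/-- The vacuum vector. -/
def vacuum : Fock T := toFock T 0 (tpowOne E)

theorem one_le_bound : 1 ≤ (1 - ‖T.op‖)⁻¹ :=
  (one_le_inv₀ (sub_pos.2 T.norm_lt_one)).2 (sub_le_self _ (norm_nonneg _))

theorem norm_toFiber_tcons_le (n : ℕ) (ξ : E) (v : TPow E n) :
    ‖toFiber T (n + 1) (tcons n ξ v)‖ ≤ (1 - ‖T.op‖)⁻¹ * ‖ξ‖ * ‖toFiber T n v‖ := by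
  set c := (1 - ‖T.op‖)⁻¹ with hc
  have hc1 : 1 ≤ c := one_le_bound T
  have h1 := ((ContinuousLinearMap.le_def _ _).1 (twistP_le T n)).re_inner_nonneg_right
    (tcons n ξ v)
  have h2 : RCLike.re ⟪tcons n ξ v, idTensor (twistP T.op n) (tcons n ξ v)⟫_ℂ =
      ‖ξ‖ ^ 2 * ‖toFiber T n v‖ ^ 2 := by
    rw [idTensor_tcons, inner_tcons, ← fiber_inner, inner_self_eq_norm_sq_to_K,
      inner_self_eq_norm_sq_to_K]
    norm_cast
  have h3 : ‖toFiber T (n + 1) (tcons n ξ v)‖ ^ 2 ≤ c * (‖ξ‖ ^ 2 * ‖toFiber T n v‖ ^ 2) := by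
    rw [← inner_self_eq_norm_sq (𝕜 := ℂ), fiber_inner, ← h2]
    have h4 : ((c • idTensor (twistP T.op n) - twistP T.op (n + 1)) (tcons n ξ v)) =
        (c : ℂ) • idTensor (twistP T.op n) (tcons n ξ v) - twistP T.op (n + 1) (tcons n ξ v) := rfl
    rw [h4, inner_sub_right, inner_smul_right, map_sub] at h1
    simp only [RCLike.re_to_complex, Complex.re_ofReal_mul] at h1 ⊢
    linarith
  refine abs_le_of_sq_le_sq' ?_ (by positivity) |>.2
  have : 0 ≤ ‖ξ‖ ^ 2 * ‖toFiber T n v‖ ^ 2 := by positivity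
  nlinarith [mul_nonneg (mul_nonneg (sub_nonneg.2 hc1) (zero_le_one.trans hc1)) this]

/-- The left creation operator `v ↦ ξ ⊗ v` on `E^{⊗ n}`. -/
def fiberCreation (ξ : E) (n : ℕ) : FockFiber T n →ₗ[ℂ] FockFiber T (n + 1) :=
  (toFiber T (n + 1)).toLinearMap ∘ₗ tcons n ξ ∘ₗ (toFiber T n).symm.toLinearMap

theorem norm_fiberCreation_le (ξ : E) (n : ℕ) (x : FockFiber T n) :
    ‖fiberCreation T ξ n x‖ ≤ (1 - ‖T.op‖)⁻¹ * ‖ξ‖ * ‖x‖ := by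
  simpa using! norm_toFiber_tcons_le T n ξ ((toFiber T n).symm x)

/-- The components of `a_T^*(ξ) f`. -/
def creationFun (ξ : E) (f : ∀ n, FockFiber T n) : ∀ n, FockFiber T n
  | 0 => 0
  | n + 1 => fiberCreation T ξ n (f n)

theorem memℓp_creationFun (ξ : E) (f : Fock T) : Memℓp (creationFun T ξ f) 2 := by
  have hf := lp.memℓp f
  rw [memℓp_gen_iff (by norm_num)] at hf ⊢
  rw [← summable_nat_add_iff 1]
  refine Summable.of_nonneg_of_le (fun n => by positivity) (fun n => ?_)
    (hf.mul_left (((1 - ‖T.op‖)⁻¹ * ‖ξ‖) ^ (2 : ENNReal).toReal))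
  have h0 : 0 ≤ (1 - ‖T.op‖)⁻¹ * ‖ξ‖ :=
    mul_nonneg (zero_le_one.trans (one_le_bound T)) (norm_nonneg _)
  rw [← Real.mul_rpow h0 (norm_nonneg _)]
  exact Real.rpow_le_rpow (norm_nonneg _) (norm_fiberCreation_le T ξ n (f n)) (by norm_num)

/-- The left creation operator on the twisted Fock space, as a linear map. -/
def creationLinear (ξ : E) : Fock T →ₗ[ℂ] Fock T where
  toFun f := ⟨creationFun T ξ f, memℓp_creationFun T ξ f⟩
  map_add' f g := by
    ext n
    cases n with
    | zero => exact (add_zero (0 : FockFiber T 0)).symm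
    | succ n => exact (fiberCreation T ξ n).map_add (f n) (g n)
  map_smul' c f := by
    ext n
    cases n with
    | zero => exact (smul_zero c).symm
    | succ n => exact (fiberCreation T ξ n).map_smul c (f n)

theorem norm_creationLinear_le (ξ : E) (f : Fock T) :
    ‖creationLinear T ξ f‖ ≤ (1 - ‖T.op‖)⁻¹ * ‖ξ‖ * ‖f‖ := by
  have h0 : 0 ≤ (1 - ‖T.op‖)⁻¹ * ‖ξ‖ :=
    mul_nonneg (zero_le_one.trans (one_le_bound T)) (norm_nonneg _)
  have hp : 0 < (2 : ENNReal).toReal := by norm_num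
  refine (Real.rpow_le_rpow_iff (norm_nonneg _) (by positivity) hp).1 ?_
  rw [Real.mul_rpow h0 (norm_nonneg _), lp.norm_rpow_eq_tsum hp, lp.norm_rpow_eq_tsum hp,
    ← tsum_mul_left]
  have hs := (memℓp_gen_iff hp).1 (lp.memℓp (creationLinear T ξ f))
  rw [hs.tsum_eq_zero_add]
  have hz : ‖creationLinear T ξ f 0‖ ^ (2 : ENNReal).toReal = 0 := by
    have : creationLinear T ξ f 0 = 0 := rfl
    rw [this]
    simp
  rw [hz, zero_add]
  refine Summable.tsum_le_tsum (fun n => ?_) ((summable_nat_add_iff 1).2 hs)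
    (((memℓp_gen_iff hp).1 (lp.memℓp f)).mul_left _)
  rw [← Real.mul_rpow h0 (norm_nonneg _)]
  exact Real.rpow_le_rpow (norm_nonneg _) (norm_fiberCreation_le T ξ n (f n)) hp.le

/-- The left creation operator `a_T^*(ξ)` on the twisted Fock space, determined by
`a_T^*(ξ) v = ξ ⊗ v` for `v ∈ E^{⊗ n}`. -/
def creation (ξ : E) : Fock T →L[ℂ] Fock T :=
  (creationLinear T ξ).mkContinuous ((1 - ‖T.op‖)⁻¹ * ‖ξ‖) (norm_creationLinear_le T ξ)

theorem creation_toFock (ξ : E) (n : ℕ) (v : TPow E n) :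
    creation T ξ (toFock T n v) = toFock T (n + 1) (tcons n ξ v) := by
  have h : ∀ m (f : Fock T), creation T ξ f (m + 1) = fiberCreation T ξ m (f m) :=
    fun m f => rfl
  have e : ∀ m k (w : TPow E m), toFock T m w k = Pi.single m (toFiber T m w) k :=
    fun m k w => rfl
  ext k
  cases k with
  | zero =>
    rw [e]
    exact (Pi.single_eq_of_ne (Nat.succ_ne_zero n).symm _).symm
  | succ k =>
    rw [h, e, e]
    by_cases hk : k = n
    · subst hk
      simp [fiberCreation]
    · rw [Pi.single_eq_of_ne hk, Pi.single_eq_of_ne (by simpa using hk), map_zero]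

end Fock

/-! ### Standard subspaces and their modular data -/

section Modular

variable (H : StandardSubspace E)

theorem eq_zero_of_add_I_smul {h k : E} (hh : h ∈ H.toClosedSubmodule)
    (hk : k ∈ H.toClosedSubmodule) (h0 : h + Complex.I • k = 0) : h = 0 ∧ k = 0 := by
  have hmem : h ∈ H.toClosedSubmodule ⊓ H.toClosedSubmodule.mulI := by
    refine ⟨hh, ⟨-k, H.toClosedSubmodule.toSubmodule.neg_mem hk, ?_⟩⟩
    change Complex.I • (-k) = h
    rw [smul_neg, eq_comm]
    exact eq_neg_of_add_eq_zero_left h0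
  rw [H.IsSeparating] at hmem
  have h1 : h = 0 := ClosedSubmodule.mem_bot.1 hmem
  refine ⟨h1, ?_⟩
  rw [h1, zero_add] at h0
  exact (smul_eq_zero.1 h0).resolve_left Complex.I_ne_zero

variable [FiniteDimensional ℂ E]

theorem exists_add_I_smul (x : E) :
    ∃ h ∈ H.toClosedSubmodule, ∃ k ∈ H.toClosedSubmodule, x = h + Complex.I • k := by
  have hx : x ∈ H.toClosedSubmodule ⊔ H.toClosedSubmodule.mulI := by
    rw [H.IsCyclic]
    exact ClosedSubmodule.mem_top
  have : FiniteDimensional ℝ E := Module.Finite.trans ℂ E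
  rw [ClosedSubmodule.mem_sup] at hx
  have hc : IsClosed (H.toClosedSubmodule.toSubmodule ⊔
      H.toClosedSubmodule.mulI.toSubmodule).carrier := Submodule.closed_of_finiteDimensional _
  rw [hc.closure_eq] at hx
  obtain ⟨h, hh, y, hy, rfl⟩ := Submodule.mem_sup.1 hx
  obtain ⟨k, hk, rfl⟩ := hy
  exact ⟨h, hh, k, hk, rfl⟩

/-- The map `h + i k ↦ h - i k` for `h, k ∈ H`. -/
def tomitaFun (x : E) : E :=
  (exists_add_I_smul H x).choose - Complex.I • (exists_add_I_smul H x).choose_spec.2.choose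

theorem tomitaFun_apply {h k : E} (hh : h ∈ H.toClosedSubmodule) (hk : k ∈ H.toClosedSubmodule) :
    tomitaFun H (h + Complex.I • k) = h - Complex.I • k := by
  set x := h + Complex.I • k with hx
  have h1 := (exists_add_I_smul H x).choose_spec.1
  have h2 := (exists_add_I_smul H x).choose_spec.2.choose_spec.1
  have h3 := (exists_add_I_smul H x).choose_spec.2.choose_spec.2
  have key : ∀ h' k' : E, h' ∈ H.toClosedSubmodule → k' ∈ H.toClosedSubmodule →
      x = h' + Complex.I • k' → h' - Complex.I • k' = h - Complex.I • k := by
    intro h' k' hh' hk' e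
    have h4 := eq_zero_of_add_I_smul H (H.toClosedSubmodule.toSubmodule.sub_mem hh' hh)
      (H.toClosedSubmodule.toSubmodule.sub_mem hk' hk)
      (by rw [smul_sub, sub_add_sub_comm, ← e, hx, sub_self])
    rw [sub_eq_zero.1 h4.1, sub_eq_zero.1 h4.2]
  exact key _ _ h1 h2 h3

/-- The Tomita operator of a standard subspace `H`: the antilinear involution of `E = H + iH` with
`S (h + i k) = h - i k` for `h, k ∈ H`. -/
def tomita : E →ₛₗ[starRingEnd ℂ] E where
  toFun := tomitaFun H
  map_add' x y := by
    obtain ⟨h, hh, k, hk, rfl⟩ := exists_add_I_smul H x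
    obtain ⟨h', hh', k', hk', rfl⟩ := exists_add_I_smul H y
    rw [add_add_add_comm, ← smul_add, tomitaFun_apply H
      (H.toClosedSubmodule.toSubmodule.add_mem hh hh')
      (H.toClosedSubmodule.toSubmodule.add_mem hk hk'),
      tomitaFun_apply H hh hk, tomitaFun_apply H hh' hk', smul_add]
    abel
  map_smul' c x := by
    obtain ⟨h, hh, k, hk, rfl⟩ := exists_add_I_smul H x
    have hr : ∀ (r : ℝ) {z : E}, z ∈ H.toClosedSubmodule → (r : ℂ) • z ∈ H.toClosedSubmodule := by
      intro r z hz
      rw [Complex.coe_smul]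
      exact H.toClosedSubmodule.toSubmodule.smul_mem r hz
    have e : c • (h + Complex.I • k) = ((c.re : ℂ) • h - (c.im : ℂ) • k) +
        Complex.I • ((c.im : ℂ) • h + (c.re : ℂ) • k) := by
      have hI : (c.im * Complex.I * Complex.I : ℂ) = -c.im := by
        rw [mul_assoc, Complex.I_mul_I, mul_neg_one]
      have hc : c • (h + Complex.I • k) =
          ((c.re : ℂ) + c.im * Complex.I) • (h + Complex.I • k) := by rw [Complex.re_add_im]
      rw [hc]
      simp only [smul_add, add_smul, smul_smul, add_mul, hI, neg_smul, mul_comm Complex.I]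
      abel
    have e' : (starRingEnd ℂ) c = (c.re : ℂ) - c.im * Complex.I := by
      apply Complex.ext <;> simp
    rw [e, tomitaFun_apply H
      (H.toClosedSubmodule.toSubmodule.sub_mem (hr _ hh) (hr _ hk))
      (H.toClosedSubmodule.toSubmodule.add_mem (hr _ hh) (hr _ hk)),
      tomitaFun_apply H hh hk, e']
    have hI : (c.im * Complex.I * Complex.I : ℂ) = -c.im := by
      rw [mul_assoc, Complex.I_mul_I, mul_neg_one]
    simp only [smul_sub, smul_add, sub_smul, smul_smul, sub_mul, hI, neg_smul, mul_comm Complex.I]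
    abel

theorem tomita_apply {h k : E} (hh : h ∈ H.toClosedSubmodule) (hk : k ∈ H.toClosedSubmodule) :
    tomita H (h + Complex.I • k) = h - Complex.I • k := tomitaFun_apply H hh hk

/-- The modular operator `Δ = S^* S`, i.e. the operator with `⟪x, Δ y⟫ = ⟪S y, S x⟫`. -/
def modularOp : E →L[ℂ] E :=
  LinearMap.toContinuousLinearMap
    { toFun := fun y => ∑ i, ⟪tomita H y, tomita H (stdOrthonormalBasis ℂ E i)⟫_ℂ •
        stdOrthonormalBasis ℂ E i
      map_add' := fun x y => by simp [add_smul, Finset.sum_add_distrib]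
      map_smul' := fun c x => by simp [mul_smul, Finset.smul_sum, smul_comm c] }

theorem inner_modularOp (x y : E) : ⟪x, modularOp H y⟫_ℂ = ⟪tomita H y, tomita H x⟫_ℂ := by
  have h : modularOp H y = ∑ i, ⟪tomita H y, tomita H (stdOrthonormalBasis ℂ E i)⟫_ℂ •
        stdOrthonormalBasis ℂ E i := rfl
  conv_rhs => rw [← (stdOrthonormalBasis ℂ E).sum_repr' x]
  simp only [h, inner_sum, map_sum, map_smulₛₗ, inner_smul_right, inner_conj_symm]
  exact Finset.sum_congr rfl fun i _ => mul_comm _ _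

/-- The complex powers `Δ^z` of the modular operator. -/
def modularPow (z : ℂ) : E →L[ℂ] E :=
  have : CompleteSpace E := FiniteDimensional.complete ℂ E
  cfc (fun x : ℂ => x ^ z) (modularOp H)

/-- The modular conjugation `J = S Δ^{-1/2}`. -/
def modularConj (x : E) : E := tomita H (modularPow H (-1 / 2) x)

/-- An orthonormal basis `e₁, …, e_d` of the real Hilbert space `(H, Re ⟪·, ·⟫)`. -/
structure IsRealOrthonormalBasis {d : ℕ} (e : Fin d → E) : Prop where
  re_inner : ∀ i j, (⟪e i, e j⟫_ℂ).re = if i = j then 1 else 0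
  span_eq : Submodule.span ℝ (Set.range e) = H.toClosedSubmodule.toSubmodule

variable {H}

/-- An orthonormal basis of the real Hilbert space `H` is a complex basis of `E = H + iH`. -/
def IsRealOrthonormalBasis.basis {d : ℕ} {e : Fin d → E} (he : IsRealOrthonormalBasis H e) :
    Module.Basis (Fin d) ℂ E :=
  Module.Basis.mk (v := e)
    (by
      rw [Fintype.linearIndependent_iff]
      intro g hg
      have hm : ∀ i, e i ∈ H.toClosedSubmodule := fun i => by
        have : e i ∈ H.toClosedSubmodule.toSubmodule := by
          rw [← he.span_eq]; exact Submodule.subset_span ⟨i, rfl⟩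
        exact this
      have hs : ∀ r : Fin d → ℝ, ∑ i, r i • e i ∈ H.toClosedSubmodule := fun r =>
        Submodule.sum_mem H.toClosedSubmodule.toSubmodule fun i _ => H.toClosedSubmodule.toSubmodule.smul_mem _ (hm i)
      have h0 : (∑ i, (g i).re • e i) + Complex.I • (∑ i, (g i).im • e i) = 0 := by
        rw [← hg, Finset.smul_sum, ← Finset.sum_add_distrib]
        refine Finset.sum_congr rfl fun i _ => ?_
        nth_rewrite 3 [← Complex.re_add_im (g i)]
        rw [add_smul, mul_comm, mul_smul, Complex.coe_smul, Complex.coe_smul]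
      obtain ⟨h1, h2⟩ := eq_zero_of_add_I_smul H (hs _) (hs _) h0
      have hz : ∀ r : Fin d → ℝ, ∑ i, r i • e i = 0 → ∀ j, r j = 0 := by
        intro r hr j
        have := congrArg (fun x => (⟪e j, x⟫_ℂ).re) hr
        simpa [inner_sum, inner_smul_right_eq_smul, he.re_inner] using this
      exact fun i => Complex.ext (hz _ h1 i) (hz _ h2 i))
    (by
      rintro x -
      have hr : ∀ h ∈ H.toClosedSubmodule, h ∈ Submodule.span ℂ (Set.range e) := by
        intro h hh
        have : h ∈ Submodule.span ℝ (Set.range e) := by rw [he.span_eq]; exact hh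
        exact Submodule.span_le_restrictScalars ℝ ℂ _ this
      obtain ⟨h, hh, k, hk, rfl⟩ := exists_add_I_smul H x
      exact add_mem (hr h hh) (Submodule.smul_mem _ _ (hr k hk)))

/-- The matrix `A` of `Δ⁻¹` in the basis `e₁, …, e_d`. -/
def IsRealOrthonormalBasis.modularMatrix {d : ℕ} {e : Fin d → E}
    (he : IsRealOrthonormalBasis H e) : Matrix (Fin d) (Fin d) ℂ :=
  LinearMap.toMatrix he.basis he.basis (modularPow H (-1)).toLinearMap

end Modular

/-! ### Twisted Araki-Woods algebras -/

section ArakiWoods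

variable (E) in
/-- `E^{⊗ 2} = E ⊗ E`. -/
def tpowTwo : TPow E 2 ≃ₗᵢ[ℂ] E ⊗[ℂ] E :=
  (tpowSucc E 1).trans ((tpowOneEquiv E).lTensor E)

theorem tpowTwo_ttwo (ξ η : E) : tpowTwo E (ttwo ξ η) = ξ ⊗ₜ[ℂ] η := by
  simp [tpowTwo, ttwo, tcons, tone, tpowOneEquiv, tpowOne]

/-- The operator `A ⊗ B` on `E^{⊗ 2}`. -/
def tensorOp (A B : E →L[ℂ] E) : TPow E 2 →L[ℂ] TPow E 2 :=
  isometryConj (tpowTwo E) (tpowTwo E) ((A.rTensor E) ∘L (B.lTensor E))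

theorem tensorOp_ttwo (A B : E →L[ℂ] E) (ξ η : E) :
    tensorOp A B (ttwo ξ η) = ttwo (A ξ) (B η) := by
  apply (tpowTwo E).injective
  simp [tensorOp, isometryConj, tpowTwo_ttwo]

variable [FiniteDimensional ℂ E] (T : StrictTwist E) (H : StandardSubspace E)

/-- The Yang-Baxter equation `T_1 T_2 T_1 = T_2 T_1 T_2` on `E^{⊗ 3}`. -/
def IsBraided : Prop :=
  twistAt T.op 0 3 * twistAt T.op 1 3 * twistAt T.op 0 3 =
    twistAt T.op 1 3 * twistAt T.op 0 3 * twistAt T.op 1 3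

/-- `T` is compatible with `H`: it commutes with all the operators `Δ^{it} ⊗ Δ^{it}`. -/
def IsCompatible : Prop :=
  ∀ t : ℝ, Commute (tensorOp (modularPow H (t * Complex.I)) (modularPow H (t * Complex.I))) T.op

/-- Crossing symmetry: for all `ψ₁, …, ψ₄` the function
`t ↦ ⟪ψ₂ ⊗ ψ₁, (Δ^{it} ⊗ 1) T (1 ⊗ Δ^{-it}) (ψ₃ ⊗ ψ₄)⟫` on the real line extends to a bounded
continuous function on the strip `0 ≤ Im z ≤ 1/2`, analytic in its interior, with the boundary values
`t + i/2 ↦ ⟪ψ₁ ⊗ J ψ₄, (1 ⊗ Δ^{it}) T (Δ^{-it} ⊗ 1) (J ψ₂ ⊗ ψ₃)⟫`. -/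
def IsCrossingSymmetric : Prop :=
  ∀ ψ₁ ψ₂ ψ₃ ψ₄ : E, ∃ f : ℂ → ℂ,
    ContinuousOn f {z | 0 ≤ z.im ∧ z.im ≤ 1 / 2} ∧
    (∃ C : ℝ, ∀ z : ℂ, 0 ≤ z.im → z.im ≤ 1 / 2 → ‖f z‖ ≤ C) ∧
    DifferentiableOn ℂ f {z | 0 < z.im ∧ z.im < 1 / 2} ∧
    ∀ t : ℝ,
      f t = ⟪ttwo ψ₂ ψ₁, tensorOp (modularPow H (t * Complex.I)) 1
        (T.op (tensorOp 1 (modularPow H (-(t * Complex.I))) (ttwo ψ₃ ψ₄)))⟫_ℂ ∧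
      f (t + Complex.I / 2) = ⟪ttwo ψ₁ (modularConj H ψ₄), tensorOp 1 (modularPow H (t * Complex.I))
        (T.op (tensorOp (modularPow H (-(t * Complex.I))) 1 (ttwo (modularConj H ψ₂) ψ₃)))⟫_ℂ

/-- The left annihilation operator `a(ξ) = a^*(ξ)^*`. -/
def annihilation (ξ : E) : Fock T →L[ℂ] Fock T := ContinuousLinearMap.adjoint (creation T ξ)

/-- The left field operator `X_T(ξ) = a^*(ξ) + a(S ξ)`. -/
def fieldOp (ξ : E) : Fock T →L[ℂ] Fock T := creation T ξ + annihilation T (tomita H ξ)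

/-- The twisted Araki-Woods von Neumann algebra: the bicommutant of the field operators `X_T(ξ)`
with `ξ ∈ H`. -/
def arakiWoods : VonNeumannAlgebra (Fock T) where
  toStarSubalgebra := StarSubalgebra.centralizer ℂ
    (StarSubalgebra.centralizer ℂ (fieldOp T H '' {ξ | ξ ∈ H.toClosedSubmodule}) :
      Set (Fock T →L[ℂ] Fock T))
  centralizer_centralizer' := by
    have h : ∀ s : Set (Fock T →L[ℂ] Fock T),
        Set.centralizer (Set.centralizer (StarSubalgebra.centralizer ℂ
          (StarSubalgebra.centralizer ℂ s : Set (Fock T →L[ℂ] Fock T)) :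
            Set (Fock T →L[ℂ] Fock T))) = (StarSubalgebra.centralizer ℂ
          (StarSubalgebra.centralizer ℂ s : Set (Fock T →L[ℂ] Fock T)) :
            Set (Fock T →L[ℂ] Fock T)) := fun s => by
      rw [StarSubalgebra.coe_centralizer_centralizer, Set.centralizer_centralizer_centralizer]
    exact h _

end ArakiWoods

/-! ### Incomplete matchings and twisted contractions -/

section Contractions

variable [FiniteDimensional ℂ E] (T : StrictTwist E) (H : StandardSubspace E)

/-- The linear functional `ξ ⊗ η ↦ ⟪S ξ, η⟫` on `E^{⊗ 2}`. -/
def pairing : TPow E 2 →ₗ[ℂ] ℂ :=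
  TensorProduct.lift
    (LinearMap.mk₂ ℂ (fun ξ η : E => ⟪tomita H ξ, η⟫_ℂ)
      (fun x y z => by rw [map_add, inner_add_left])
      (fun c x y => by rw [map_smulₛₗ, inner_smul_left, Complex.conj_conj, smul_eq_mul])
      (fun x y z => inner_add_right _ _ _)
      (fun c x y => inner_smul_right _ _ _)) ∘ₗ (tpowTwo E).toLinearEquiv.toLinearMap

/-- The contraction operators
`C_{i+1} (ξ₁ ⊗ ⋯ ⊗ ξ_{k+2}) = ⟪S ξ_{i+1}, ξ_{i+2}⟫ ξ₁ ⊗ ⋯ ⊗ ξ_i ⊗ ξ_{i+3} ⊗ ⋯ ⊗ ξ_{k+2}` for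
`i ≤ k` (positions are counted from `0`; the value is `0` if `i > k`). -/
def contraction : (i k : ℕ) → (TPow E (k + 2) →L[ℂ] TPow E k)
  | 0, k => LinearMap.toContinuousLinearMap
      ((TensorProduct.lid ℂ (TPow E k)).toLinearMap ∘ₗ (pairing H).rTensor (TPow E k) ∘ₗ
        (tpowSplit E k).toLinearEquiv.toLinearMap)
  | i + 1, k + 1 => idTensor (contraction i k)
  | _ + 1, 0 => 0

theorem contraction_zero_tcons (k : ℕ) (ξ η : E) (v : TPow E k) :
    contraction H 0 k (tcons (k + 1) ξ (tcons k η v)) = ⟪tomita H ξ, η⟫_ℂ • v := by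
  simp [contraction, tpowSplit_tcons, pairing, tpowTwo_ttwo]

theorem contraction_succ_tcons (i k : ℕ) (ξ : E) (v : TPow E (k + 2)) :
    contraction H (i + 1) (k + 1) (tcons (k + 2) ξ v) = tcons k ξ (contraction H i k v) := by
  rw [contraction]
  exact idTensor_tcons _ _ _

/-- The operator `C_a T_{a+1} T_{a+2} ⋯ T_{b-1}` contracting the positions `a < b` of
`E^{⊗ (k + 2)}`. -/
def twistedContraction (a b k : ℕ) : TPow E (k + 2) →L[ℂ] TPow E k :=
  contraction H a k ∘L twistProd T.op (a + 1) b (k + 2)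

/-- The composition of the twisted contractions at the pairs of positions in a list, the first pair
of the list being contracted first. If `N ≠ m + 2 s` for lists of length `s`, its value is `0`. -/
def contractList : List (ℕ × ℕ) → (N m : ℕ) → (TPow E N →L[ℂ] TPow E m)
  | [], N, m => if h : N = m then h ▸ ContinuousLinearMap.id ℂ (TPow E N) else 0
  | p :: l, k + 2, m => contractList l k m ∘L twistedContraction T H p.1 p.2 k
  | _ :: _, _, _ => 0

/-- The number of points `y < x` that belong to a pair `{y, π y}` with left end point `< i`. -/
def removedBefore {N : ℕ} (π : Equiv.Perm (Fin N)) (i x : Fin N) : ℕ :=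
  (Finset.univ.filter fun y => y < x ∧ π y ≠ y ∧ min y (π y) < i).card

/-- An incomplete matching of `N` points is given as the involution `π` that exchanges the two
points of every pair and fixes the singletons. Its pairs `{i, π i}`, `i < π i`, are listed in the
order of their left end points `i`; each of them is recorded by the positions of its end points
after removal of the preceding pairs. -/
def matchingPositions {N : ℕ} (π : Equiv.Perm (Fin N)) : List (ℕ × ℕ) :=
  ((List.finRange N).filter fun i : Fin N => i < π i).map fun i : Fin N =>
    ((i : ℕ) - removedBefore π i i, (π i : ℕ) - removedBefore π i (π i))

/-- The twisted contraction operator `W_π : E^{⊗ N} → E^{⊗ m}` of an incomplete matching `π` with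
`m` singletons (the value is `0` if `m` is not the number of singletons). -/
def wickContraction {N : ℕ} (π : Equiv.Perm (Fin N)) (m : ℕ) : TPow E N →L[ℂ] TPow E m :=
  contractList T H (matchingPositions π) N m

/-- `B(2n+1)`: the incomplete matchings of `2n+1` points in which the middle point is a singleton
and each of the first `n` points is paired with one of the last `n` points. -/
def matchingsB (n : ℕ) : Finset (Equiv.Perm (Fin (2 * n + 1))) :=
  Finset.univ.filter fun π => (∀ k, π (π k) = k) ∧ (∀ k : Fin (2 * n + 1), (k : ℕ) = n → π k = k) ∧
    ∀ k : Fin (2 * n + 1), (k : ℕ) < n → n < (π k : ℕ)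

/-- The component `P_{T,2n+1}^{-1} ∑_{π ∈ B(2n+1)} W_π^* ξ` of degree `2n+1`, where `W_π^*` is the
adjoint for the undeformed inner products. -/
def conjugateTerm (n : ℕ) (ξ : E) : TPow E (2 * n + 1) :=
  Ring.inverse (twistP T.op (2 * n + 1))
    (∑ π ∈ matchingsB n, ContinuousLinearMap.adjoint (wickContraction T H π 1) (tone ξ))

end Contractions

/-! ### Free and quasi-free difference quotients -/

section DifferenceQuotients

variable {d : ℕ}

/-- The noncommutative monomial `x_{j₁} ⋯ x_{j_k}`. -/
def monomial (w : List (Fin d)) : FreeAlgebra ℂ (Fin d) := (w.map (FreeAlgebra.ι ℂ)).prod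

/-- The free difference quotient: `∂_i (x_{j₁} ⋯ x_{j_k})` is the sum over all `m` with `j_m = i` of
`x_{j₁} ⋯ x_{j_{m-1}} ⊗ x_{j_{m+1}} ⋯ x_{j_k}`. -/
def freeDifferenceQuotient (i : Fin d) :
    FreeAlgebra ℂ (Fin d) →ₗ[ℂ] FreeAlgebra ℂ (Fin d) ⊗[ℂ] FreeAlgebra ℂ (Fin d) :=
  (FreeAlgebra.basisFreeMonoid ℂ (Fin d)).constr ℂ fun w =>
    ∑ m : Fin w.toList.length, if w.toList.get m = i then
      monomial (w.toList.take m) ⊗ₜ[ℂ] monomial (w.toList.drop (m + 1)) else 0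

theorem basisFreeMonoid_ofList (w : List (Fin d)) :
    FreeAlgebra.basisFreeMonoid ℂ (Fin d) (FreeMonoid.ofList w) = monomial w := by
  have h : FreeAlgebra.basisFreeMonoid ℂ (Fin d) (FreeMonoid.ofList w) =
      FreeAlgebra.equivMonoidAlgebraFreeMonoid.symm
        (MonoidAlgebra.of ℂ (FreeMonoid (Fin d)) (FreeMonoid.ofList w)) := rfl
  rw [h]
  induction w with
  | nil => simp [monomial, MonoidAlgebra.one_def]
  | cons j w ih =>
    rw [FreeMonoid.ofList_cons, map_mul, map_mul, ih rfl, monomial, monomial, List.map_cons,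
      List.prod_cons]
    congr 1
    simp [FreeAlgebra.equivMonoidAlgebraFreeMonoid]

theorem freeDifferenceQuotient_monomial (i : Fin d) (w : List (Fin d)) :
    freeDifferenceQuotient i (monomial w) =
      ∑ m : Fin w.length, if w.get m = i then
        monomial (w.take m) ⊗ₜ[ℂ] monomial (w.drop (m + 1)) else 0 := by
  rw [← basisFreeMonoid_ofList, freeDifferenceQuotient, Module.Basis.constr_basis]
  rfl

/-- The quasi-free difference quotient `ð_i = ∑_k [2 / (1 + A)]_{ki} ∂_k`. -/
def quasiFreeDifferenceQuotient (A : Matrix (Fin d) (Fin d) ℂ) (i : Fin d) :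
    FreeAlgebra ℂ (Fin d) →ₗ[ℂ] FreeAlgebra ℂ (Fin d) ⊗[ℂ] FreeAlgebra ℂ (Fin d) :=
  ∑ k, ((2 : ℂ) • (1 + A)⁻¹) k i • freeDifferenceQuotient k

variable {K : Type*} [NormedAddCommGroup K] [InnerProductSpace ℂ K] [CompleteSpace K]

/-- The vector state `φ(a) = ⟪Ω, a Ω⟫`. -/
def vectorState (Ω : K) : (K →L[ℂ] K) →ₗ[ℂ] ℂ where
  toFun a := ⟪Ω, a Ω⟫_ℂ
  map_add' a b := by simp
  map_smul' c a := by simp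

/-- The number `(φ ⊗ φ^op) (q(X))` for `q ∈ ℂ⟨x⟩ ⊗ ℂ⟨x⟩`, that is
`p₁ ⊗ p₂ ↦ φ(p₁(X)) φ(p₂(X))`. -/
def tensorState (φ : (K →L[ℂ] K) →ₗ[ℂ] ℂ) (X : Fin d → K →L[ℂ] K) :
    FreeAlgebra ℂ (Fin d) ⊗[ℂ] FreeAlgebra ℂ (Fin d) →ₗ[ℂ] ℂ :=
  LinearMap.mul' ℂ ℂ ∘ₗ TensorProduct.map (φ ∘ₗ (FreeAlgebra.lift ℂ X).toLinearMap)
    (φ ∘ₗ (FreeAlgebra.lift ℂ X).toLinearMap)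

/-- `(Θ₁, …, Θ_d)` is a conjugate system for `X₁, …, X_d ∈ M` with respect to the linear maps
`D₁, …, D_d : ℂ⟨x⟩ → ℂ⟨x⟩ ⊗ ℂ⟨x⟩` and the vector state `φ(a) = ⟪Ω, a Ω⟫`: the `Θ_i` belong to
`L²(M, φ) = closure (M Ω)` and
`⟪Θ_i, p(X) Ω⟫ = ⟪1 ⊗ 1, (D_i p)(X)⟫_{φ ⊗ φ^op}` for all `p`; in other words
`Θ_i = D_i^* (1 ⊗ 1)`. -/
def IsConjugateSystem (M : VonNeumannAlgebra K) (Ω : K) (X : Fin d → K →L[ℂ] K)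
    (D : Fin d → FreeAlgebra ℂ (Fin d) →ₗ[ℂ] FreeAlgebra ℂ (Fin d) ⊗[ℂ] FreeAlgebra ℂ (Fin d))
    (Θ : Fin d → K) : Prop :=
  ∀ i, Θ i ∈ closure {v | ∃ a ∈ M, v = a Ω} ∧
    ∀ p : FreeAlgebra ℂ (Fin d),
      ⟪Θ i, FreeAlgebra.lift ℂ X p Ω⟫_ℂ = tensorState (vectorState Ω) X (D i p)

end DifferenceQuotients

end

end TwistedFock

open scoped ComplexOrder

/-!
The conjugate variables are found by solving the adjoint problem. A *dual operator* is a linear map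
`D` from vectors of finite degree in the Fock space to vectors of finite degree with one more,
distinguished, tensor factor on the right such that
`D Ω = 0` and `D X(ξ) = (X(ξ) ⊗ 1) D + (Ω ⊗ ξ) ⟪Ω, ·⟫`.
By induction on the length of the word, these relations give
`D X(ξ₁) ⋯ X(ξ_k) Ω = ∑_m ⟪Ω, X(ξ_{m+1}) ⋯ X(ξ_k) Ω⟫ X(ξ₁) ⋯ X(ξ_{m-1}) Ω ⊗ ξ_m`
(`dualSum_wordVec`). If `D₁` is the part of `D` with values in `E`, then `⟪ξ, D₁ p(X) Ω⟫` is
therefore `φ ⊗ φ^op` of a combination of free difference quotients of `p`, with the coefficients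
`⟪ξ, e_k⟫`. For `ξ = e_i` these are the entries of `2 / (1 + A)`
(`IsRealOrthonormalBasis.two_smul_inv`), which makes `D₁^* e_i` the conjugate variable.

The dual operator is written down explicitly. On `ξ₁ ⊗ ⋯ ⊗ ξ_N` it is the sum, over the choices of a
distinguished position and over the ways to pair every position on its right with a position on its
left, of the twisted contractions of these pairs with alternating signs (`dualComponent`). The
relation with `X(ξ)` comes down to an identity for contractions of a new first position,
`dualComponent_comp_sum_twistedContraction`, which is proved by induction on the degree. It
uses the braid relation and crossing symmetry, the latter in the algebraic form
`C₁ T₂ = C₂ T₁` on `E^{⊗ 3}` (`contraction_comp_twistAt_of_crossing`): on eigenvectors of `Δ` the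
analytic continuation to `i / 2` is an explicit exponential.

A term of degree `2n+1` of `D₁` leaves one unpaired position, so that it is a sum over the matchings
in which all points on the left of the middle point are paired with points on the right of it. These
correspond to permutations, and peeling off the first pair of a permutation gives the recursion of
`dualComponent`; hence the sum of the operators `W_π` is `(-1)^n D₁` on `E^{⊗ (2n+1)}`
(`sum_wickContraction`).

It remains to see that the series for `D₁^* ξ` converges. The norm of `D₁` on `E^{⊗ (2n+1)}` is at
most `∏_{k ≤ n} k K q^k` with `q = ‖T‖ < 1`, which decays faster than any exponential
(`norm_dualComponent_le`), while `P_{T,n} ≥ C^{-n}` for some constant `C` (`one_le_twistP`).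
Uniqueness of the conjugate system holds because the vacuum is cyclic for polynomials in the field
operators (`toFock_mem_polynomialVectors`).
-/

namespace TwistedFock

noncomputable section

universe u

/-! ### Operators on tensor powers -/

section Operators

variable {E : Type u} [NormedAddCommGroup E] [InnerProductSpace ℂ E]

@[elab_as_elim]
theorem tpow_succ_induction {n : ℕ} {p : TPow E (n + 1) → Prop} (zero : p 0)
    (tcons : ∀ ξ v, p (tcons n ξ v)) (add : ∀ x y, p x → p y → p (x + y)) (x : TPow E (n + 1)) :
    p x := by
  obtain ⟨y, rfl⟩ := (tpowSucc E n).symm.surjective x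
  induction y with
  | zero => simpa using zero
  | tmul ξ v => exact tcons ξ v
  | add y z hy hz => rw [map_add]; exact add _ _ hy hz

theorem ext_tcons {W : Type*} [AddCommMonoid W] [Module ℂ W] [TopologicalSpace W] {n : ℕ}
    {A B : TPow E (n + 1) →L[ℂ] W} (h : ∀ ξ v, A (tcons n ξ v) = B (tcons n ξ v)) : A = B := by
  ext x
  induction x using tpow_succ_induction with
  | zero => simp
  | tcons ξ v => exact h ξ v
  | add x y hx hy => rw [map_add, map_add, hx, hy]

theorem ext_tcons_tcons {W : Type*} [AddCommMonoid W] [Module ℂ W] [TopologicalSpace W] {n : ℕ}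
    {A B : TPow E (n + 2) →L[ℂ] W}
    (h : ∀ ξ η v, A (tcons (n + 1) ξ (tcons n η v)) = B (tcons (n + 1) ξ (tcons n η v))) :
    A = B := by
  refine ext_tcons fun ξ x => ?_
  induction x using tpow_succ_induction with
  | zero => simp
  | tcons η v => exact h ξ η v
  | add x y hx hy => rw [map_add, map_add, map_add, hx, hy]

theorem exists_smul_tpowOne (x : TPow E 0) : x = tpowZero E x • tpowOne E := by
  apply (tpowZero E).injective
  simp [tpowOne]

theorem tcons_add_left (n : ℕ) (ξ η : E) (v : TPow E n) :
    tcons n (ξ + η) v = tcons n ξ v + tcons n η v := by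
  simp [tcons]

theorem tcons_smul_left (n : ℕ) (c : ℂ) (ξ : E) (v : TPow E n) :
    tcons n (c • ξ) v = c • tcons n ξ v := by
  simp [tcons]

theorem norm_tcons {n : ℕ} (ξ : E) (v : TPow E n) : ‖tcons n ξ v‖ = ‖ξ‖ * ‖v‖ := by
  simp [tcons]

theorem idTensor_comp {k n m : ℕ} (A : TPow E n →L[ℂ] TPow E m) (B : TPow E k →L[ℂ] TPow E n) :
    idTensor (A ∘L B) = idTensor A ∘L idTensor B :=
  ext_tcons fun ξ v => by simp [idTensor_tcons]

@[simp]
theorem idTensor_id (n : ℕ) :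
    idTensor (ContinuousLinearMap.id ℂ (TPow E n)) = ContinuousLinearMap.id ℂ _ :=
  ext_tcons fun ξ v => by simp [idTensor_tcons]

@[simp]
theorem idTensor_zero (n m : ℕ) : idTensor (0 : TPow E n →L[ℂ] TPow E m) = 0 :=
  ext_tcons fun ξ v => by simp [idTensor_tcons]

theorem idTensor_sub {n m : ℕ} (A B : TPow E n →L[ℂ] TPow E m) :
    idTensor (A - B) = idTensor A - idTensor B :=
  ext_tcons fun ξ v => by simp [idTensor_tcons]

theorem idTensor_sum {ι : Type*} {n m : ℕ} (s : Finset ι) (A : ι → TPow E n →L[ℂ] TPow E m) :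
    idTensor (∑ i ∈ s, A i) = ∑ i ∈ s, idTensor (A i) :=
  ext_tcons fun ξ v => by simp [idTensor_tcons]

/-- The twist at the first two positions commutes with `1 ⊗ 1 ⊗ A`. -/
theorem twistAt_zero_comp_idTensor_idTensor (T : TPow E 2 →L[ℂ] TPow E 2) {n m : ℕ}
    (A : TPow E n →L[ℂ] TPow E m) :
    twistAt T 0 (m + 2) ∘L idTensor (idTensor A) =
      idTensor (idTensor A) ∘L twistAt T 0 (n + 2) := by
  have key : ∀ x : TPow E 2 ⊗[ℂ] TPow E n, idTensor (idTensor A) ((tpowSplit E n).symm x) =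
      (tpowSplit E m).symm (A.lTensor (TPow E 2) x) := by
    intro x
    obtain ⟨y, rfl⟩ := (tpowSplit E n).surjective x
    rw [LinearIsometryEquiv.symm_apply_apply]
    apply (tpowSplit E m).injective
    rw [LinearIsometryEquiv.apply_symm_apply]
    have : ((tpowSplit E m).toContinuousLinearEquiv.toContinuousLinearMap ∘L
        idTensor (idTensor A)) = (A.lTensor (TPow E 2)) ∘L
          (tpowSplit E n).toContinuousLinearEquiv.toContinuousLinearMap :=
      ext_tcons_tcons fun ξ η v => by simp [idTensor_tcons, tpowSplit_tcons]
    exact DFunLike.congr_fun this y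
  refine ext_tcons_tcons fun ξ η v => ?_
  have h1 : ∀ (k : ℕ) (w : TPow E k), twistAt T 0 (k + 2) (tcons (k + 1) ξ (tcons k η w)) =
      (tpowSplit E k).symm (T (ttwo ξ η) ⊗ₜ[ℂ] w) := by
    intro k w
    rw [twistAt]
    simp [isometryConj, tpowSplit_tcons]
  rw [ContinuousLinearMap.comp_apply, ContinuousLinearMap.comp_apply, idTensor_tcons,
    idTensor_tcons, h1, h1, key]
  simp

theorem tpowSplit_zero (x : TPow E 2) : tpowSplit E 0 x = x ⊗ₜ[ℂ] tpowOne E := by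
  induction x using tpow_succ_induction with
  | zero => simp
  | tcons ξ x =>
    induction x using tpow_succ_induction with
    | zero => simp
    | tcons η v =>
      rw [tpowSplit_tcons, exists_smul_tpowOne v, ttwo, tone]
      simp [TensorProduct.tmul_smul, TensorProduct.smul_tmul']
    | add x y hx hy => rw [map_add, map_add, hx, hy, TensorProduct.add_tmul]
  | add x y hx hy => rw [map_add, hx, hy, TensorProduct.add_tmul]

/-- The twist on `E^{⊗ 2}` itself, where `E^{⊗ 2} ⊗ E^{⊗ 0}` is identified with `E^{⊗ 2}`. -/
theorem twistAt_zero_two (T : TPow E 2 →L[ℂ] TPow E 2) : twistAt T 0 2 = T := by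
  ext x
  apply (tpowSplit E 0).injective
  rw [tpowSplit_zero (T x), twistAt]
  simp [isometryConj, tpowSplit_zero]

theorem twistAt_succ (T : TPow E 2 →L[ℂ] TPow E 2) (i n : ℕ) :
    twistAt T (i + 1) (n + 1) = idTensor (twistAt T i n) := by
  rw [twistAt]

theorem twistAt_of_lt (T : TPow E 2 →L[ℂ] TPow E 2) {i n : ℕ} (h : n < i + 2) :
    twistAt T i n = 0 := by
  induction i generalizing n with
  | zero =>
    match n, h with
    | 0, _ => rfl
    | 1, _ => rfl
  | succ i ih =>
    match n, h with
    | 0, _ => rfl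
    | n + 1, h => rw [twistAt_succ, ih (by omega), idTensor_zero]

/-- Twists at non-adjacent positions commute. -/
theorem commute_twistAt (T : TPow E 2 →L[ℂ] TPow E 2) (i j n : ℕ) (h : i + 2 ≤ j) :
    Commute (twistAt T i n) (twistAt T j n) := by
  induction i generalizing j n with
  | zero =>
    obtain ⟨j, rfl⟩ := Nat.exists_eq_add_of_le' h
    match n with
    | 0 => rw [twistAt_of_lt T (by omega : 0 < 0 + 2)]; exact Commute.zero_left _
    | 1 => rw [twistAt_of_lt T (by omega : 1 < 0 + 2)]; exact Commute.zero_left _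
    | n + 2 =>
      have := twistAt_zero_comp_idTensor_idTensor T (twistAt T j n)
      rw [← twistAt_succ, ← twistAt_succ] at this
      exact this
  | succ i ih =>
    obtain ⟨j, rfl⟩ := Nat.exists_eq_add_of_le' (show 1 ≤ j by omega)
    match n with
    | 0 => rw [twistAt_of_lt T (by omega : 0 < i + 1 + 2)]; exact Commute.zero_left _
    | n + 1 =>
      have := ih j n (by omega)
      rw [twistAt_succ, twistAt_succ, commute_iff_eq, ← idTensor_mul, this.eq, idTensor_mul]

/-- The linear map `u ↦ u ⊗ v` from `E^{⊗ k}` to `E^{⊗ (n + k)}`, for `v ∈ E^{⊗ n}`. -/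
def tappend {n : ℕ} (v : TPow E n) : (k : ℕ) → (TPow E k →L[ℂ] TPow E (n + k))
  | 0 => (ContinuousLinearMap.toSpanSingleton ℂ v) ∘L
      (tpowZero E).toContinuousLinearEquiv.toContinuousLinearMap
  | k + 1 => idTensor (tappend v k)

@[simp]
theorem tappend_zero_tpowOne {n : ℕ} (v : TPow E n) : tappend v 0 (tpowOne E) = v := by
  simp [tappend, tpowOne]

theorem tappend_succ {n : ℕ} (v : TPow E n) (k : ℕ) : tappend v (k + 1) = idTensor (tappend v k) :=
  rfl

@[simp]
theorem tappend_succ_tcons {n : ℕ} (v : TPow E n) (k : ℕ) (ξ : E) (w : TPow E k) :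
    tappend v (k + 1) (tcons k ξ w) = tcons (n + k) ξ (tappend v k w) :=
  idTensor_tcons _ _ _

/-- A relation between twists at the first three positions has to be checked on `E^{⊗ 3}` only. -/
theorem ext_tappend_three {W : Type*} [AddCommMonoid W] [Module ℂ W] [TopologicalSpace W] {n : ℕ}
    {A B : TPow E (n + 3) →L[ℂ] W}
    (h : ∀ v : TPow E n, A ∘L tappend v 3 = B ∘L tappend v 3) : A = B := by
  refine ext_tcons_tcons fun ξ η x => ?_
  induction x using tpow_succ_induction with
  | zero => simp
  | tcons ζ v =>
    have := DFunLike.congr_fun (h v) (tcons 2 ξ (tcons 1 η (tone ζ)))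
    simpa [tone] using this
  | add x y hx hy => simp only [map_add, hx, hy]

theorem twistAt_zero_comp_tappend (T : TPow E 2 →L[ℂ] TPow E 2) {n : ℕ} (v : TPow E n) (k : ℕ) :
    twistAt T 0 (n + (k + 2)) ∘L tappend v (k + 2) = tappend v (k + 2) ∘L twistAt T 0 (k + 2) :=
  twistAt_zero_comp_idTensor_idTensor T (tappend v k)

theorem twistAt_one_comp_tappend (T : TPow E 2 →L[ℂ] TPow E 2) {n : ℕ} (v : TPow E n) (k : ℕ) :
    twistAt T 1 (n + (k + 3)) ∘L tappend v (k + 3) = tappend v (k + 3) ∘L twistAt T 1 (k + 3) := by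
  rw [tappend_succ, twistAt_succ]
  have : twistAt T 1 (n + (k + 3)) = idTensor (twistAt T 0 (n + (k + 2))) := rfl
  rw [this, ← idTensor_comp, twistAt_zero_comp_tappend, idTensor_comp]

/-- The braid relation holds at all positions of all tensor powers. -/
theorem braid_twistAt (T : TPow E 2 →L[ℂ] TPow E 2)
    (hT : twistAt T 0 3 * twistAt T 1 3 * twistAt T 0 3 =
      twistAt T 1 3 * twistAt T 0 3 * twistAt T 1 3) (i n : ℕ) :
    twistAt T i n * twistAt T (i + 1) n * twistAt T i n =
      twistAt T (i + 1) n * twistAt T i n * twistAt T (i + 1) n := by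
  induction i generalizing n with
  | zero =>
    by_cases hn : n < 3
    · rw [twistAt_of_lt T (show n < 0 + 1 + 2 by omega)]
      simp
    obtain ⟨n, rfl⟩ := Nat.exists_eq_add_of_le' (not_lt.1 hn)
    refine ext_tappend_three fun v => ?_
    ext x
    have h0 : ∀ x, twistAt T 0 (n + 3) (tappend v 3 x) = tappend v 3 (twistAt T 0 3 x) :=
      DFunLike.congr_fun (twistAt_zero_comp_tappend T v 1)
    have h1 : ∀ x, twistAt T 1 (n + 3) (tappend v 3 x) = tappend v 3 (twistAt T 1 3 x) :=
      DFunLike.congr_fun (twistAt_one_comp_tappend T v 0)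
    have h2 := DFunLike.congr_fun hT x
    simp only [ContinuousLinearMap.comp_apply, ContinuousLinearMap.mul_def, zero_add] at h2 ⊢
    rw [h0, h1, h0, h1, h0, h1, h2]
  | succ i ih =>
    match n with
    | 0 => rw [twistAt_of_lt T (by omega : 0 < i + 1 + 2)]; simp
    | n + 1 =>
      simp only [twistAt_succ, ← idTensor_mul, ih]

theorem idTensor_twistProd (T : TPow E 2 →L[ℂ] TPow E 2) (a b n : ℕ) :
    idTensor (twistProd T a b n) = twistProd T (a + 1) (b + 1) (n + 1) := by
  have h : ∀ l : List ℕ, idTensor ((l.map fun i => twistAt T i n).prod) =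
      ((l.map (· + 1)).map fun i => twistAt T i (n + 1)).prod := by
    intro l
    induction l with
    | nil => exact idTensor_id n
    | cons i l ih =>
      simp only [List.map_cons, List.prod_cons, idTensor_mul, ih, twistAt_succ]
  have h1 : (fun x : ℕ => x + 1) = fun x => 1 + x := funext fun x => add_comm _ _
  rw [twistProd, h, twistProd, Nat.add_sub_add_right, h1, List.map_add_range', add_comm 1 a]

theorem twistProd_self (T : TPow E 2 →L[ℂ] TPow E 2) (a n : ℕ) : twistProd T a a n = 1 := by
  simp [twistProd]

theorem twistProd_eq_mul_left (T : TPow E 2 →L[ℂ] TPow E 2) {a b : ℕ} (h : a < b) (n : ℕ) :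
    twistProd T a b n = twistAt T a n * twistProd T (a + 1) b n := by
  obtain ⟨k, rfl⟩ := Nat.exists_eq_add_of_lt h
  have h1 : a + k + 1 - a = k + 1 := by omega
  have h2 : a + k + 1 - (a + 1) = k := by omega
  rw [twistProd, twistProd, h1, h2, List.range'_succ, List.map_cons, List.prod_cons]

theorem twistProd_succ_right (T : TPow E 2 →L[ℂ] TPow E 2) {a b : ℕ} (h : a ≤ b) (n : ℕ) :
    twistProd T a (b + 1) n = twistProd T a b n * twistAt T b n := by
  obtain ⟨k, rfl⟩ := Nat.exists_eq_add_of_le h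
  have h1 : a + k + 1 - a = k + 1 := by omega
  have h2 : a + k - a = k := by omega
  rw [twistProd, twistProd, h1, h2, List.range'_concat, List.map_append, List.prod_append]
  simp

end Operators

/-! ### Contractions -/

section ContractionRelations

variable {E : Type u} [NormedAddCommGroup E] [InnerProductSpace ℂ E] [FiniteDimensional ℂ E]
  (H : StandardSubspace E)

theorem contraction_succ_succ (i k : ℕ) :
    contraction H (i + 1) (k + 1) = idTensor (contraction H i k) := by
  rw [contraction]

/-- Contracting the first two positions intertwines `1 ⊗ 1 ⊗ A` with `A`. -/
theorem contraction_zero_comp_idTensor_idTensor {n m : ℕ} (A : TPow E n →L[ℂ] TPow E m) :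
    contraction H 0 m ∘L idTensor (idTensor A) = A ∘L contraction H 0 n :=
  ext_tcons_tcons fun ξ η v => by simp [idTensor_tcons, contraction_zero_tcons]

variable (T : TPow E 2 →L[ℂ] TPow E 2)

/-- The crossing relation between contractions and twists on `E^{⊗ 3}` holds on the first three
positions of every tensor power. -/
theorem contraction_zero_comp_twistAt_one
    (hT : contraction H 0 1 ∘L twistAt T 1 3 = contraction H 1 1 ∘L twistAt T 0 3) (n : ℕ) :
    contraction H 0 (n + 1) ∘L twistAt T 1 (n + 3) =
      contraction H 1 (n + 1) ∘L twistAt T 0 (n + 3) := by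
  refine ext_tappend_three fun v => ?_
  have h0 : twistAt T 0 (n + 3) ∘L tappend v 3 = tappend v 3 ∘L twistAt T 0 3 :=
    twistAt_zero_comp_tappend T v 1
  have h1 : twistAt T 1 (n + 3) ∘L tappend v 3 = tappend v 3 ∘L twistAt T 1 3 :=
    twistAt_one_comp_tappend T v 0
  have h2 : contraction H 0 (n + 1) ∘L tappend v 3 = tappend v 1 ∘L contraction H 0 1 :=
    contraction_zero_comp_idTensor_idTensor H (tappend v 1)
  have h3 : contraction H 1 (n + 1) ∘L tappend v 3 = tappend v 1 ∘L contraction H 1 1 := by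
    rw [contraction_succ_succ, contraction_succ_succ, tappend_succ v 2, tappend_succ v 0]
    refine (idTensor_comp _ _).symm.trans (Eq.trans ?_ (idTensor_comp _ _))
    exact congrArg idTensor (contraction_zero_comp_idTensor_idTensor H (tappend v 0))
  rw [ContinuousLinearMap.comp_assoc, ContinuousLinearMap.comp_assoc]
  rw [h0, h1, ← ContinuousLinearMap.comp_assoc, ← ContinuousLinearMap.comp_assoc, h2, h3,
    ContinuousLinearMap.comp_assoc, ContinuousLinearMap.comp_assoc, hT]

end ContractionRelations

/-! ### Braid relations for products of twists -/

section Braid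

variable {E : Type u} [NormedAddCommGroup E] [InnerProductSpace ℂ E]
  (T : TPow E 2 →L[ℂ] TPow E 2)

theorem commute_twistAt_twistProd {i a : ℕ} (h : i + 2 ≤ a) (b n : ℕ) :
    Commute (twistAt T i n) (twistProd T a b n) := by
  rw [twistProd]
  refine Commute.list_prod_right _ _ fun x hx => ?_
  obtain ⟨j, hj, rfl⟩ := List.mem_map.1 hx
  exact commute_twistAt T i j n (h.trans (List.mem_range'_1.1 hj).1)

variable {T}

/-- The relation `T_{i+1} (T_a ⋯ T_{b-1}) = (T_a ⋯ T_{b-1}) T_i` of the braid group. -/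
theorem twistAt_succ_mul_twistProd
    (hT : twistAt T 0 3 * twistAt T 1 3 * twistAt T 0 3 =
      twistAt T 1 3 * twistAt T 0 3 * twistAt T 1 3)
    {a i b : ℕ} (hai : a ≤ i) (hib : i + 1 < b) (n : ℕ) :
    twistAt T (i + 1) n * twistProd T a b n = twistProd T a b n * twistAt T i n := by
  obtain ⟨k, rfl⟩ := Nat.exists_eq_add_of_le hai
  induction k generalizing a with
  | zero =>
    rw [add_zero] at *
    rw [twistProd_eq_mul_left T (by omega : a < b), twistProd_eq_mul_left T (by omega : a + 1 < b),
      ← mul_assoc, ← mul_assoc, ← braid_twistAt T hT, mul_assoc _ (twistAt T a n),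
      (commute_twistAt_twistProd T le_rfl b n).eq, mul_assoc, mul_assoc, mul_assoc]
  | succ k ih =>
    rw [twistProd_eq_mul_left T (by omega : a < b), ← mul_assoc,
      ← (commute_twistAt T a (a + (k + 1) + 1) n (by omega)).eq, mul_assoc, mul_assoc]
    congr 1
    have := ih (a := a + 1) (by omega) (by omega)
    rwa [show a + 1 + k = a + (k + 1) by omega] at this

theorem twistProd_succ_mul_twistProd
    (hT : twistAt T 0 3 * twistAt T 1 3 * twistAt T 0 3 =
      twistAt T 1 3 * twistAt T 0 3 * twistAt T 1 3)
    {a b c : ℕ} (hbc : b < c) (n : ℕ) :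
    twistProd T (a + 1) (b + 1) n * twistProd T a c n =
      twistProd T a c n * twistProd T a b n := by
  by_cases hab : b ≤ a
  · have h1 : b - a = 0 := by omega
    simp [twistProd, h1]
  obtain ⟨k, rfl⟩ := Nat.exists_eq_add_of_le (not_le.1 hab).le
  clear hab
  induction k with
  | zero => simp [twistProd]
  | succ k ih =>
    rw [← add_assoc, twistProd_succ_right T (show a + 1 ≤ a + k + 1 by omega),
      twistProd_succ_right T (show a ≤ a + k by omega), mul_assoc,
      twistAt_succ_mul_twistProd hT (by omega) (by omega), ← mul_assoc, ih (by omega), mul_assoc]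

end Braid

/-! ### The dual operator -/

section Dual

variable {E : Type u} [NormedAddCommGroup E] [InnerProductSpace ℂ E] [FiniteDimensional ℂ E]
  (T : StrictTwist E) (H : StandardSubspace E)

theorem twistedContraction_one (N : ℕ) : twistedContraction T H 0 1 N = contraction H 0 N := by
  rw [twistedContraction, twistProd_self]; rfl

theorem twistedContraction_add_one (b N : ℕ) :
    twistedContraction T H 0 (b + 1) N =
      contraction H 0 N ∘L idTensor (twistProd T.op 0 b (N + 1)) := by
  rw [idTensor_twistProd]; rfl

variable {T H}

theorem idTensor_twistedContraction (b N : ℕ) :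
    idTensor (twistedContraction T H 0 b N) =
      contraction H 1 (N + 1) ∘L twistProd T.op 2 (b + 1) (N + 3) := by
  rw [twistedContraction, idTensor_comp, idTensor_twistProd, contraction_succ_succ]

/-- A contraction line that passes over the second strand can be pulled to the other side of it:
crossing symmetry turns the crossing at the right end of the line into one at its left end. -/
theorem twistedContraction_succ_succ
    (hX : contraction H 0 1 ∘L twistAt T.op 1 3 = contraction H 1 1 ∘L twistAt T.op 0 3)
    {b : ℕ} (hb : 0 < b) (N : ℕ) :
    twistedContraction T H 0 (b + 1) (N + 1) =
      idTensor (twistedContraction T H 0 b N) ∘L twistAt T.op 0 (N + 3) := by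
  have h := contraction_zero_comp_twistAt_one H T.op hX N
  rw [idTensor_twistedContraction, twistedContraction, zero_add,
    twistProd_eq_mul_left T.op (by omega), ContinuousLinearMap.mul_def,
    ← ContinuousLinearMap.comp_assoc, h, ContinuousLinearMap.comp_assoc,
    ContinuousLinearMap.comp_assoc]
  congr 1
  exact commute_twistAt_twistProd T.op le_rfl _ _

theorem twistProd_comp_contraction_one (a b N : ℕ) :
    twistProd T.op (a + 1) (b + 1) (N + 1) ∘L contraction H 1 (N + 1) =
      contraction H 1 (N + 1) ∘L twistProd T.op (a + 3) (b + 3) (N + 3) := by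
  rw [← idTensor_twistProd, contraction_succ_succ, ← idTensor_comp,
    ← contraction_zero_comp_idTensor_idTensor, idTensor_twistProd, idTensor_twistProd,
    idTensor_comp, idTensor_twistProd]

/-- A twist of the right ends of two nested contractions can be moved to their left ends, by the
crossing relation for the inner pair followed by that for the outer pair. -/
theorem contraction_zero_comp_contraction_one_comp_twistAt_two
    (hX : contraction H 0 1 ∘L twistAt T.op 1 3 = contraction H 1 1 ∘L twistAt T.op 0 3) (N : ℕ) :
    contraction H 0 N ∘L contraction H 1 (N + 2) ∘L twistAt T.op 2 (N + 4) =
      contraction H 0 N ∘L contraction H 1 (N + 2) ∘L twistAt T.op 0 (N + 4) := by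
  have h0 := contraction_zero_comp_twistAt_one H T.op hX N
  have h1 : contraction H 0 (N + 2) ∘L twistAt T.op 1 (N + 4) =
      contraction H 1 (N + 2) ∘L twistAt T.op 0 (N + 4) :=
    contraction_zero_comp_twistAt_one H T.op hX (N + 1)
  have h2 : contraction H 1 (N + 2) ∘L twistAt T.op 2 (N + 4) =
      idTensor (idTensor (contraction H 0 N)) ∘L twistAt T.op 1 (N + 4) := by
    have : contraction H 1 (N + 2) = idTensor (contraction H 0 (N + 1)) :=
      contraction_succ_succ H _ _
    rw [this, twistAt_succ T.op 1 (N + 3), ← idTensor_comp, h0, idTensor_comp,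
      contraction_succ_succ, twistAt_succ T.op 0 (N + 3)]
  rw [h2, ← ContinuousLinearMap.comp_assoc, contraction_zero_comp_idTensor_idTensor,
    ContinuousLinearMap.comp_assoc, h1]

/-- Two contractions can be carried out in either order, at the price of one twist of their left
ends. The braid relation moves the two contraction lines past each other, and crossing symmetry
moves the remaining twist from the right ends of the lines to the left ends. -/
theorem twistedContraction_comp_twistedContraction
    (hX : contraction H 0 1 ∘L twistAt T.op 1 3 = contraction H 1 1 ∘L twistAt T.op 0 3)
    (hT : IsBraided T) {b c : ℕ} (hb : 0 < b) (hbc : b < c) (N : ℕ) :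
    twistedContraction T H 0 c N ∘L idTensor (twistedContraction T H 0 b (N + 1)) ∘L
        twistAt T.op 0 (N + 4) =
      twistedContraction T H 0 b N ∘L idTensor (twistedContraction T H 0 (c + 1) (N + 1)) := by
  obtain ⟨b, rfl⟩ := Nat.exists_eq_add_of_le' hb
  obtain ⟨c, rfl⟩ := Nat.exists_eq_add_of_le' (hb.trans hbc)
  have h1 := twistProd_comp_contraction_one (T := T) (H := H) 0 c (N + 1)
  have h2 := twistProd_comp_contraction_one (T := T) (H := H) 0 b (N + 1)
  rw [idTensor_twistedContraction, idTensor_twistedContraction, twistedContraction,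
    twistedContraction]
  have h3 := contraction_zero_comp_contraction_one_comp_twistAt_two hX N
  have h4 := twistProd_succ_mul_twistProd hT (a := 2) (b := b + 2) (c := c + 3) (by omega) (N + 4)
  have h5 := twistProd_eq_mul_left T.op (show 2 < c + 3 by omega) (N + 4)
  have h6 := (commute_twistAt_twistProd T.op (show 0 + 2 ≤ 3 by omega) (c + 3) (N + 4)).eq
  have h7 := (commute_twistAt_twistProd T.op (show 0 + 2 ≤ 2 by omega) (b + 2) (N + 4)).eq
  ext x
  replace h1 := DFunLike.congr_fun h1
  replace h2 := DFunLike.congr_fun h2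
  replace h3 := DFunLike.congr_fun h3
  replace h4 := DFunLike.congr_fun h4
  replace h5 := DFunLike.congr_fun h5
  replace h6 := DFunLike.congr_fun h6
  replace h7 := DFunLike.congr_fun h7
  simp only [ContinuousLinearMap.comp_apply, ContinuousLinearMap.mul_def, zero_add] at *
  rw [h1, h2, h4, h5, h3, h6, h7]

variable (T H) in
/-- The component `E^{⊗ N} → E^{⊗ m}` of the dual operator. It sends `ξ₁ ⊗ ⋯ ⊗ ξ_N` to the sum
over all ways to choose a distinguished position and to pair every position on its right with one
on its left, of `(-1)^s` times the twisted contraction of these `s` pairs; the distinguished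
position is the last one of the `m = N - 2 s` remaining positions. The recursion
distinguishes whether the first position is unpaired or paired. -/
def dualComponent : (N m : ℕ) → (TPow E N →L[ℂ] TPow E m)
  | 0, _ => 0
  | 1, 0 => 0
  | 1, 1 => ContinuousLinearMap.id ℂ _
  | 1, _ + 2 => 0
  | _ + 2, 0 => 0
  | N + 2, m + 1 => idTensor (dualComponent (N + 1) m) - dualComponent N (m + 1) ∘L
      ∑ b ∈ Finset.Ico ((N + m + 3) / 2) (N + 2), twistedContraction T H 0 b N

theorem dualComponent_zero (m : ℕ) : dualComponent T H 0 m = 0 := by rw [dualComponent]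

theorem dualComponent_one_one : dualComponent T H 1 1 = ContinuousLinearMap.id ℂ _ := by
  rw [dualComponent]

theorem dualComponent_one_of_ne {m : ℕ} (hm : m ≠ 1) : dualComponent T H 1 m = 0 := by
  match m, hm with
  | 0, _ => rw [dualComponent]
  | m + 2, _ => rw [dualComponent]

theorem dualComponent_to_zero (N : ℕ) : dualComponent T H N 0 = 0 := by
  match N with
  | 0 => rw [dualComponent]
  | 1 => rw [dualComponent]
  | N + 2 => rw [dualComponent]

theorem dualComponent_add_two (N m : ℕ) : dualComponent T H (N + 2) (m + 1) =
    idTensor (dualComponent T H (N + 1) m) - dualComponent T H N (m + 1) ∘L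
      ∑ b ∈ Finset.Ico ((N + m + 3) / 2) (N + 2), twistedContraction T H 0 b N := by
  rw [dualComponent]

/-- The dual operator turns contractions of a new first position with the positions on the left of
the distinguished one into contractions with those of them that remain unpaired. This is the point
of the whole construction at which the braid relation and crossing symmetry are used. -/
theorem dualComponent_comp_sum_twistedContraction
    (hX : contraction H 0 1 ∘L twistAt T.op 1 3 = contraction H 1 1 ∘L twistAt T.op 0 3)
    (hT : IsBraided T) (N m : ℕ) :
    dualComponent T H N m ∘L
        ∑ b ∈ Finset.Ico 1 ((N + m + 2) / 2), twistedContraction T H 0 b N =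
      (∑ b ∈ Finset.Ico 1 (m + 1), twistedContraction T H 0 b m) ∘L
        idTensor (dualComponent T H (N + 1) (m + 1)) := by
  induction N using Nat.strong_induction_on generalizing m with
  | _ N ih =>
  match N, m, ih with
  | N, 0, _ => simp [dualComponent_to_zero]
  | 0, m + 1, _ => simp [dualComponent_zero, dualComponent_one_of_ne]
  | 1, 1, _ =>
    simp [dualComponent_one_one, dualComponent_add_two, dualComponent_zero]
  | 1, m + 2, _ =>
    simp [dualComponent_one_of_ne, dualComponent_add_two, dualComponent_zero]
  | N + 2, M + 1, ih =>
    set L := (N + M + 3) / 2 with hL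
    have e1 : (N + 2 + (M + 1) + 2) / 2 = L + 1 := by omega
    have e2 : (N + 1 + (M + 1) + 3) / 2 = L + 1 := by omega
    have e3 : (N + 1 + M + 2) / 2 = L := by omega
    have e4 : (N + (M + 1) + 2) / 2 = L := by omega
    have ih1 := ih (N + 1) (by omega) M
    have ih2 := ih N (by omega) (M + 1)
    rw [e3] at ih1
    rw [e4] at ih2
    have hL1 : 1 ≤ L := by omega
    -- The summand `b = 1` contracts two adjacent positions; in all others the contraction line
    -- crosses the second strand, and crossing symmetry pulls this strand out to the left.
    have split : ∀ (K k : ℕ), 1 ≤ K →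
        ∑ b ∈ Finset.Ico 1 (K + 1), twistedContraction T H 0 b (k + 1) = contraction H 0 (k + 1) +
          (∑ b ∈ Finset.Ico 1 K, idTensor (twistedContraction T H 0 b k)) ∘L
            twistAt T.op 0 (k + 3) := by
      intro K k hK
      rw [Finset.sum_eq_sum_Ico_succ_bot (by omega), twistedContraction_one,
        ContinuousLinearMap.finsetSum_comp, ← Finset.sum_Ico_add' _ 1 K 1]
      congr 1
      refine Finset.sum_congr rfl fun b hb => ?_
      exact twistedContraction_succ_succ hX (Finset.mem_Ico.1 hb).1 k
    -- A contraction to a position on the left of the distinguished one can be interchanged with a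
    -- contraction to a position on its right.
    have cross : (∑ c ∈ Finset.Ico L (N + 2), twistedContraction T H 0 c N) ∘L
          idTensor (∑ b ∈ Finset.Ico 1 L, twistedContraction T H 0 b (N + 1)) ∘L
            twistAt T.op 0 (N + 4) =
        (∑ b ∈ Finset.Ico 1 L, twistedContraction T H 0 b N) ∘L
          idTensor (∑ c ∈ Finset.Ico (L + 1) (N + 3), twistedContraction T H 0 c (N + 1)) := by
      rw [← Finset.sum_Ico_add' _ L (N + 2) 1, idTensor_sum, idTensor_sum]
      simp only [ContinuousLinearMap.finsetSum_comp, ContinuousLinearMap.comp_finsetSum]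
      rw [Finset.sum_comm]
      refine Finset.sum_congr rfl fun b hb => Finset.sum_congr rfl fun c hc => ?_
      rw [Finset.mem_Ico] at hb hc
      exact twistedContraction_comp_twistedContraction hX hT hc.1 (by omega) N
    have hD : dualComponent T H (N + 2) (M + 1) = idTensor (dualComponent T H (N + 1) M) -
        dualComponent T H N (M + 1) ∘L
          ∑ c ∈ Finset.Ico L (N + 2), twistedContraction T H 0 c N := dualComponent_add_two N M
    have hD3 : dualComponent T H (N + 3) (M + 2) = idTensor (dualComponent T H (N + 2) (M + 1)) -
        dualComponent T H (N + 1) (M + 2) ∘L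
          ∑ c ∈ Finset.Ico (L + 1) (N + 3), twistedContraction T H 0 c (N + 1) := by
      rw [← e2]; exact dualComponent_add_two (N + 1) (M + 1)
    have hc := contraction_zero_comp_idTensor_idTensor H (dualComponent T H (N + 2) (M + 1))
    have ht := twistAt_zero_comp_idTensor_idTensor T.op (dualComponent T H (N + 2) (M + 1))
    have hs1 := split L (N + 1) hL1
    have hs2 := split (M + 1) M (by omega)
    have hI : idTensor (dualComponent T H (N + 1) M) ∘L
        idTensor (∑ b ∈ Finset.Ico 1 L, twistedContraction T H 0 b (N + 1)) =
        (∑ b ∈ Finset.Ico 1 (M + 1), idTensor (twistedContraction T H 0 b M)) ∘L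
          idTensor (idTensor (dualComponent T H (N + 2) (M + 1))) := by
      rw [← idTensor_comp, ih1, idTensor_comp, idTensor_sum]
    rw [← idTensor_sum] at hs1
    rw [e1, hs1]
    ext x
    replace hD := DFunLike.congr_fun hD
    replace cross := DFunLike.congr_fun cross
    replace hc := DFunLike.congr_fun hc
    replace ht := DFunLike.congr_fun ht
    replace hI := DFunLike.congr_fun hI
    replace ih2 := DFunLike.congr_fun ih2
    replace hs2' := DFunLike.congr_fun hs2
    simp only [ContinuousLinearMap.comp_apply, sub_apply,
      add_apply] at hD cross hc ht hI ih2 hs2' ⊢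
    have hx : idTensor (dualComponent T H (N + 3) (M + 2)) x =
        idTensor (idTensor (dualComponent T H (N + 2) (M + 1))) x -
          idTensor (dualComponent T H (N + 1) (M + 2)) (idTensor (∑ c ∈ Finset.Ico (L + 1) (N + 3),
            twistedContraction T H 0 c (N + 1)) x) := by
      rw [hD3, idTensor_sub, idTensor_comp]; rfl
    have hDx := hD (idTensor (∑ b ∈ Finset.Ico 1 L, twistedContraction T H 0 b (N + 1))
      (twistAt T.op 0 (N + 4) x))
    refine Eq.trans (map_add _ _ _) (Eq.trans ?_ (congrArg _ hx).symm)
    refine Eq.trans (congrArg (_ + ·) hDx) ?_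
    refine Eq.trans ?_ (map_sub _ _ _).symm
    refine Eq.trans ?_ (congrArg₂ (· - ·) (hs2' _).symm (ih2 _))
    rw [hc, ht, cross]
    refine Eq.trans (congrArg (_ + ·) (congrArg (· - _) (hI _))) ?_
    abel

end Dual

/-! ### Right tensor factors -/

section RightFactor

variable {E : Type u} [NormedAddCommGroup E] [InnerProductSpace ℂ E]

/-- The linear map `v ↦ v ⊗ η` from `E^{⊗ n}` to `E^{⊗ (n + 1)}`. -/
def tsnoc (η : E) : (n : ℕ) → (TPow E n →L[ℂ] TPow E (n + 1))
  | 0 => (ContinuousLinearMap.toSpanSingleton ℂ (tone η)) ∘L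
      (tpowZero E).toContinuousLinearEquiv.toContinuousLinearMap
  | n + 1 => idTensor (tsnoc η n)

theorem tsnoc_zero_apply (η : E) (v : TPow E 0) : tsnoc η 0 v = tpowZero E v • tone η := by
  simp [tsnoc]

theorem tsnoc_succ (η : E) (n : ℕ) : tsnoc η (n + 1) = idTensor (tsnoc η n) := rfl

theorem tsnoc_succ_tcons (η ξ : E) (n : ℕ) (v : TPow E n) :
    tsnoc η (n + 1) (tcons n ξ v) = tcons (n + 1) ξ (tsnoc η n v) :=
  idTensor_tcons _ _ _

theorem twistAt_comp_tsnoc (T : TPow E 2 →L[ℂ] TPow E 2) (η : E) {i n : ℕ} (h : i + 2 ≤ n) :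
    twistAt T i (n + 1) ∘L tsnoc η n = tsnoc η n ∘L twistAt T i n := by
  induction i generalizing n with
  | zero =>
    obtain ⟨n, rfl⟩ := Nat.exists_eq_add_of_le' h
    exact twistAt_zero_comp_idTensor_idTensor T (tsnoc η n)
  | succ i ih =>
    obtain ⟨n, rfl⟩ := Nat.exists_eq_add_of_le' (show 1 ≤ n by omega)
    rw [tsnoc_succ, twistAt_succ, twistAt_succ, ← idTensor_comp, ih (by omega), idTensor_comp]

theorem twistProd_comp_tsnoc (T : TPow E 2 →L[ℂ] TPow E 2) (η : E) {a b n : ℕ} (h : b + 1 ≤ n) :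
    twistProd T a b (n + 1) ∘L tsnoc η n = tsnoc η n ∘L twistProd T a b n := by
  have key : ∀ l : List ℕ, (∀ i ∈ l, i + 2 ≤ n) →
      ((l.map fun i => twistAt T i (n + 1)).prod) ∘L tsnoc η n =
        tsnoc η n ∘L ((l.map fun i => twistAt T i n).prod) := by
    intro l
    induction l with
    | nil => intro _; rfl
    | cons i l ih =>
      intro hl
      rw [List.map_cons, List.map_cons, List.prod_cons, List.prod_cons,
        ContinuousLinearMap.mul_def, ContinuousLinearMap.mul_def, ContinuousLinearMap.comp_assoc,
        ih fun j hj => hl j (List.mem_cons_of_mem _ hj), ← ContinuousLinearMap.comp_assoc,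
        twistAt_comp_tsnoc T η (hl i List.mem_cons_self), ContinuousLinearMap.comp_assoc]
  refine key _ fun i hi => ?_
  have := List.mem_range'_1.1 hi
  omega

end RightFactor

/-! ### The dual operator and the field operators -/

section DualField

variable {E : Type u} [NormedAddCommGroup E] [InnerProductSpace ℂ E] [FiniteDimensional ℂ E]
  (T : StrictTwist E) (H : StandardSubspace E)

/-- The part of the annihilation operator `a_T(S ξ) : E^{⊗ (n + 1)} → E^{⊗ n}` that contracts `ξ`
with the first `c` positions. -/
def partialAnnihilation (c : ℕ) (ξ : E) (n : ℕ) : TPow E (n + 1) →ₗ[ℂ] TPow E n :=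
  (∑ b ∈ Finset.Ico 1 (c + 1), twistedContraction T H 0 b n).toLinearMap ∘ₗ tcons (n + 1) ξ

/-- The annihilation operator `a_T(S ξ) : E^{⊗ (n + 1)} → E^{⊗ n}`. -/
def annihilationComponent (ξ : E) (n : ℕ) : TPow E (n + 1) →ₗ[ℂ] TPow E n :=
  partialAnnihilation T H (n + 1) ξ n

theorem annihilationComponent_apply (ξ : E) (n : ℕ) (v : TPow E (n + 1)) :
    annihilationComponent T H ξ n v =
      contraction H 0 n (tcons (n + 1) ξ (twistR T.op (n + 1) v)) := by
  have h : ∑ b ∈ Finset.Ico 1 (n + 2), twistedContraction T H 0 b n =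
      contraction H 0 n ∘L idTensor (twistR T.op (n + 1)) := by
    rw [twistR, idTensor_sum, ContinuousLinearMap.comp_finsetSum, Finset.range_eq_Ico,
      ← Finset.sum_Ico_add' _ 0 (n + 1) 1]
    exact Finset.sum_congr rfl fun b _ => twistedContraction_add_one T H b n
  rw [annihilationComponent, partialAnnihilation, h]
  simp [idTensor_tcons]

/-- The field operator `X_T(ξ)` on sequences of vectors `f n ∈ E^{⊗ n}`. -/
def fieldFun (ξ : E) (f : ∀ n, TPow E n) : ∀ n, TPow E n
  | 0 => annihilationComponent T H ξ 0 (f 1)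
  | n + 1 => tcons n ξ (f n) + annihilationComponent T H ξ (n + 1) (f (n + 2))

/-- The components of the vector `X_T(ξ₁) ⋯ X_T(ξ_k) Ω`. -/
def wordVec : List E → ∀ n, TPow E n
  | [] => Pi.single 0 (tpowOne E)
  | ξ :: l => fieldFun T H ξ (wordVec l)

variable {T H} in
theorem wordVec_of_length_lt (l : List E) (n : ℕ) (h : l.length < n) : wordVec T H l n = 0 := by
  induction l generalizing n with
  | nil => exact Pi.single_eq_of_ne (by simp at h; omega) _
  | cons ξ l ih =>
    rw [List.length_cons] at h
    obtain ⟨n, rfl⟩ := Nat.exists_eq_add_of_le' (show 1 ≤ n by omega)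
    rw [wordVec, fieldFun, ih n (by omega), ih (n + 2) (by omega), map_zero, map_zero, add_zero]

variable {T H} in
theorem dualComponent_of_lt {N m : ℕ} (h : N < m) : dualComponent T H N m = 0 := by
  induction N using Nat.strong_induction_on generalizing m with
  | _ N ih =>
  match N, m, ih, h with
  | 0, m, _, _ => exact dualComponent_zero m
  | 1, m, _, h => exact dualComponent_one_of_ne (by omega)
  | N + 2, m + 1, ih, h =>
    rw [dualComponent_add_two, ih (N + 1) (by omega) (by omega), ih N (by omega) (by omega)]
    simp

/-- The commutation relation between the dual operator and a field operator, on vectors of fixed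
degree: on the right, `ξ` is contracted only with positions on the left of the distinguished one.
Contractions with the positions on its right cancel against the recursion for the dual operator. -/
theorem dualComponent_field
    (hX : contraction H 0 1 ∘L twistAt T.op 1 3 = contraction H 1 1 ∘L twistAt T.op 0 3)
    (hT : IsBraided T) (ξ : E) (N m : ℕ) (v : TPow E (N + 1)) :
    dualComponent T H (N + 2) (m + 1) (tcons (N + 1) ξ v) +
        dualComponent T H N (m + 1) (annihilationComponent T H ξ N v) =
      tcons m ξ (dualComponent T H (N + 1) m v) +
        partialAnnihilation T H (m + 1) ξ (m + 1) (dualComponent T H (N + 1) (m + 2) v) := by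
  have h := DFunLike.congr_fun (dualComponent_comp_sum_twistedContraction hX hT N (m + 1))
    (tcons (N + 1) ξ v)
  have e : (N + (m + 1) + 2) / 2 = (N + m + 3) / 2 := by omega
  rw [e] at h
  simp only [ContinuousLinearMap.comp_apply, idTensor_tcons] at h
  have h' : partialAnnihilation T H (m + 1) ξ (m + 1) (dualComponent T H (N + 1) (m + 2) v) =
      (∑ b ∈ Finset.Ico 1 (m + 1 + 1), twistedContraction T H 0 b (m + 1))
        (tcons (m + 2) ξ (dualComponent T H (N + 1) (m + 2) v)) := rfl
  rw [h', ← h, dualComponent_add_two, sub_apply, idTensor_tcons]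
  rw [sub_add_eq_add_sub, add_sub_assoc, add_right_inj, ContinuousLinearMap.comp_apply, ← map_sub]
  by_cases hm : N < m + 1
  · rw [dualComponent_of_lt hm]
    simp
  · congr 1
    rw [annihilationComponent, partialAnnihilation, LinearMap.comp_apply,
      ContinuousLinearMap.coe_coe,
      ← Finset.sum_Ico_consecutive _ (show 1 ≤ (N + m + 3) / 2 by omega)
        (show (N + m + 3) / 2 ≤ N + 2 by omega), add_apply, add_sub_cancel_right]

/-- The dual operator on sequences that vanish from degree `K` on. -/
def dualSum (K m : ℕ) (f : ∀ n, TPow E n) : TPow E m :=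
  ∑ N ∈ Finset.range K, dualComponent T H N m (f N)

/-- The dual operator commutes with `X_T(ξ)`, acting on the positions on the left of the
distinguished one, up to the term `Ω ⊗ ξ` that comes from the vacuum component. -/
theorem dualSum_fieldFun
    (hX : contraction H 0 1 ∘L twistAt T.op 1 3 = contraction H 1 1 ∘L twistAt T.op 0 3)
    (hT : IsBraided T) (ξ : E) (f : ∀ n, TPow E n) (K m : ℕ) (hf : ∀ n, K < n → f n = 0) :
    dualSum T H (K + 2) (m + 1) (fieldFun T H ξ f) =
      dualComponent T H 1 (m + 1) (tcons 0 ξ (f 0)) + (tcons m ξ (dualSum T H (K + 1) m f) +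
        partialAnnihilation T H (m + 1) ξ (m + 1) (dualSum T H (K + 1) (m + 2) f)) := by
  have h1 : dualSum T H (K + 2) (m + 1) (fieldFun T H ξ f) =
      ∑ N ∈ Finset.range (K + 1), (dualComponent T H (N + 1) (m + 1) (tcons N ξ (f N)) +
        dualComponent T H (N + 1) (m + 1) (annihilationComponent T H ξ (N + 1) (f (N + 2)))) := by
    rw [dualSum, Finset.sum_range_succ', dualComponent_zero]
    simp [fieldFun]
  have h2 : ∑ N ∈ Finset.range (K + 1),
      dualComponent T H (N + 1) (m + 1) (annihilationComponent T H ξ (N + 1) (f (N + 2))) =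
      ∑ N ∈ Finset.range K,
        dualComponent T H N (m + 1) (annihilationComponent T H ξ N (f (N + 1))) := by
    have h := Finset.sum_range_succ' (fun N => dualComponent T H N (m + 1)
      (annihilationComponent T H ξ N (f (N + 1)))) (K + 1)
    rw [Finset.sum_range_succ, Finset.sum_range_succ, hf (K + 1) (by omega),
      hf (K + 1 + 1) (by omega), dualComponent_zero] at h
    simpa using h.symm
  have h3 : ∀ k, dualSum T H (K + 1) k f =
      ∑ N ∈ Finset.range K, dualComponent T H (N + 1) k (f (N + 1)) := by
    intro k
    rw [dualSum, Finset.sum_range_succ', dualComponent_zero]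
    simp
  rw [h1, Finset.sum_add_distrib, h2, Finset.sum_range_succ', h3, h3, map_sum, map_sum,
    ← Finset.sum_add_distrib, add_right_comm, ← Finset.sum_add_distrib]
  refine (add_comm _ _).trans (congrArg (_ + ·) ?_)
  exact Finset.sum_congr rfl fun N _ => dualComponent_field T H hX hT ξ N m (f (N + 1))

/-- A right tensor factor is not affected by contractions with the other positions. -/
theorem annihilationComponent_tsnoc (ξ η : E) (n : ℕ) (v : TPow E (n + 1)) :
    partialAnnihilation T H (n + 1) ξ (n + 1) (tsnoc η (n + 1) v) =
      tsnoc η n (annihilationComponent T H ξ n v) := by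
  have h : (∑ b ∈ Finset.Ico 1 (n + 2), twistedContraction T H 0 b (n + 1)) ∘L tsnoc η (n + 2) =
      tsnoc η n ∘L ∑ b ∈ Finset.Ico 1 (n + 2), twistedContraction T H 0 b n := by
    rw [ContinuousLinearMap.finsetSum_comp, ContinuousLinearMap.comp_finsetSum]
    refine Finset.sum_congr rfl fun b hb => ?_
    have h1 := twistProd_comp_tsnoc T.op η (a := 1) (b := b) (n := n + 2)
      (by have := (Finset.mem_Ico.1 hb).2; omega)
    have h2 := contraction_zero_comp_idTensor_idTensor H (tsnoc η n)
    rw [twistedContraction, ContinuousLinearMap.comp_assoc]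
    refine (congrArg (contraction H 0 (n + 1) ∘L ·) h1).trans ?_
    rw [← ContinuousLinearMap.comp_assoc]
    exact congrArg (· ∘L twistProd T.op 1 b (n + 2)) h2
  have h3 := DFunLike.congr_fun h (tcons (n + 1) ξ v)
  simp only [ContinuousLinearMap.comp_apply, tsnoc_succ, idTensor_tcons] at h3
  exact h3

/-- The vacuum expectation `⟪Ω, X_T(ξ₁) ⋯ X_T(ξ_k) Ω⟫`. -/
def wordState (l : List E) : ℂ := tpowZero E (wordVec T H l 0)

/-- The dual operator acts on words in the field operators as a partial difference quotient. -/
theorem dualSum_wordVec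
    (hX : contraction H 0 1 ∘L twistAt T.op 1 3 = contraction H 1 1 ∘L twistAt T.op 0 3)
    (hT : IsBraided T) (l : List E) (m : ℕ) :
    dualSum T H (l.length + 1) (m + 1) (wordVec T H l) =
      ∑ k : Fin l.length, wordState T H (l.drop (k + 1)) •
        tsnoc (l.get k) m (wordVec T H (l.take k) m) := by
  induction l generalizing m with
  | nil => simp [dualSum, dualComponent_zero]
  | cons ξ l ih =>
    have h := dualSum_fieldFun T H hX hT ξ (wordVec T H l) l.length m fun n hn =>
      wordVec_of_length_lt l n hn
    refine h.trans (Eq.trans ?_ (Fin.sum_univ_succ (n := l.length) _).symm)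
    congr 1
    · have e : wordVec T H l 0 = wordState T H l • tpowOne E := exists_smul_tpowOne _
      rw [e, map_smul, map_smul]
      simp only [Fin.val_zero, zero_add, List.drop_succ_cons, List.drop_zero, List.take_zero,
        List.get_cons_zero]
      congr 1
      match m with
      | 0 =>
        rw [dualComponent_one_one, tsnoc_zero_apply]
        simp [wordVec, tone, tpowOne]
      | m + 1 =>
        rw [dualComponent_one_of_ne (by omega)]
        simp [wordVec]
    · rw [ih (m + 1), map_sum]
      simp only [Fin.val_succ, List.drop_succ_cons, List.take_succ_cons, wordVec]
      match m with
      | 0 =>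
        have : dualSum T H (l.length + 1) 0 (wordVec T H l) = 0 := by
          simp [dualSum, dualComponent_to_zero]
        rw [this, map_zero]
        refine (zero_add _).trans ?_
        refine Finset.sum_congr rfl fun k _ => ?_
        rw [map_smul, annihilationComponent_tsnoc]
        rfl
      | m + 1 =>
        rw [ih m, map_sum, ← Finset.sum_add_distrib]
        refine Finset.sum_congr rfl fun k _ => ?_
        rw [map_smul, map_smul, annihilationComponent_tsnoc, ← smul_add, fieldFun, map_add,
          tsnoc_succ_tcons]
        rfl

/-- The dual operator in degree one satisfies the conjugate relation. -/
theorem dualSum_wordVec_one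
    (hX : contraction H 0 1 ∘L twistAt T.op 1 3 = contraction H 1 1 ∘L twistAt T.op 0 3)
    (hT : IsBraided T) (l : List E) :
    dualSum T H (l.length + 1) 1 (wordVec T H l) =
      ∑ k : Fin l.length, (wordState T H (l.take k) * wordState T H (l.drop (k + 1))) •
        tone (l.get k) := by
  rw [dualSum_wordVec T H hX hT l 0]
  refine Finset.sum_congr rfl fun k _ => ?_
  rw [tsnoc_zero_apply, smul_smul, mul_comm]
  rfl

end DualField

/-! ### Modular data and crossing symmetry -/

/-- A bounded continuous function on the closed strip `0 ≤ Im z ≤ 1/2` that is holomorphic in the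
interior is determined by its values on the real line. -/
theorem eq_of_eq_on_real {f g : ℂ → ℂ}
    (hf : ContinuousOn f {z | 0 ≤ z.im ∧ z.im ≤ 1 / 2})
    (hfb : ∃ C : ℝ, ∀ z : ℂ, 0 ≤ z.im → z.im ≤ 1 / 2 → ‖f z‖ ≤ C)
    (hfd : DifferentiableOn ℂ f {z | 0 < z.im ∧ z.im < 1 / 2})
    (hg : ContinuousOn g {z | 0 ≤ z.im ∧ z.im ≤ 1 / 2})
    (hgb : ∃ C : ℝ, ∀ z : ℂ, 0 ≤ z.im → z.im ≤ 1 / 2 → ‖g z‖ ≤ C)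
    (hgd : DifferentiableOn ℂ g {z | 0 < z.im ∧ z.im < 1 / 2})
    (h : ∀ t : ℝ, f t = g t) {z : ℂ} (hz0 : 0 ≤ z.im) (hz1 : z.im ≤ 1 / 2) : f z = g z := by
  have hcl : closure {z : ℂ | 0 < z.im ∧ z.im < 1 / 2} = {z | 0 ≤ z.im ∧ z.im ≤ 1 / 2} := by
    have := Complex.closure_preimage_im (Set.Ioo 0 (1 / 2))
    rw [closure_Ioo (by norm_num)] at this
    exact this
  have hclr : closure (Complex.re ⁻¹' Set.Ioo 0 (1 / 2)) = Complex.re ⁻¹' Set.Icc 0 (1 / 2) := by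
    rw [Complex.closure_preimage_re, closure_Ioo (by norm_num)]
  have hint : Set.EqOn f g {z : ℂ | 0 < z.im ∧ z.im < 1 / 2} := by
    rintro w ⟨hw0, hw1⟩
    obtain ⟨C, hC⟩ := hfb
    obtain ⟨C', hC'⟩ := hgb
    have hIim : ∀ w : ℂ, (Complex.I * w).im = w.re := fun w => by simp
    let F : ℂ → ℂ := fun w => f (Complex.I * w) - g (Complex.I * w)
    have hbd : ∀ w : ℂ, 0 ≤ w.re → w.re ≤ 1 / 2 → ‖F w‖ ≤ C + C' := fun w h0 h1 =>
      (norm_sub_le _ _).trans (add_le_add (hC _ (by rwa [hIim]) (by rwa [hIim]))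
        (hC' _ (by rwa [hIim]) (by rwa [hIim])))
    have hd : DiffContOnCl ℂ F (Complex.HadamardThreeLines.verticalStrip 0 (1 / 2)) := by
      constructor
      · refine DifferentiableOn.sub ?_ ?_
        · refine hfd.comp (by fun_prop) fun w hw => ?_
          simpa [Complex.HadamardThreeLines.verticalStrip] using hw
        · refine hgd.comp (by fun_prop) fun w hw => ?_
          simpa [Complex.HadamardThreeLines.verticalStrip] using hw
      · rw [Complex.HadamardThreeLines.verticalStrip, hclr]
        refine ContinuousOn.sub ?_ ?_
        · refine hf.comp (by fun_prop) fun w hw => ?_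
          simpa using hw
        · refine hg.comp (by fun_prop) fun w hw => ?_
          simpa using hw
    have hw' : (-Complex.I * w).re = w.im := by simp
    -- Three lines theorem on the strip rotated by `-i`: the difference vanishes on one of the two
    -- boundary lines.
    have key := Complex.HadamardThreeLines.norm_le_interp_of_mem_verticalClosedStrip'
      (f := F) (z := -Complex.I * w) (a := 0) (b := C + C') (l := 0) (u := 1 / 2) (by norm_num)
      ⟨by rw [hw']; exact hw0.le, by rw [hw']; exact hw1.le⟩ hd
      ⟨C + C', by
        rintro _ ⟨w, hw, rfl⟩
        exact hbd w hw.1 hw.2⟩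
      (fun w hw => by
        have e : Complex.I * w = ((-w.im : ℝ) : ℂ) := by
          have : w.re = 0 := hw
          apply Complex.ext <;> simp [this]
        simp only [F, e, h, sub_self, norm_zero, le_refl])
      (fun w hw => by
        have : w.re = 1 / 2 := hw
        exact hbd w (by rw [this]; norm_num) this.le)
    rw [hw', Real.zero_rpow (by
      have : (w.im - 0) / (1 / 2 - 0) < 1 := by rw [div_lt_one] <;> linarith
      linarith), zero_mul] at key
    have e : Complex.I * (-Complex.I * w) = w := by
      rw [← mul_assoc, mul_neg, Complex.I_mul_I, neg_neg, one_mul]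
    have := norm_le_zero_iff.1 key
    simp only [F, e] at this
    exact sub_eq_zero.1 this
  exact hint.of_subset_closure hf hg (fun w hw => ⟨hw.1.le, hw.2.le⟩) hcl.ge ⟨hz0, hz1⟩

section TensorSquare

variable {E : Type u} [NormedAddCommGroup E] [InnerProductSpace ℂ E]

theorem ext_ttwo {W : Type*} [AddCommMonoid W] [Module ℂ W] [TopologicalSpace W]
    {A B : TPow E 2 →L[ℂ] W} (h : ∀ ξ η, A (ttwo ξ η) = B (ttwo ξ η)) : A = B := by
  refine ext_tcons_tcons fun ξ η v => ?_
  rw [exists_smul_tpowOne v]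
  simp only [map_smul]
  exact congrArg _ (h ξ η)

theorem inner_ttwo (a b c d : E) : ⟪ttwo a b, ttwo c d⟫_ℂ = ⟪a, c⟫_ℂ * ⟪b, d⟫_ℂ := by
  rw [ttwo, ttwo, inner_tcons, tone, tone, inner_tcons]
  simp [tpowOne]

theorem tcons_sum_left {ι : Type*} (s : Finset ι) (n : ℕ) (f : ι → E) (v : TPow E n) :
    tcons n (∑ i ∈ s, f i) v = ∑ i ∈ s, tcons n (f i) v := by
  induction s using Finset.cons_induction with
  | empty => simp [tcons]
  | cons i s hi ih => rw [Finset.sum_cons, Finset.sum_cons, tcons_add_left, ih]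

theorem inner_tone (a b : E) : ⟪tone a, tone b⟫_ℂ = ⟪a, b⟫_ℂ := by
  simp [tone, inner_tcons, tpowOne]

theorem ext_inner_tone {x y : TPow E 1} (h : ∀ ζ : E, ⟪tone ζ, x⟫_ℂ = ⟪tone ζ, y⟫_ℂ) : x = y := by
  refine ext_inner_left ℂ fun w => ?_
  induction w using tpow_succ_induction with
  | zero => simp
  | tcons ξ v =>
    rw [exists_smul_tpowOne v, map_smul, inner_smul_left, inner_smul_left]
    exact congrArg _ (h ξ)
  | add w w' hw hw' => rw [inner_add_left, inner_add_left, hw, hw']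

theorem tappend_two_ttwo {n : ℕ} (v : TPow E n) (ξ η : E) :
    tappend v 2 (ttwo ξ η) = tcons (n + 1) ξ (tcons n η v) := by
  have h : tappend v 1 (tone η) = tcons n η v :=
    (tappend_succ_tcons v 0 η (tpowOne E)).trans (congrArg _ (tappend_zero_tpowOne v))
  exact (tappend_succ_tcons v 1 ξ (tone η)).trans (congrArg _ h)

theorem twistAt_zero_tcons_tcons (T : TPow E 2 →L[ℂ] TPow E 2) {n : ℕ} (ξ η : E) (v : TPow E n) :
    twistAt T 0 (n + 2) (tcons (n + 1) ξ (tcons n η v)) = tappend v 2 (T (ttwo ξ η)) := by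
  have h : ∀ x, twistAt T 0 (n + 2) (tappend v 2 x) = tappend v 2 (twistAt T 0 2 x) :=
    DFunLike.congr_fun (twistAt_zero_comp_tappend T v 0)
  rw [← tappend_two_ttwo, h, twistAt_zero_two]

end TensorSquare

section Modular

variable {E : Type u} [NormedAddCommGroup E] [InnerProductSpace ℂ E] [FiniteDimensional ℂ E]
  (H : StandardSubspace E)

theorem tomita_tomita (x : E) : tomita H (tomita H x) = x := by
  obtain ⟨h, hh, k, hk, rfl⟩ := exists_add_I_smul H x
  have e : h - Complex.I • k = h + Complex.I • (-k) := by rw [smul_neg, sub_eq_add_neg]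
  rw [tomita_apply H hh hk, e, tomita_apply H hh (H.toClosedSubmodule.toSubmodule.neg_mem hk),
    smul_neg, sub_neg_eq_add]

theorem tomita_of_mem {h : E} (hh : h ∈ H.toClosedSubmodule) : tomita H h = h := by
  have := tomita_apply H hh H.toClosedSubmodule.toSubmodule.zero_mem
  simpa using this

theorem modularOp_isSymmetric : (modularOp H).toLinearMap.IsSymmetric := fun x y => by
  change ⟪modularOp H x, y⟫_ℂ = ⟪x, modularOp H y⟫_ℂ
  rw [← inner_conj_symm, inner_modularOp, inner_modularOp, inner_conj_symm]

/-- The continuous functional calculus acts on eigenvectors through the eigenvalue, since on the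
finite spectrum every function agrees with a polynomial. -/
theorem modularPow_of_modularOp_eq_smul {v : E} {r : ℂ} (hv : modularOp H v = r • v) (z : ℂ) :
    modularPow H z v = r ^ z • v := by
  have : CompleteSpace E := FiniteDimensional.complete ℂ E
  rcases eq_or_ne v 0 with rfl | hv0
  · simp
  have hsa : IsSelfAdjoint (modularOp H) :=
    ContinuousLinearMap.isSelfAdjoint_iff_isSymmetric.2 (modularOp_isSymmetric H)
  have hn : IsStarNormal (modularOp H) := hsa.isStarNormal
  have hfin : (spectrum ℂ (modularOp H)).Finite := by
    rw [ContinuousLinearMap.spectrum_eq]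
    exact Module.End.finite_spectrum _
  have hr : r ∈ spectrum ℂ (modularOp H) := by
    rw [ContinuousLinearMap.spectrum_eq]
    exact (Module.End.hasEigenvalue_of_hasEigenvector
      ⟨Module.End.mem_eigenspace_iff.2 hv, hv0⟩).mem_spectrum
  let p : Polynomial ℂ := Lagrange.interpolate hfin.toFinset id fun x => x ^ z
  have hp : ∀ x ∈ spectrum ℂ (modularOp H), p.eval x = x ^ z := fun x hx =>
    Lagrange.eval_interpolate_at_node (v := id) _ (Function.injective_id.injOn)
      (hfin.mem_toFinset.2 hx)
  have h1 : modularPow H z = Polynomial.aeval (modularOp H) p := by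
    rw [← cfc_polynomial p (modularOp H) hn, modularPow]
    exact cfc_congr fun x hx => (hp x hx).symm
  have h2 : ∀ q : Polynomial ℂ, Polynomial.aeval (modularOp H) q v = q.eval r • v := by
    intro q
    induction q using Polynomial.induction_on' with
    | add p q hp hq => simp [hp, hq, add_smul]
    | monomial n c =>
      rw [Polynomial.aeval_monomial, Polynomial.eval_monomial]
      have : ∀ n : ℕ, (modularOp H ^ n) v = r ^ n • v := by
        intro n
        induction n with
        | zero => simp
        | succ n ih =>
          rw [pow_succ, pow_succ']
          change (modularOp H ^ n) (modularOp H v) = _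
          rw [hv, map_smul, ih, smul_smul]
      rw [mul_smul, ← this n]
      simp [Algebra.algebraMap_eq_smul_one]
  rw [h1, h2, hp r hr]

/-- The modular operator is diagonal in an orthonormal basis, with positive eigenvalues
`exp (l i)`. -/
theorem exists_modular_basis : ∃ (n : ℕ) (b : OrthonormalBasis (Fin n) ℂ E) (l : Fin n → ℝ),
    (∀ i, modularOp H (b i) = Complex.exp (l i) • b i) ∧
      ∀ i z, modularPow H z (b i) = Complex.exp (l i * z) • b i := by
  let b := (modularOp_isSymmetric H).eigenvectorBasis rfl
  let r := (modularOp_isSymmetric H).eigenvalues rfl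
  have hb : ∀ i, modularOp H (b i) = (r i : ℂ) • b i := fun i =>
    (modularOp_isSymmetric H).apply_eigenvectorBasis rfl i
  have hr : ∀ i, 0 < r i := fun i => by
    have h1 : ⟪b i, modularOp H (b i)⟫_ℂ = r i := by
      rw [hb, inner_smul_right, inner_self_eq_norm_sq_to_K, b.orthonormal.1 i]
      simp
    rw [inner_modularOp, inner_self_eq_norm_sq_to_K] at h1
    have h2 : ‖tomita H (b i)‖ ^ 2 = r i := Complex.ofReal_injective (by simpa using h1)
    rw [← h2]
    have h3 : tomita H (b i) ≠ 0 := fun h0 => by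
      have := tomita_tomita H (b i)
      rw [h0, map_zero] at this
      exact b.orthonormal.ne_zero i this.symm
    have := norm_pos_iff.2 h3
    positivity
  have hl : ∀ i, Complex.exp (Real.log (r i)) = r i := fun i => by
    rw [← Complex.ofReal_exp, Real.exp_log (hr i)]
  refine ⟨_, b, fun i => Real.log (r i), fun i => ?_, fun i z => ?_⟩
  · rw [hb, hl]
  · rw [modularPow_of_modularOp_eq_smul H (hb i), Complex.cpow_def_of_ne_zero
      (by exact_mod_cast (hr i).ne'), Complex.ofReal_log (hr i).le]

/-- Contracting with `ξ` is adjoint to creating `S ξ`, for the undeformed inner products. -/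
theorem inner_contraction_tcons (n : ℕ) (ξ : E) (w : TPow E n) (v : TPow E (n + 1)) :
    ⟪w, contraction H 0 n (tcons (n + 1) ξ v)⟫_ℂ = ⟪tcons n (tomita H ξ) w, v⟫_ℂ := by
  induction v using tpow_succ_induction with
  | zero => simp
  | tcons η v => rw [contraction_zero_tcons, inner_smul_right, inner_tcons]
  | add x y hx hy => simp only [map_add, inner_add_right, hx, hy]

variable {H} in
/-- Crossing symmetry, evaluated at `z = i / 2` on eigenvectors of the modular operator. -/
theorem inner_crossing {T : StrictTwist E} (hc : IsCrossingSymmetric T H) {n : ℕ}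
    {b : OrthonormalBasis (Fin n) ℂ E} {l : Fin n → ℝ}
    (hb : ∀ i z, modularPow H z (b i) = Complex.exp (l i * z) • b i) (i j : Fin n) (ψ₁ ψ₃ : E) :
    ⟪ttwo (b i) ψ₁, T.op (ttwo ψ₃ (b j))⟫_ℂ = Complex.exp (-l j) *
      ⟪ttwo ψ₁ (tomita H (b j)), T.op (ttwo (tomita H (b i)) ψ₃)⟫_ℂ := by
  obtain ⟨f, hf, hfb, hfd, hft⟩ := hc ψ₁ (b i) ψ₃ (b j)
  set K := ⟪ttwo (b i) ψ₁, T.op (ttwo ψ₃ (b j))⟫_ℂ with hK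
  have hpow0 : modularPow H 0 = 1 := by
    have := b.toBasis.ext (f₁ := (modularPow H 0).toLinearMap) (f₂ := LinearMap.id) fun i => by
      simp [hb]
    ext x
    exact DFunLike.congr_fun this x
  have hone : tensorOp (1 : E →L[ℂ] E) 1 = 1 := ext_ttwo fun ξ η => by simp [tensorOp_ttwo]
  have hleft : ∀ (z : ℂ) (y : TPow E 2), ⟪ttwo (b i) ψ₁, tensorOp (modularPow H z) 1 y⟫_ℂ =
      Complex.exp (l i * z) * ⟪ttwo (b i) ψ₁, y⟫_ℂ := by
    intro z y
    have hin : ∀ a : E, ⟪b i, modularPow H z a⟫_ℂ = Complex.exp (l i * z) * ⟪b i, a⟫_ℂ := by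
      intro a
      conv_lhs => rw [← b.sum_repr' a]
      simp only [map_sum, map_smul, hb, inner_sum, inner_smul_right]
      rw [Finset.sum_eq_single i]
      · rw [inner_self_eq_norm_sq_to_K, b.orthonormal.1 i]
        simp [mul_comm]
      · intro j _ hj
        rw [b.orthonormal.2 hj.symm]
        simp
      · simp
    have : (innerSL ℂ (ttwo (b i) ψ₁)) ∘L tensorOp (modularPow H z) 1 =
        Complex.exp (l i * z) • innerSL ℂ (ttwo (b i) ψ₁) :=
      ext_ttwo fun ξ η => by
        simp [tensorOp_ttwo, inner_ttwo, hin, mul_assoc]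
    exact DFunLike.congr_fun this y
  -- On eigenvectors the analytic continuation is an explicit exponential.
  let g : ℂ → ℂ := fun z => Complex.exp ((l i - l j) * (z * Complex.I)) * K
  have hg : Differentiable ℂ g := by fun_prop
  have hgt : ∀ t : ℝ, f t = g t := by
    intro t
    rw [(hft t).1, tensorOp_ttwo, hleft, hb]
    have : ttwo ((1 : E →L[ℂ] E) ψ₃) (Complex.exp (l j * -(t * Complex.I)) • b j) =
        Complex.exp (l j * -(t * Complex.I)) • ttwo ψ₃ (b j) := by
      simp [ttwo, tone, tcons_smul_left]
    rw [this, map_smul, inner_smul_right, ← mul_assoc, ← Complex.exp_add]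
    simp only [g]
    congr 2
    ring
  have hgb : ∃ C : ℝ, ∀ z : ℂ, 0 ≤ z.im → z.im ≤ 1 / 2 → ‖g z‖ ≤ C := by
    refine ⟨Real.exp |l i - l j| * ‖K‖, fun z h0 h1 => ?_⟩
    rw [norm_mul, Complex.norm_exp]
    gcongr
    have : (((l i - l j : ℂ)) * (z * Complex.I)).re = -((l i - l j) * z.im) := by
      simp
    rw [this]
    calc -((l i - l j) * z.im) ≤ |(l i - l j) * z.im| := neg_le_abs _
      _ = |l i - l j| * z.im := by rw [abs_mul, abs_of_nonneg h0]
      _ ≤ |l i - l j| * 1 := by gcongr; linarith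
      _ = _ := mul_one _
  have key := eq_of_eq_on_real hf hfb hfd hg.continuous.continuousOn hgb
    hg.differentiableOn hgt (z := Complex.I / 2) (by simp) (by simp)
  have h0 := (hft 0).2
  have hJ : ∀ i, modularConj H (b i) = Complex.exp (-(l i) / 2) • tomita H (b i) := by
    intro i
    rw [modularConj, hb, map_smulₛₗ, ← Complex.exp_conj]
    congr 2
    simp only [map_mul, map_div₀, map_neg, map_one, Complex.conj_ofReal, map_ofNat]
    ring
  have hscal : ∀ (c c' : ℂ) (ξ η : E), ttwo (c • ξ) (c' • η) = (c * c') • ttwo ξ η := by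
    intro c c' ξ η
    simp [ttwo, tone, tcons_smul_left, smul_smul, mul_comm]
  have h1 : ttwo ψ₁ (modularConj H (b j)) =
      Complex.exp (-(l j) / 2) • ttwo ψ₁ (tomita H (b j)) := by
    rw [hJ]
    simpa using hscal 1 (Complex.exp (-(l j) / 2)) ψ₁ (tomita H (b j))
  have h2 : ttwo (modularConj H (b i)) ψ₃ =
      Complex.exp (-(l i) / 2) • ttwo (tomita H (b i)) ψ₃ := by
    rw [hJ]
    simpa using hscal (Complex.exp (-(l i) / 2)) 1 (tomita H (b i)) ψ₃
  rw [Complex.ofReal_zero, zero_add, key, zero_mul, neg_zero, hpow0, hone, h1, h2,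
    one_apply_eq_self, one_apply_eq_self, map_smul, inner_smul_left,
    inner_smul_right, ← Complex.exp_conj] at h0
  simp only [g] at h0
  have e1 : ((l i - l j : ℂ)) * (Complex.I / 2 * Complex.I) = -(l i) / 2 + l j / 2 := by
    rw [div_mul_eq_mul_div, Complex.I_mul_I]
    ring
  have e2 : (starRingEnd ℂ) (-(l j : ℂ) / 2) = -(l j) / 2 := by
    simp only [map_div₀, map_neg, Complex.conj_ofReal, map_ofNat]
  rw [e1, e2, Complex.exp_add, mul_left_comm, mul_assoc] at h0
  have h3 := mul_left_cancel₀ (Complex.exp_ne_zero _) h0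
  have h4 : Complex.exp (-(l j : ℂ)) = Complex.exp (-(l j) / 2) * Complex.exp (-(l j) / 2) := by
    rw [← Complex.exp_add]; congr 1; ring
  have h5 : Complex.exp (-(l j : ℂ) / 2) * Complex.exp (l j / 2) = 1 := by
    rw [← Complex.exp_add]; simp [← add_div]
  rw [h4, mul_assoc, ← h3, ← mul_assoc, h5, one_mul]

variable {H} in
/-- Crossing symmetry as a relation between contractions and twists on `E^{⊗ 3}`. -/
theorem contraction_comp_twistAt_of_crossing {T : StrictTwist E} (hc : IsCrossingSymmetric T H) :
    contraction H 0 1 ∘L twistAt T.op 1 3 = contraction H 1 1 ∘L twistAt T.op 0 3 := by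
  obtain ⟨n, b, l, hΔ, hb⟩ := exists_modular_basis H
  have h3 : ∀ (i j : Fin n) (ψ : E),
      contraction H 0 1 (twistAt T.op 1 3 (tcons 2 (tomita H (b i)) (ttwo ψ (b j)))) =
        contraction H 1 1 (twistAt T.op 0 3 (tcons 2 (tomita H (b i)) (ttwo ψ (b j)))) := by
    intro i j ψ
    refine ext_inner_tone fun ζ => ?_
    have e1 : twistAt T.op 1 3 (tcons 2 (tomita H (b i)) (ttwo ψ (b j))) =
        tcons 2 (tomita H (b i)) (T.op (ttwo ψ (b j))) := by
      have := idTensor_tcons (twistAt T.op 0 2) (tomita H (b i)) (ttwo ψ (b j))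
      rwa [← twistAt_succ, twistAt_zero_two] at this
    have e2 : twistAt T.op 0 3 (tcons 2 (tomita H (b i)) (ttwo ψ (b j))) =
        tappend (tone (b j)) 2 (T.op (ttwo (tomita H (b i)) ψ)) :=
      twistAt_zero_tcons_tcons T.op _ ψ (tone (b j))
    have e3 : ∀ y : TPow E 2, ⟪tone ζ, contraction H 1 1 (tappend (tone (b j)) 2 y)⟫_ℂ =
        Complex.exp (-l j) * ⟪ttwo ζ (tomita H (b j)), y⟫_ℂ := by
      intro y
      have : innerSL ℂ (tone ζ) ∘L contraction H 1 1 ∘L tappend (tone (b j)) 2 =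
          Complex.exp (-l j) • innerSL ℂ (ttwo ζ (tomita H (b j))) := by
        refine ext_ttwo fun ξ η => ?_
        have hS : ⟪tomita H η, b j⟫_ℂ = Complex.exp (-l j) * ⟪tomita H (b j), η⟫_ℂ := by
          have h := inner_modularOp H (tomita H η) (b j)
          rw [hΔ, inner_smul_right, tomita_tomita] at h
          rw [← h, ← mul_assoc, ← Complex.exp_add]
          simp
        have h1 : contraction H 1 1 (tappend (tone (b j)) 2 (ttwo ξ η)) =
            ⟪tomita H η, b j⟫_ℂ • tone ξ := by
          have h2 := contraction_succ_tcons H 0 0 ξ (tcons 1 η (tone (b j)))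
          have h4 := contraction_zero_tcons H 0 η (b j) (tpowOne E)
          rw [← tone] at h4
          rw [h4, map_smul] at h2
          rw [tappend_two_ttwo]
          exact h2
        simp only [ContinuousLinearMap.comp_apply, h1]
        simp [inner_tone, inner_ttwo, hS]
        ring
      exact DFunLike.congr_fun this y
    rw [e1, e2, inner_contraction_tcons, tomita_tomita, e3]
    exact inner_crossing hc hb i j ζ ψ
  -- The vectors `S b_i` span `E`, so that both sides need only be compared on the vectors in `h3`.
  have hbasis : ∀ x : E, x = ∑ i, ⟪tomita H x, b i⟫_ℂ • tomita H (b i) := by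
    intro x
    have := congrArg (tomita H) (b.sum_repr' (tomita H x))
    rw [tomita_tomita, map_sum] at this
    refine this.symm.trans (Finset.sum_congr rfl fun i _ => ?_)
    rw [map_smulₛₗ, inner_conj_symm]
  refine ext_tcons fun ξ x => ?_
  induction x using tpow_succ_induction with
  | zero => simp
  | add x y hx hy => simp only [map_add, hx, hy]
  | tcons ψ x =>
    induction x using tpow_succ_induction with
    | zero => simp
    | add x y hx hy => simp only [map_add, hx, hy]
    | tcons η v =>
      have h4 : ∀ i j ψ, contraction H 0 1 (twistAt T.op 1 3 (tcons 2 (tomita H (b i))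
          (tcons 1 ψ (tcons 0 (b j) (tpowOne E))))) = contraction H 1 1 (twistAt T.op 0 3
            (tcons 2 (tomita H (b i)) (tcons 1 ψ (tcons 0 (b j) (tpowOne E))))) := h3
      rw [exists_smul_tpowOne v, hbasis ξ, ← b.sum_repr' η]
      simp only [tcons_sum_left, map_sum, map_smul, tcons_smul_left, ContinuousLinearMap.comp_apply,
        h4]

end Modular

/-! ### Matchings across the middle point -/

section Matchings

variable {n : ℕ}

/-- The `k`-th point on the left of the middle point of `2n+1` points. -/
def leftPoint (k : Fin n) : Fin (2 * n + 1) := ⟨k, by omega⟩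

/-- The middle point of `2n+1` points. -/
def midPoint (n : ℕ) : Fin (2 * n + 1) := ⟨n, by omega⟩

/-- The `k`-th point on the right of the middle point of `2n+1` points. -/
def rightPoint (k : Fin n) : Fin (2 * n + 1) := ⟨n + 1 + k, by omega⟩

@[simp] theorem val_leftPoint (k : Fin n) : (leftPoint k : ℕ) = k := rfl

@[simp] theorem val_midPoint : (midPoint n : ℕ) = n := rfl

@[simp] theorem val_rightPoint (k : Fin n) : (rightPoint k : ℕ) = n + 1 + k := rfl

@[elab_as_elim]
theorem point_cases {p : Fin (2 * n + 1) → Prop} (left : ∀ k, p (leftPoint k))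
    (mid : p (midPoint n)) (right : ∀ k, p (rightPoint k)) (x : Fin (2 * n + 1)) : p x := by
  rcases lt_trichotomy (x : ℕ) n with h | h | h
  · exact left ⟨x, h⟩
  · have : x = midPoint n := Fin.ext h
    exact this ▸ mid
  · have : x = rightPoint ⟨x - (n + 1), by omega⟩ := Fin.ext (by simp; omega)
    exact this ▸ right _

theorem sum_points {M : Type*} [AddCommMonoid M] (f : Fin (2 * n + 1) → M) :
    ∑ x, f x = ∑ k, f (leftPoint k) + f (midPoint n) + ∑ k, f (rightPoint k) := by
  have h : n + 1 + n = 2 * n + 1 := by omega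
  rw [← (finCongr h).sum_comp, Fin.sum_univ_add, Fin.sum_univ_castSucc]
  rfl

/-- The involution that exchanges the left point `k` with the right point `σ k` and fixes the middle
point. -/
def crossMatching (σ : Equiv.Perm (Fin n)) : Equiv.Perm (Fin (2 * n + 1)) :=
  Function.Involutive.toPerm
    (fun x => if h : (x : ℕ) < n then rightPoint (σ ⟨x, h⟩) else
      if h' : n < (x : ℕ) then leftPoint (σ.symm ⟨x - (n + 1), by omega⟩) else x)
    (fun x => by
      induction x using point_cases with
      | left k =>
        simp [Nat.not_lt.2 (by omega : n ≤ n + 1 + (σ k : ℕ)),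
          show n < n + 1 + (σ k : ℕ) by omega]
      | mid => simp
      | right k =>
        simp [Nat.not_lt.2 (by omega : n ≤ n + 1 + (k : ℕ)), show n < n + 1 + (k : ℕ) by omega])

variable (σ : Equiv.Perm (Fin n))

theorem crossMatching_apply (x : Fin (2 * n + 1)) :
    crossMatching σ x = if h : (x : ℕ) < n then rightPoint (σ ⟨x, h⟩) else
      if h' : n < (x : ℕ) then leftPoint (σ.symm ⟨x - (n + 1), by omega⟩) else x := rfl

@[simp]
theorem crossMatching_left (k : Fin n) : crossMatching σ (leftPoint k) = rightPoint (σ k) := by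
  simp [crossMatching_apply]

@[simp]
theorem crossMatching_mid : crossMatching σ (midPoint n) = midPoint n := by
  simp [crossMatching_apply]

@[simp]
theorem crossMatching_right (k : Fin n) :
    crossMatching σ (rightPoint k) = leftPoint (σ.symm k) := by
  simp [crossMatching_apply, Nat.not_lt.2 (by omega : n ≤ n + 1 + (k : ℕ)),
    show n < n + 1 + (k : ℕ) by omega]

@[simp]
theorem leftPoint_lt_leftPoint {a b : Fin n} : leftPoint a < leftPoint b ↔ a < b := Iff.rfl

@[simp]
theorem rightPoint_lt_rightPoint {a b : Fin n} : rightPoint a < rightPoint b ↔ a < b := by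
  rw [Fin.lt_def, Fin.lt_def, val_rightPoint, val_rightPoint]
  omega

theorem leftPoint_lt_midPoint (a : Fin n) : leftPoint a < midPoint n := by
  simp [Fin.lt_def]

theorem midPoint_lt_rightPoint (a : Fin n) : midPoint n < rightPoint a := by
  simp [Fin.lt_def]
  omega

theorem leftPoint_lt_rightPoint (a b : Fin n) : leftPoint a < rightPoint b :=
  (leftPoint_lt_midPoint a).trans (midPoint_lt_rightPoint b)

theorem leftPoint_injective : Function.Injective (leftPoint (n := n)) := fun a b h => by
  simpa [leftPoint, Fin.ext_iff] using h

theorem rightPoint_injective : Function.Injective (rightPoint (n := n)) := fun a b h => by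
  simpa [rightPoint, Fin.ext_iff] using h

theorem crossMatching_mem : crossMatching σ ∈ matchingsB n := by
  simp only [matchingsB, Finset.mem_filter, Finset.mem_univ, true_and]
  refine ⟨fun k => ?_, fun k hk => ?_, fun k hk => ?_⟩
  · induction k using point_cases <;> simp
  · have : k = midPoint n := Fin.ext hk
    rw [this, crossMatching_mid]
  · have : k = leftPoint ⟨k, hk⟩ := rfl
    rw [this, crossMatching_left, val_rightPoint]
    omega

theorem crossMatching_injective : Function.Injective (crossMatching (n := n)) := by
  intro σ τ h
  ext k : 1
  apply rightPoint_injective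
  rw [← crossMatching_left, h, crossMatching_left]

theorem exists_crossMatching {π : Equiv.Perm (Fin (2 * n + 1))} (hπ : π ∈ matchingsB n) :
    ∃ σ, crossMatching σ = π := by
  simp only [matchingsB, Finset.mem_filter, Finset.mem_univ, true_and] at hπ
  obtain ⟨h1, h2, h3⟩ := hπ
  have hr : ∀ k : Fin n, ∃ j, π (leftPoint k) = rightPoint j := by
    intro k
    have h := h3 (leftPoint k) k.2
    exact ⟨⟨π (leftPoint k) - (n + 1), by omega⟩, Fin.ext (by simp; omega)⟩
  choose s hs using hr
  have hinj : Function.Injective s := fun a b hab => by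
    apply leftPoint_injective
    apply π.injective
    rw [hs, hs, hab]
  let σ := Equiv.ofBijective s (Finite.injective_iff_bijective.1 hinj)
  have hσ : ∀ k, σ k = s k := fun k => rfl
  refine ⟨σ, ?_⟩
  ext x : 1
  induction x using point_cases with
  | left k => rw [crossMatching_left, hs, hσ]
  | mid => rw [crossMatching_mid, h2 _ rfl]
  | right k =>
    obtain ⟨j, rfl⟩ := σ.surjective k
    rw [crossMatching_right, Equiv.symm_apply_apply, hσ, ← hs, h1]

/-- The positions at which the pairs of `crossMatching σ` are contracted. The left end of each pair
is always in the first position; the position of the right end is determined by the number of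
subsequent pairs that end on its left. -/
def crossPositions (σ : Equiv.Perm (Fin n)) : List (ℕ × ℕ) :=
  (List.finRange n).map fun k =>
    (0, n - k + 1 + ∑ j, if k < j ∧ σ j < σ k then 1 else 0)

theorem sum_lt (k : Fin n) : (∑ j : Fin n, if j < k then 1 else 0) = (k : ℕ) := by
  rw [← Finset.card_filter]
  have : (Finset.univ.filter fun j : Fin n => j < k) = Finset.Iio k := by ext; simp
  rw [this, Fin.card_Iio]

theorem matchingPositions_crossMatching :
    matchingPositions (crossMatching σ) = crossPositions σ := by
  have hl : ((List.finRange (2 * n + 1)).filter fun i : Fin (2 * n + 1) => i < crossMatching σ i) =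
      (List.finRange n).map leftPoint := by
    refine List.SortedLT.eq_of_mem_iff ?_ ?_ fun x => ?_
    · exact ((List.sortedLT_finRange _).pairwise.filter _).sortedLT
    · exact (List.pairwise_map.2 ((List.pairwise_lt_finRange n).imp
        leftPoint_lt_leftPoint.2)).sortedLT
    · rw [List.mem_filter, List.mem_map]
      induction x using point_cases with
      | left k => simp [leftPoint_lt_rightPoint]
      | mid => simpa using fun x => (leftPoint_lt_midPoint x).ne
      | right k =>
        simpa [(leftPoint_lt_rightPoint _ _).not_gt] using fun x => (leftPoint_lt_rightPoint x k).ne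
  rw [matchingPositions, hl, crossPositions, List.map_map]
  refine List.map_congr_left fun k _ => ?_
  have h1 : removedBefore (crossMatching σ) (leftPoint k) (leftPoint k) = k := by
    rw [removedBefore, Finset.card_filter, sum_points, ← sum_lt k]
    simp [(leftPoint_lt_rightPoint _ _).ne', (leftPoint_lt_rightPoint _ _).le,
      (leftPoint_lt_rightPoint _ _).not_gt]
  have h2 : removedBefore (crossMatching σ) (leftPoint k) (rightPoint (σ k)) =
      k + ∑ j : Fin n, if j < k ∧ σ j < σ k then 1 else 0 := by
    rw [removedBefore, Finset.card_filter, sum_points, ← sum_lt k]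
    have : ∑ j, (if j < k ∧ σ j < σ k then 1 else 0) =
        ∑ j, if j < σ k ∧ σ.symm j < k then 1 else 0 := by
      rw [← Equiv.sum_comp σ fun j => if j < σ k ∧ σ.symm j < k then 1 else 0]
      simp [and_comm]
    rw [this]
    simp [leftPoint_lt_rightPoint, (leftPoint_lt_rightPoint _ _).ne',
      (leftPoint_lt_rightPoint _ _).le, (leftPoint_lt_rightPoint _ _).ne, and_comm]
  have h3 : (∑ j : Fin n, if j < k ∧ σ j < σ k then 1 else 0) +
      (∑ j : Fin n, if k < j ∧ σ j < σ k then 1 else 0) = (σ k : ℕ) := by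
    rw [← sum_lt (σ k), ← Equiv.sum_comp σ fun j => if j < σ k then 1 else 0,
      ← Finset.sum_add_distrib]
    refine Finset.sum_congr rfl fun j _ => ?_
    rcases lt_trichotomy j k with h | h | h
    · simp [h, h.not_gt]
    · simp [h]
    · simp [h, h.not_gt]
  have hk := k.2
  rw [Function.comp_apply, crossMatching_left, h1, h2, val_leftPoint, val_rightPoint, Nat.sub_self,
    Prod.mk.injEq]
  exact ⟨rfl, by omega⟩

/-- The permutation of `n + 1` points with `0 ↦ p` that induces the permutation `τ` between the
remaining points. -/
def permCons (p : Fin (n + 1)) (τ : Equiv.Perm (Fin n)) : Equiv.Perm (Fin (n + 1)) :=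
  (finSuccEquiv' 0).trans ((Equiv.optionCongr τ).trans (finSuccEquiv' p).symm)

@[simp]
theorem permCons_zero (p : Fin (n + 1)) (τ : Equiv.Perm (Fin n)) : permCons p τ 0 = p := by
  simp [permCons]

@[simp]
theorem permCons_succ (p : Fin (n + 1)) (τ : Equiv.Perm (Fin n)) (k : Fin n) :
    permCons p τ k.succ = p.succAbove (τ k) := by
  have : finSuccEquiv' 0 k.succ = some k := by
    rw [← Fin.succAbove_zero]; exact finSuccEquiv'_succAbove 0 k
  simp [permCons, this]

theorem permCons_bijective :
    Function.Bijective fun q : Fin (n + 1) × Equiv.Perm (Fin n) => permCons q.1 q.2 := by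
  rw [Fintype.bijective_iff_injective_and_card]
  constructor
  · rintro ⟨p, τ⟩ ⟨p', τ'⟩ h
    have h' := fun k => DFunLike.congr_fun h k
    have hp : p = p' := by simpa using h' 0
    subst hp
    rw [Prod.mk.injEq]
    refine ⟨rfl, Equiv.ext fun k => ?_⟩
    simpa using h' k.succ
  · simp [Fintype.card_perm, Nat.factorial_succ]

/-- The pair of the first left point is contracted first; this leaves the matching of the induced
permutation. -/
theorem crossPositions_permCons (p : Fin (n + 1)) (τ : Equiv.Perm (Fin n)) :
    crossPositions (permCons p τ) = (0, n + 2 + p) :: crossPositions τ := by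
  have hp : (∑ k : Fin n, if k.castSucc < p then 1 else 0) = (p : ℕ) := by
    have := sum_lt p
    rw [Fin.sum_univ_castSucc] at this
    rwa [if_neg (Fin.le_last p).not_gt, add_zero] at this
  rw [crossPositions, List.finRange_succ, List.map_cons, List.map_map, crossPositions]
  congr 1
  · rw [Prod.mk.injEq]
    refine ⟨rfl, ?_⟩
    rw [Fin.sum_univ_succ]
    simp only [permCons_zero, permCons_succ, lt_irrefl, false_and, if_false, Fin.succ_pos, true_and,
      Fin.succAbove_lt_iff_castSucc_lt]
    rw [Equiv.sum_comp τ fun k => if k.castSucc < p then 1 else 0, hp]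
    simp
  · refine List.map_congr_left fun k _ => ?_
    rw [Function.comp_apply, Fin.sum_univ_succ, Prod.mk.injEq]
    refine ⟨rfl, ?_⟩
    simp only [permCons_succ, Fin.not_lt_zero, false_and, if_false, Fin.succ_lt_succ_iff,
      Fin.val_succ, (Fin.strictMono_succAbove p).lt_iff_lt]
    omega

end Matchings

/-! ### Sums over matchings as components of the dual operator -/

section WickSum

variable {E : Type u} [NormedAddCommGroup E] [InnerProductSpace ℂ E] [FiniteDimensional ℂ E]
  (T : StrictTwist E) (H : StandardSubspace E)

theorem dualComponent_add_two_one (N : ℕ) : dualComponent T H (N + 2) 1 =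
    -(dualComponent T H N 1 ∘L
      ∑ b ∈ Finset.Ico ((N + 3) / 2) (N + 2), twistedContraction T H 0 b N) := by
  rw [dualComponent_add_two, dualComponent_to_zero, idTensor_zero, zero_sub, add_zero]

/-- Both sides obey the same recursion: removing the pair of the first left point leaves a
permutation of one point less, and the right end of that pair can be any of the last positions. -/
theorem sum_contractList_crossPositions (n : ℕ) :
    ∑ σ : Equiv.Perm (Fin n), contractList T H (crossPositions σ) (2 * n + 1) 1 =
      (-1 : ℂ) ^ n • dualComponent T H (2 * n + 1) 1 := by
  induction n with
  | zero =>
    rw [Fintype.sum_eq_single 1 fun σ h => (h (Subsingleton.elim _ _)).elim]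
    simp [crossPositions, contractList, dualComponent_one_one]
  | succ n ih =>
    rw [← permCons_bijective.sum_comp, Fintype.sum_prod_type]
    have h : ∀ (p : Fin (n + 1)) (τ : Equiv.Perm (Fin n)),
        contractList T H (crossPositions (permCons p τ)) (2 * (n + 1) + 1) 1 =
          contractList T H (crossPositions τ) (2 * n + 1) 1 ∘L
            twistedContraction T H 0 (n + 2 + p) (2 * n + 1) := by
      intro p τ
      rw [crossPositions_permCons]
      rfl
    have e : (2 * n + 1 + 3) / 2 = n + 2 := by omega
    have hd := dualComponent_add_two_one T H (2 * n + 1)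
    rw [e] at hd
    refine Eq.trans ?_ (congrArg ((-1 : ℂ) ^ (n + 1) • ·) hd.symm)
    simp only [h]
    rw [Finset.sum_comm]
    simp only [← ContinuousLinearMap.comp_finsetSum]
    rw [← ContinuousLinearMap.finsetSum_comp, ih, pow_succ, mul_neg_one, neg_smul_neg,
      ContinuousLinearMap.smul_comp]
    congr 2
    rw [Finset.sum_Ico_eq_sum_range, show 2 * n + 1 + 2 - (n + 2) = n + 1 by omega,
      Finset.sum_range]

/-- The twisted contractions of the matchings across the middle point add up to the component of
the dual operator in degree one. -/
theorem sum_wickContraction (n : ℕ) :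
    ∑ π ∈ matchingsB n, wickContraction T H π 1 =
      (-1 : ℂ) ^ n • dualComponent T H (2 * n + 1) 1 := by
  rw [← sum_contractList_crossPositions]
  symm
  refine Finset.sum_bij (fun σ _ => crossMatching σ) (fun σ _ => crossMatching_mem σ)
    (fun σ _ τ _ h => crossMatching_injective h)
    (fun π hπ => (exists_crossMatching hπ).imp fun σ hσ => ⟨Finset.mem_univ _, hσ⟩) fun σ _ => ?_
  rw [wickContraction, matchingPositions_crossMatching]

end WickSum

/-! ### Lower bounds for the deformed inner products -/

section Inverse

variable {E : Type u} [NormedAddCommGroup E] [InnerProductSpace ℂ E]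

/-- The factorization `R_{m+1} (1 - c) = (1 - T_1 c) R_m` with `c = T_1 ⋯ T_m`, for the partial sums
`R_m = 1 + T_1 + ⋯ + T_1 ⋯ T_{m-1}`. -/
theorem sum_twistProd_mul {T : TPow E 2 →L[ℂ] TPow E 2}
    (hT : twistAt T 0 3 * twistAt T 1 3 * twistAt T 0 3 =
      twistAt T 1 3 * twistAt T 0 3 * twistAt T 1 3) (m n : ℕ) :
    (∑ k ∈ Finset.range (m + 1), twistProd T 0 k n) * (1 - twistProd T 0 m n) =
      (1 - twistAt T 0 n * twistProd T 0 m n) * ∑ k ∈ Finset.range m, twistProd T 0 k n := by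
  have h : twistAt T 0 n * twistProd T 0 m n * ∑ k ∈ Finset.range m, twistProd T 0 k n =
      (∑ k ∈ Finset.range (m + 1), twistProd T 0 k n - 1) * twistProd T 0 m n := by
    rw [Finset.sum_range_succ', twistProd_self, add_sub_cancel_right, mul_assoc, Finset.mul_sum,
      Finset.sum_mul, Finset.mul_sum]
    refine Finset.sum_congr rfl fun k hk => ?_
    rw [← twistProd_succ_mul_twistProd hT (Finset.mem_range.1 hk), ← mul_assoc,
      ← twistProd_eq_mul_left T (Nat.succ_pos k)]
  rw [mul_sub, mul_one, sub_mul 1, one_mul, h, sub_mul, one_mul, Finset.sum_range_succ]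
  abel

variable [FiniteDimensional ℂ E]

theorem exists_right_inverse_one_sub {n : ℕ} (x : TPow E n →L[ℂ] TPow E n) (hx : ‖x‖ < 1) :
    ∃ N, (1 - x) * N = 1 ∧ ‖N‖ ≤ (1 - ‖x‖)⁻¹ := by
  have hs : Summable (x ^ · : ℕ → TPow E n →L[ℂ] TPow E n) :=
    summable_geometric_of_norm_lt_one hx
  refine ⟨∑' k, x ^ k, hs.one_sub_mul_tsum_pow, ?_⟩
  refine (tsum_geometric_le_of_norm_lt_one x hx).trans ?_
  have : ‖(1 : TPow E n →L[ℂ] TPow E n)‖ ≤ 1 := ContinuousLinearMap.norm_id_le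
  linarith

/-- The operators `R_{T,n}` of a braided twist have right inverses that are bounded uniformly in
`n`: by the factorization above, a right inverse of `R_{m+1}` is `(1 - c) R_m⁻¹ (1 - T_1 c)⁻¹` with
`‖c‖ ≤ q ^ m`, `q = ‖T‖`, so that its norm exceeds that of `R_m⁻¹` by a factor of at most
`(1 + q ^ m) / (1 - q ^ m)`, and the product of these factors converges. -/
theorem exists_right_inverse_twistR {T : TPow E 2 →L[ℂ] TPow E 2} (hq : ‖T‖ < 1)
    (hT : twistAt T 0 3 * twistAt T 1 3 * twistAt T 0 3 =
      twistAt T 1 3 * twistAt T 0 3 * twistAt T 1 3) (n : ℕ) :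
    ∃ S, twistR T (n + 1) * S = 1 ∧ ‖S‖ ≤ Real.exp (2 / (1 - ‖T‖) ^ 2) := by
  set q := ‖T‖ with hqdef
  have hq0 : 0 ≤ q := norm_nonneg _
  have h1q : 0 < 1 - q := sub_pos.2 hq
  have key : ∀ m, ∃ S, (∑ k ∈ Finset.range (m + 1), twistProd T 0 k (n + 1)) * S = 1 ∧
      ‖S‖ ≤ Real.exp (∑ k ∈ Finset.range m, 2 * q ^ k / (1 - q)) := by
    intro m
    induction m with
    | zero =>
      refine ⟨1, by simp [twistProd_self], ?_⟩
      simpa using! ContinuousLinearMap.norm_id_le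
    | succ m ih =>
      obtain ⟨S, hS, hSn⟩ := ih
      have hc : ‖twistProd T 0 (m + 1) (n + 1)‖ ≤ q ^ (m + 1) := norm_twistProd_le T 0 (m + 1) _
      have hqm : q ^ (m + 1) ≤ q := pow_le_of_le_one hq0 hq.le (by omega)
      have hx : ‖twistAt T 0 (n + 1) * twistProd T 0 (m + 1) (n + 1)‖ ≤ q := by
        refine (norm_mul_le _ _).trans ?_
        calc _ ≤ q * q ^ (m + 1) := mul_le_mul (norm_twistAt_le T 0 _) hc (norm_nonneg _) hq0
          _ ≤ q * 1 := by gcongr; exact hqm.trans hq.le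
          _ = q := mul_one _
      have hx' : ‖twistAt T 0 (n + 1) * twistProd T 0 (m + 1) (n + 1)‖ ≤ q ^ (m + 1) := by
        refine (norm_mul_le _ _).trans ?_
        calc _ ≤ 1 * q ^ (m + 1) :=
              mul_le_mul ((norm_twistAt_le T 0 _).trans hq.le) hc (norm_nonneg _) zero_le_one
          _ = _ := one_mul _
      obtain ⟨N, hN, hNn⟩ := exists_right_inverse_one_sub _ (hx.trans_lt hq)
      refine ⟨(1 - twistProd T 0 (m + 1) (n + 1)) * S * N, ?_, ?_⟩
      · rw [← mul_assoc, ← mul_assoc, sum_twistProd_mul hT, mul_assoc _ _ S, hS, mul_one, hN]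
      · have h1 : ‖(1 - twistProd T 0 (m + 1) (n + 1))‖ ≤ 1 + q ^ (m + 1) := by
          refine (norm_sub_le _ _).trans (add_le_add ?_ hc)
          exact ContinuousLinearMap.norm_id_le
        have h2 : ‖N‖ ≤ (1 - q ^ (m + 1))⁻¹ := by
          refine hNn.trans ?_
          gcongr
          exact sub_pos.2 (hqm.trans_lt hq)
        have h3 : 0 < 1 - q ^ (m + 1) := sub_pos.2 (hqm.trans_lt hq)
        have h4 : (1 + q ^ (m + 1)) * (1 - q ^ (m + 1))⁻¹ ≤ Real.exp (2 * q ^ m / (1 - q)) := by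
          refine le_trans ?_ (Real.add_one_le_exp _)
          rw [← div_eq_mul_inv, div_le_iff₀ h3, add_mul]
          have h5 : 2 * q ^ (m + 1) ≤ 2 * q ^ m / (1 - q) * (1 - q ^ (m + 1)) := by
            rw [div_mul_eq_mul_div, le_div_iff₀ h1q]
            refine mul_le_mul ?_ (by linarith) h1q.le (by positivity)
            have : q ^ (m + 1) ≤ q ^ m := pow_le_pow_of_le_one hq0 hq.le (Nat.le_succ m)
            linarith
          linarith
        rw [Finset.sum_range_succ, Real.exp_add]
        calc ‖(1 - twistProd T 0 (m + 1) (n + 1)) * S * N‖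
            ≤ ‖(1 - twistProd T 0 (m + 1) (n + 1))‖ * ‖S‖ * ‖N‖ :=
              (norm_mul_le _ _).trans (by gcongr; exact norm_mul_le _ _)
          _ ≤ (1 + q ^ (m + 1)) * Real.exp (∑ k ∈ Finset.range m, 2 * q ^ k / (1 - q)) *
              (1 - q ^ (m + 1))⁻¹ := by gcongr
          _ = Real.exp (∑ k ∈ Finset.range m, 2 * q ^ k / (1 - q)) *
              ((1 + q ^ (m + 1)) * (1 - q ^ (m + 1))⁻¹) := by ring
          _ ≤ _ := by gcongr
  obtain ⟨S, hS, hSn⟩ := key n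
  refine ⟨S, hS, hSn.trans (Real.exp_le_exp.2 ?_)⟩
  have hg : ∑ k ∈ Finset.range n, q ^ k ≤ (1 - q)⁻¹ := by
    rw [← tsum_geometric_of_lt_one hq0 hq]
    exact (summable_geometric_of_lt_one hq0 hq).sum_le_tsum _ fun k _ => pow_nonneg hq0 _
  calc ∑ k ∈ Finset.range n, 2 * q ^ k / (1 - q)
      = 2 / (1 - q) * ∑ k ∈ Finset.range n, q ^ k := by
        rw [Finset.mul_sum]
        exact Finset.sum_congr rfl fun k _ => by ring
    _ ≤ 2 / (1 - q) * (1 - q)⁻¹ := by gcongr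
    _ = _ := by rw [← div_eq_mul_inv, div_div, sq]

end Inverse

section LowerBound

variable {E : Type u} [NormedAddCommGroup E] [InnerProductSpace ℂ E] [FiniteDimensional ℂ E]
  (T : StrictTwist E)

/-- The exponential rate in the lower bound for the operators `P_{T,n}`, a bound for the norms of
the right inverses of all `R_{T,n}`. -/
def boundConst : ℝ := Real.exp (2 / (1 - ‖T.op‖) ^ 2)

theorem one_le_boundConst : 1 ≤ boundConst T := Real.one_le_exp (by positivity)

variable {T}

/-- The lower bound `P_{T,n} ≥ C^{-n}`. If `S` is a right inverse of `R_{T,n+1}`, then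
`1 ⊗ P_{T,n} = P_{T,n+1} S`, hence `1 ⊗ P_{T,n} ≤ ‖S‖ P_{T,n+1}`. -/
theorem one_le_twistP (hT : IsBraided T) (n : ℕ) : 1 ≤ boundConst T ^ n • twistP T.op n := by
  induction n with
  | zero => simp [twistP]
  | succ n ih =>
    obtain ⟨S, hS, hSn⟩ := exists_right_inverse_twistR T.norm_lt_one hT n
    have h1 := twist_inequality (idTensor (twistP T.op n)) (twistP T.op (n + 1)) S
      (idTensor_nonneg (T.strictlyPositive n).1) (T.strictlyPositive (n + 1)).1 (by
        rw [twistP, mul_assoc, hS, mul_one])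
    have h2 : idTensor (twistP T.op n) ≤ boundConst T • twistP T.op (n + 1) :=
      h1.trans (smul_le_smul_of_nonneg_right hSn (T.strictlyPositive (n + 1)).1)
    have h3 : (1 : TPow E (n + 1) →L[ℂ] TPow E (n + 1)) ≤
        boundConst T ^ n • idTensor (twistP T.op n) := by
      have h4 := idTensor_nonneg (sub_nonneg.2 ih)
      rw [idTensor_sub] at h4
      have h5 : idTensor (boundConst T ^ n • twistP T.op n) =
          boundConst T ^ n • idTensor (twistP T.op n) := ext_tcons fun ξ v => by
        simp [idTensor_tcons]
      have h6 : idTensor (1 : TPow E n →L[ℂ] TPow E n) = 1 := idTensor_id n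
      rw [h5, h6] at h4
      exact sub_nonneg.1 h4
    rw [pow_succ, mul_smul]
    exact h3.trans (smul_le_smul_of_nonneg_left h2 (pow_nonneg (zero_le_one.trans
      (one_le_boundConst T)) n))

theorem norm_sq_le (hT : IsBraided T) {n : ℕ} (v : TPow E n) :
    ‖v‖ ^ 2 ≤ boundConst T ^ n * ‖toFiber T n v‖ ^ 2 := by
  have h1 := ((ContinuousLinearMap.le_def _ _).1 (one_le_twistP hT n)).re_inner_nonneg_right v
  have h2 : ((boundConst T ^ n • twistP T.op n - 1) v) =
      ((boundConst T ^ n : ℝ) : ℂ) • twistP T.op n v - v := rfl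
  rw [h2, inner_sub_right, inner_smul_right, map_sub, ← fiber_inner, inner_self_eq_norm_sq] at h1
  rw [← inner_self_eq_norm_sq (𝕜 := ℂ) (toFiber T n v)]
  simp only [RCLike.re_to_complex, Complex.re_ofReal_mul] at h1 ⊢
  linarith

theorem twistP_inverse_apply (n : ℕ) (u : TPow E n) :
    twistP T.op n (Ring.inverse (twistP T.op n) u) = u := by
  have h := Ring.mul_inverse_cancel _ (T.strictlyPositive n).isUnit
  exact DFunLike.congr_fun h u

theorem norm_toFiber_inverse_le (hT : IsBraided T) {n : ℕ} (u : TPow E n) :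
    ‖toFiber T n (Ring.inverse (twistP T.op n) u)‖ ≤ boundConst T ^ n * ‖u‖ := by
  set w := Ring.inverse (twistP T.op n) u with hw
  have h1 : ‖toFiber T n w‖ ^ 2 ≤ ‖w‖ * ‖u‖ := by
    rw [← inner_self_eq_norm_sq (𝕜 := ℂ), fiber_inner, hw, twistP_inverse_apply]
    exact (RCLike.re_le_norm _).trans (norm_inner_le_norm _ _)
  have h2 := norm_sq_le hT w
  have h3 : ‖w‖ ≤ boundConst T ^ n * ‖toFiber T n w‖ := by
    have hC : 1 ≤ boundConst T ^ n := one_le_pow₀ (one_le_boundConst T)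
    refine abs_le_of_sq_le_sq' ?_ (by positivity) |>.2
    refine h2.trans ?_
    rw [mul_pow]
    gcongr
    nlinarith
  rcases (norm_nonneg (toFiber T n w)).eq_or_lt with h0 | h0
  · rw [← h0]
    have := one_le_boundConst T
    positivity
  · have h4 : ‖toFiber T n w‖ * ‖toFiber T n w‖ ≤ boundConst T ^ n * ‖u‖ * ‖toFiber T n w‖ := by
      rw [← sq]
      calc _ ≤ _ := h1
        _ ≤ boundConst T ^ n * ‖toFiber T n w‖ * ‖u‖ := by gcongr
        _ = _ := by ring
    exact le_of_mul_le_mul_right h4 h0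

end LowerBound

/-! ### Convergence of the conjugate variables -/

section Convergence

variable {E : Type u} [NormedAddCommGroup E] [InnerProductSpace ℂ E] [FiniteDimensional ℂ E]
  (T : StrictTwist E) (H : StandardSubspace E)

theorem exists_norm_contraction_le : ∃ K : ℝ, 0 ≤ K ∧ ∀ k, ‖contraction H 0 k‖ ≤ K := by
  let p : TPow E 2 →L[ℂ] ℂ := LinearMap.toContinuousLinearMap (pairing H)
  refine ⟨‖p‖, norm_nonneg _, fun k => ?_⟩
  refine ContinuousLinearMap.opNorm_le_bound _ (norm_nonneg _) fun x => ?_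
  have h : contraction H 0 k x = TensorProduct.lidIsometry ℂ (TPow E k)
      (p.rTensor (TPow E k) (tpowSplit E k x)) := by
    rw [contraction]
    rfl
  rw [h, LinearIsometryEquiv.norm_map]
  refine ((p.rTensor (TPow E k)).le_opNorm _).trans ?_
  rw [LinearIsometryEquiv.norm_map]
  gcongr
  exact ContinuousLinearMap.norm_rTensor_le _ p

/-- The dual operator in degree one decays like `n! K^n q^{n(n+1)/2}`, `q = ‖T‖`, because the
contraction line of the `k`-th pair counted from the middle passes over at least `k` strands. -/
theorem norm_dualComponent_le {K : ℝ} (hK0 : 0 ≤ K) (hK : ∀ k, ‖contraction H 0 k‖ ≤ K) (n : ℕ) :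
    ‖dualComponent T H (2 * n + 1) 1‖ ≤
      ∏ k ∈ Finset.range n, ((k + 1 : ℕ) * (K * ‖T.op‖ ^ (k + 1))) := by
  induction n with
  | zero =>
    simpa [dualComponent_one_one] using ContinuousLinearMap.norm_id_le
  | succ n ih =>
    have e : (2 * n + 1 + 3) / 2 = n + 2 := by omega
    have hd := dualComponent_add_two_one T H (2 * n + 1)
    rw [e] at hd
    rw [Finset.prod_range_succ]
    refine (congrArg norm hd).le.trans ?_
    rw [norm_neg]
    refine (ContinuousLinearMap.opNorm_comp_le _ _).trans ?_
    refine mul_le_mul ih ?_ (norm_nonneg _) (by positivity)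
    refine (norm_sum_le_of_le (f := fun b => twistedContraction T H 0 b (2 * n + 1))
      (n := fun _ => K * ‖T.op‖ ^ (n + 1)) _ fun b hb => ?_).trans ?_
    · refine (ContinuousLinearMap.opNorm_comp_le _ _).trans ?_
      refine mul_le_mul (hK _) ((norm_twistProd_le _ _ _ _).trans ?_) (norm_nonneg _) hK0
      exact pow_le_pow_of_le_one (norm_nonneg _) T.norm_lt_one.le
        (by have := Finset.mem_Ico.1 hb; omega)
    · rw [Finset.sum_const, Nat.card_Ico, nsmul_eq_mul,
        show 2 * n + 1 + 2 - (n + 2) = n + 1 by omega]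

/-- The terms of the series are, up to a sign, the images of `ξ` under the adjoint of the dual
operator for the deformed inner products. -/
theorem conjugateTerm_eq (n : ℕ) (ξ : E) : conjugateTerm T H n ξ =
    Ring.inverse (twistP T.op (2 * n + 1)) ((-1 : ℂ) ^ n •
      ContinuousLinearMap.adjoint (dualComponent T H (2 * n + 1) 1) (tone ξ)) := by
  have h := congrArg (fun A => ContinuousLinearMap.adjoint A (tone ξ)) (sum_wickContraction T H n)
  simp only [map_sum, map_smulₛₗ, map_pow, map_neg, map_one] at h
  rw [conjugateTerm]
  congr 1
  refine Eq.trans ?_ h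
  simp

variable {T} in
/-- The series of the conjugate variable converges absolutely: the decay of the dual operator beats
the exponential growth of `P_{T,n}⁻¹`. -/
theorem summable_conjugateTerm (hT : IsBraided T) (ξ : E) :
    Summable fun n : ℕ => (-1 : ℂ) ^ n • toFock T (2 * n + 1) (conjugateTerm T H n ξ) := by
  obtain ⟨K, hK0, hK⟩ := exists_norm_contraction_le H
  set q := ‖T.op‖ with hq
  set C := boundConst T with hC
  have hC1 : 1 ≤ C := one_le_boundConst T
  let β : ℕ → ℝ := fun n => C ^ (2 * n + 1) *
    ((∏ k ∈ Finset.range n, ((k + 1 : ℕ) * (K * q ^ (k + 1)))) * ‖ξ‖)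
  have hβ : ∀ n, 0 ≤ β n := fun n => by positivity
  have hsum : Summable β := by
    -- The quotient of consecutive terms is a constant times `(n + 1) q^(n + 1)`, which tends to 0.
    refine summable_of_ratio_norm_eventually_le (r := 1 / 2) (by norm_num) ?_
    have ht : Filter.Tendsto (fun n : ℕ => C ^ 2 * K * (((n + 1 : ℕ) : ℝ) * q ^ (n + 1)))
        Filter.atTop (nhds 0) := by
      have h := (tendsto_self_mul_const_pow_of_lt_one (norm_nonneg _) T.norm_lt_one).comp
        (Filter.tendsto_add_atTop_nat 1)
      simpa using! h.const_mul (C ^ 2 * K)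
    filter_upwards [ht.eventually_lt_const (show (0 : ℝ) < 1 / 2 by norm_num)] with n hn
    rw [Real.norm_of_nonneg (hβ _), Real.norm_of_nonneg (hβ _)]
    have : β (n + 1) = C ^ 2 * K * (((n + 1 : ℕ) : ℝ) * q ^ (n + 1)) * β n := by
      simp only [β, Finset.prod_range_succ]
      ring
    rw [this]
    exact mul_le_mul_of_nonneg_right hn.le (hβ n)
  refine hsum.of_norm_bounded fun n => ?_
  rw [norm_smul, norm_pow, norm_neg, norm_one, one_pow, one_mul]
  have h1 : ‖toFock T (2 * n + 1) (conjugateTerm T H n ξ)‖ =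
      ‖toFiber T (2 * n + 1) (conjugateTerm T H n ξ)‖ := by
    rw [toFock]
    exact lp.norm_single (by norm_num) _ _
  rw [h1, conjugateTerm_eq]
  refine (norm_toFiber_inverse_le hT _).trans ?_
  refine mul_le_mul_of_nonneg_left ?_ (by positivity)
  rw [norm_smul, norm_pow, norm_neg, norm_one, one_pow, one_mul]
  refine (ContinuousLinearMap.le_opNorm _ _).trans ?_
  have h2 : ‖tone ξ‖ = ‖ξ‖ := by
    rw [tone, norm_tcons]; simp [tpowOne]
  rw [h2, LinearIsometryEquiv.norm_map]
  exact mul_le_mul_of_nonneg_right (norm_dualComponent_le T H hK0 hK n) (norm_nonneg _)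

end Convergence

/-! ### The matrix of the modular operator -/

section ModularMatrix

variable {E : Type u} [NormedAddCommGroup E] [InnerProductSpace ℂ E]
  {H : StandardSubspace E} {d : ℕ} {e : Fin d → E}

theorem IsRealOrthonormalBasis.mem (he : IsRealOrthonormalBasis H e) (i : Fin d) :
    e i ∈ H.toClosedSubmodule := by
  have : e i ∈ H.toClosedSubmodule.toSubmodule := by
    rw [← he.span_eq]; exact Submodule.subset_span ⟨i, rfl⟩
  exact this

/-- This holds since the real parts of the inner products are those of an orthonormal basis. -/
theorem IsRealOrthonormalBasis.gram_add_transpose (he : IsRealOrthonormalBasis H e) :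
    (Matrix.gram ℂ e).transpose + Matrix.gram ℂ e = 2 := by
  ext j k
  have h : ⟪e k, e j⟫_ℂ + ⟪e j, e k⟫_ℂ = (2 * (⟪e j, e k⟫_ℂ).re : ℝ) := by
    rw [← inner_conj_symm (e k), add_comm, Complex.add_conj]
  rw [Matrix.add_apply, Matrix.transpose_apply, Matrix.gram_apply, Matrix.gram_apply, h,
    he.re_inner, ← Matrix.diagonal_ofNat', Matrix.diagonal_apply]
  split_ifs <;> simp

variable [FiniteDimensional ℂ E]

theorem IsRealOrthonormalBasis.basis_apply (he : IsRealOrthonormalBasis H e) (i : Fin d) :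
    he.basis i = e i := Module.Basis.mk_apply _ _ i

theorem modularOp_modularPow_neg_one (H : StandardSubspace E) (x : E) :
    modularOp H (modularPow H (-1) x) = x := by
  obtain ⟨n, b, l, hb, hp⟩ := exists_modular_basis H
  have := b.toBasis.ext (f₁ := (modularOp H ∘L modularPow H (-1)).toLinearMap)
    (f₂ := LinearMap.id) fun i => by
      simp [hb, hp, smul_smul, ← Complex.exp_add]
  exact DFunLike.congr_fun this x

/-- The Gram matrix `G` of `(e_i)` and the matrix `A` of `Δ⁻¹` satisfy `Gᵀ A = G`, because
`⟪x, Δ y⟫ = ⟪S y, S x⟫` and `S e_i = e_i`. -/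
theorem IsRealOrthonormalBasis.gram_mul_modularMatrix (he : IsRealOrthonormalBasis H e) :
    (Matrix.gram ℂ e).transpose * he.modularMatrix = Matrix.gram ℂ e := by
  ext j k
  have h1 : modularPow H (-1) (e k) = ∑ i, he.modularMatrix i k • e i := by
    have := (he.basis.sum_repr (modularPow H (-1) (e k))).symm
    simpa [IsRealOrthonormalBasis.modularMatrix, LinearMap.toMatrix_apply, he.basis_apply]
      using this
  have h2 : ⟪e j, modularOp H (modularPow H (-1) (e k))⟫_ℂ = ⟪e j, e k⟫_ℂ := by
    rw [modularOp_modularPow_neg_one]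
  rw [h1, map_sum, inner_sum] at h2
  simp only [map_smul, inner_smul_right, inner_modularOp, tomita_of_mem H (he.mem _)] at h2
  rw [Matrix.mul_apply, Matrix.gram_apply, ← h2]
  refine Finset.sum_congr rfl fun i _ => ?_
  rw [Matrix.transpose_apply, Matrix.gram_apply, mul_comm]

theorem IsRealOrthonormalBasis.gram_mul_one_add_modularMatrix (he : IsRealOrthonormalBasis H e) :
    ((2 : ℂ)⁻¹ • (Matrix.gram ℂ e).transpose) * (1 + he.modularMatrix) = 1 := by
  have h : (2 : Matrix (Fin d) (Fin d) ℂ) = (2 : ℂ) • 1 := by rw [two_smul, one_add_one_eq_two]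
  rw [Matrix.smul_mul, mul_add, mul_one, he.gram_mul_modularMatrix, he.gram_add_transpose, h,
    smul_smul, inv_mul_cancel₀ two_ne_zero, one_smul]

theorem IsRealOrthonormalBasis.two_smul_inv (he : IsRealOrthonormalBasis H e) :
    (2 : ℂ) • (1 + he.modularMatrix)⁻¹ = (Matrix.gram ℂ e).transpose := by
  rw [Matrix.inv_eq_left_inv he.gram_mul_one_add_modularMatrix, smul_smul,
    mul_inv_cancel₀ two_ne_zero, one_smul]

theorem IsRealOrthonormalBasis.two_smul_mul_inv (he : IsRealOrthonormalBasis H e) :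
    (2 : ℂ) • (he.modularMatrix * (1 + he.modularMatrix)⁻¹) = Matrix.gram ℂ e := by
  have h : (1 + he.modularMatrix)⁻¹ + he.modularMatrix * (1 + he.modularMatrix)⁻¹ = 1 := by
    have := Matrix.mul_nonsing_inv _
      (Matrix.isUnit_det_of_left_inverse he.gram_mul_one_add_modularMatrix)
    rwa [add_mul, one_mul] at this
  rw [eq_sub_of_add_eq' h, smul_sub, he.two_smul_inv, sub_eq_iff_eq_add', he.gram_add_transpose,
    two_smul, one_add_one_eq_two]

theorem IsRealOrthonormalBasis.modularMatrix_posDef (he : IsRealOrthonormalBasis H e) :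
    he.modularMatrix.PosDef := by
  have hGA := he.gram_mul_modularMatrix
  have hGG := he.gram_add_transpose
  set G := Matrix.gram ℂ e with hG
  have hli : LinearIndependent ℂ e := by
    have := he.basis.linearIndependent
    rwa [show ⇑he.basis = e from funext he.basis_apply] at this
  have hpd : G.PosDef := Matrix.posDef_gram_of_linearIndependent hli
  have hpt : G.transpose.PosDef := hpd.transpose
  have h1 : G.transpose⁻¹ * G = he.modularMatrix := by
    nth_rewrite 2 [← hGA]
    rw [← mul_assoc, Matrix.nonsing_inv_mul _ ((Matrix.isUnit_iff_isUnit_det _).1 hpt.isUnit),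
      one_mul]
  -- Multiplying `A = (Gᵀ)⁻¹ G` by `Gᵀ + G = 2` shows that `2 A` is a sum of positive matrices.
  have h2 : (2 : ℂ) • he.modularMatrix = G + G.conjTranspose * G.transpose⁻¹ * G := by
    rw [hpd.isHermitian.eq, mul_assoc, h1]
    nth_rewrite 1 [← hGA]
    rw [← add_mul, hGG, two_smul, two_mul]
  have h3 : ((2 : ℂ) • he.modularMatrix).PosDef := by
    rw [h2]
    exact hpd.add_posSemidef (hpt.inv.posSemidef.conjTranspose_mul_mul_same G)
  have h4 := h3.smul (a := (2 : ℝ)⁻¹) (by norm_num)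
  rwa [← Complex.coe_smul, smul_smul, Complex.ofReal_inv, Complex.ofReal_ofNat,
    inv_mul_cancel₀ two_ne_zero, one_smul] at h4

end ModularMatrix

/-! ### Field operators on the Fock space -/

section FockSpace

variable {E : Type u} [NormedAddCommGroup E] [InnerProductSpace ℂ E] [FiniteDimensional ℂ E]
  (T : StrictTwist E) (H : StandardSubspace E)

theorem toFock_apply (m k : ℕ) (w : TPow E m) :
    toFock T m w k = Pi.single m (toFiber T m w) k := rfl

variable {T} in
theorem inner_toFock (n : ℕ) (v : TPow E n) (F : Fock T) :
    ⟪toFock T n v, F⟫_ℂ = ⟪toFiber T n v, F n⟫_ℂ := by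
  rw [toFock]
  exact lp.inner_single_left n (toFiber T n v) F

variable {T} in
theorem ext_inner_toFock {F G : Fock T}
    (h : ∀ n v, ⟪toFock T n v, F⟫_ℂ = ⟪toFock T n v, G⟫_ℂ) : F = G := by
  ext n
  refine ext_inner_left ℂ fun v => ?_
  have := h n ((toFiber T n).symm v)
  rwa [inner_toFock, inner_toFock, LinearEquiv.apply_symm_apply] at this

/-- The adjoint of the creation operator: `P_{T,n+1} = (1 ⊗ P_{T,n}) R_{T,n+1}`, and the factor
`1 ⊗ P_{T,n}` is absorbed by the deformed inner products. -/
theorem annihilation_apply (ξ : E) (F : Fock T) (n : ℕ) (v : TPow E (n + 1))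
    (hv : F (n + 1) = toFiber T (n + 1) v) :
    annihilation T (tomita H ξ) F n = toFiber T n (annihilationComponent T H ξ n v) := by
  refine ext_inner_left ℂ fun w => ?_
  obtain ⟨w, rfl⟩ := (toFiber T n).surjective w
  rw [← inner_toFock, annihilation, ContinuousLinearMap.adjoint_inner_right, creation_toFock,
    inner_toFock, hv, fiber_inner, fiber_inner, annihilationComponent_apply, twistP]
  have hsym : ∀ a b, ⟪a, twistP T.op n b⟫_ℂ = ⟪twistP T.op n a, b⟫_ℂ := fun a b =>
    (((ContinuousLinearMap.nonneg_iff_isPositive _).1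
      (T.strictlyPositive n).1).isSymmetric a b).symm
  rw [hsym, inner_contraction_tcons]
  change ⟪_, idTensor (twistP T.op n) (twistR T.op (n + 1) v)⟫_ℂ = _
  generalize twistR T.op (n + 1) v = y
  induction y using tpow_succ_induction with
  | zero => simp
  | tcons η y => rw [idTensor_tcons, inner_tcons, inner_tcons, hsym]
  | add x y hx hy => rw [map_add, inner_add_right, inner_add_right, hx, hy]

theorem fieldOp_apply (ξ : E) (F : Fock T) (f : ∀ n, TPow E n)
    (hF : ∀ n, F n = toFiber T n (f n)) (n : ℕ) :
    fieldOp T H ξ F n = toFiber T n (fieldFun T H ξ f n) := by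
  have h : fieldOp T H ξ F n = creation T ξ F n + annihilation T (tomita H ξ) F n := rfl
  rw [h, annihilation_apply T H ξ F n _ (hF (n + 1))]
  cases n with
  | zero => exact zero_add _
  | succ n =>
    have h1 : creation T ξ F (n + 1) = fiberCreation T ξ n (F n) := rfl
    rw [h1, hF n, fieldFun, map_add]
    simp [fiberCreation]

/-- The components of a word in the field operators, applied to the vacuum. -/
theorem prod_fieldOp_vacuum_apply (l : List E) (n : ℕ) :
    (l.map (fieldOp T H)).prod (vacuum T) n = toFiber T n (wordVec T H l n) := by
  induction l generalizing n with
  | nil =>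
    change vacuum T n = _
    rw [vacuum, toFock_apply, wordVec]
    by_cases h : n = 0
    · subst h; simp
    · rw [Pi.single_eq_of_ne h, Pi.single_eq_of_ne h, map_zero]
  | cons ξ l ih =>
    rw [List.map_cons, List.prod_cons]
    exact fieldOp_apply T H ξ _ _ ih n

theorem vectorState_prod_fieldOp (l : List E) :
    vectorState (vacuum T) (l.map (fieldOp T H)).prod = wordState T H l := by
  change ⟪vacuum T, (l.map (fieldOp T H)).prod (vacuum T)⟫_ℂ = _
  rw [vacuum, inner_toFock, ← vacuum, prod_fieldOp_vacuum_apply, fiber_inner]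
  change ⟪tpowOne E, wordVec T H l 0⟫_ℂ = _
  rw [← (tpowZero E).inner_map_map]
  simp [tpowOne, wordState]

theorem vectorState_fieldOp_mul_fieldOp (ξ η : E) :
    vectorState (vacuum T) (fieldOp T H ξ * fieldOp T H η) = ⟪tomita H ξ, η⟫_ℂ := by
  have h := vectorState_prod_fieldOp T H [ξ, η]
  simp only [List.map_cons, List.map_nil, List.prod_cons, List.prod_nil, mul_one] at h
  have h1 : wordVec T H [η] 1 = tone η := by
    rw [wordVec, fieldFun]
    simp [wordVec, tone]
  have h2 : twistR T.op 1 = 1 := by simp [twistR, twistProd_self]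
  rw [h, wordState, wordVec, fieldFun, annihilationComponent_apply, h1, h2]
  change tpowZero E (contraction H 0 0 (tcons 1 ξ (tone η))) = _
  rw [tone, contraction_zero_tcons]
  simp [tpowOne]

end FockSpace

/-! ### The conjugate variables -/

section Conjugate

variable {E : Type u} [NormedAddCommGroup E] [InnerProductSpace ℂ E] [FiniteDimensional ℂ E]
  (T : StrictTwist E) (H : StandardSubspace E)

/-- Only components of odd degree can be contracted to degree one. -/
theorem dualComponent_even (k : ℕ) : dualComponent T H (2 * k) 1 = 0 := by
  induction k with
  | zero => exact dualComponent_zero 1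
  | succ k ih =>
    have h := dualComponent_add_two_one T H (2 * k)
    rw [ih, ContinuousLinearMap.zero_comp, neg_zero] at h
    exact h

/-- The vector `D^* ξ`, where `D` is the component of the dual operator with values in
`E^{⊗ 1} = E`, as the sum of its homogeneous components. -/
def conjugateVector (ξ : E) : Fock T :=
  ∑' n : ℕ, (-1 : ℂ) ^ n • toFock T (2 * n + 1) (conjugateTerm T H n ξ)

theorem inner_conjugateTerm (n : ℕ) (ξ : E) (v : TPow E (2 * n + 1)) :
    ⟪conjugateTerm T H n ξ, twistP T.op (2 * n + 1) v⟫_ℂ =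
      (-1 : ℂ) ^ n * ⟪tone ξ, dualComponent T H (2 * n + 1) 1 v⟫_ℂ := by
  have hsym : ⟪conjugateTerm T H n ξ, twistP T.op (2 * n + 1) v⟫_ℂ =
      ⟪twistP T.op (2 * n + 1) (conjugateTerm T H n ξ), v⟫_ℂ :=
    (((ContinuousLinearMap.nonneg_iff_isPositive _).1
      (T.strictlyPositive (2 * n + 1)).1).isSymmetric _ _).symm
  rw [hsym, conjugateTerm_eq, twistP_inverse_apply, inner_smul_left,
    ContinuousLinearMap.adjoint_inner_left, map_pow, map_neg, map_one]

variable {T} in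
/-- `conjugateVector T H ξ` represents the functional `F ↦ ⟪ξ, D F⟫` on vectors of finite degree,
where `D` is the dual operator in degree one. -/
theorem inner_conjugateVector (hT : IsBraided T) (ξ : E) (F : Fock T) (f : ∀ n, TPow E n) (K : ℕ)
    (hF : ∀ n, F n = toFiber T n (f n)) (hf : ∀ n, K ≤ n → f n = 0) :
    ⟪conjugateVector T H ξ, F⟫_ℂ = ⟪tone ξ, dualSum T H K 1 f⟫_ℂ := by
  have h1 : HasSum
      (fun n : ℕ => ⟪F, (-1 : ℂ) ^ n • toFock T (2 * n + 1) (conjugateTerm T H n ξ)⟫_ℂ)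
      ⟪F, conjugateVector T H ξ⟫_ℂ :=
    ((summable_conjugateTerm H hT ξ).hasSum).mapL (innerSL ℂ F)
  have h2 : ∀ n, ⟪(-1 : ℂ) ^ n • toFock T (2 * n + 1) (conjugateTerm T H n ξ), F⟫_ℂ =
      ⟪tone ξ, dualComponent T H (2 * n + 1) 1 (f (2 * n + 1))⟫_ℂ := fun n => by
    rw [inner_smul_left, inner_toFock, hF, fiber_inner, inner_conjugateTerm, map_pow, map_neg,
      map_one, ← mul_assoc, ← mul_pow, neg_mul_neg, one_mul, one_pow, one_mul]
  have h3 : HasSum (fun n => ⟪tone ξ, dualComponent T H (2 * n + 1) 1 (f (2 * n + 1))⟫_ℂ)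
      ⟪conjugateVector T H ξ, F⟫_ℂ := by
    have h4 := Complex.hasSum_conj'.2 h1
    simp only [inner_conj_symm] at h4
    rwa [funext h2] at h4
  have h5 : HasSum (fun N => ⟪tone ξ, dualComponent T H N 1 (f N)⟫_ℂ)
      ⟪tone ξ, dualSum T H K 1 f⟫_ℂ := by
    rw [dualSum, inner_sum]
    refine hasSum_sum_of_ne_finset_zero fun N hN => ?_
    rw [hf N (by simpa using hN), map_zero, inner_zero_right]
  have h6 : Function.Injective fun n : ℕ => 2 * n + 1 := fun a b h => by
    simpa using h
  have h7 : HasSum ((fun N => ⟪tone ξ, dualComponent T H N 1 (f N)⟫_ℂ) ∘ fun n : ℕ => 2 * n + 1)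
      ⟪tone ξ, dualSum T H K 1 f⟫_ℂ := by
    refine (h6.hasSum_iff fun N hN => ?_).2 h5
    obtain ⟨k, rfl | rfl⟩ := N.even_or_odd'
    · rw [dualComponent_even, zero_apply, inner_zero_right]
    · exact absurd ⟨k, rfl⟩ hN
  exact h3.unique h7

end Conjugate

/-! ### The conjugate system -/

section ConjugateSystem

variable {E : Type u} [NormedAddCommGroup E] [InnerProductSpace ℂ E] [FiniteDimensional ℂ E]
  (T : StrictTwist E) (H : StandardSubspace E) {d : ℕ} {e : Fin d → E}

theorem fieldOp_isSelfAdjoint {ξ : E} (hξ : ξ ∈ H.toClosedSubmodule) :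
    IsSelfAdjoint (fieldOp T H ξ) := by
  rw [fieldOp, tomita_of_mem H hξ, annihilation]
  exact IsSelfAdjoint.add_star_self (creation T ξ)

theorem fieldOp_mem_arakiWoods {ξ : E} (hξ : ξ ∈ H.toClosedSubmodule) :
    fieldOp T H ξ ∈ arakiWoods T H := by
  change fieldOp T H ξ ∈ (StarSubalgebra.centralizer ℂ
    (StarSubalgebra.centralizer ℂ (fieldOp T H '' {ξ | ξ ∈ H.toClosedSubmodule}) :
      Set (Fock T →L[ℂ] Fock T)) : Set (Fock T →L[ℂ] Fock T))
  rw [StarSubalgebra.coe_centralizer_centralizer]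
  exact Set.subset_centralizer_centralizer (Or.inl ⟨ξ, hξ, rfl⟩)

theorem lift_fieldOp_mem_arakiWoods (he : ∀ i, e i ∈ H.toClosedSubmodule)
    (p : FreeAlgebra ℂ (Fin d)) :
    FreeAlgebra.lift ℂ (fun i => fieldOp T H (e i)) p ∈ arakiWoods T H := by
  change _ ∈ (arakiWoods T H).toStarSubalgebra
  induction p using FreeAlgebra.induction with
  | grade0 r => rw [AlgHom.commutes]; exact algebraMap_mem _ r
  | grade1 i => rw [FreeAlgebra.lift_ι_apply]; exact fieldOp_mem_arakiWoods T H (he i)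
  | mul a b ha hb => rw [map_mul]; exact mul_mem ha hb
  | add a b ha hb => rw [map_add]; exact add_mem ha hb

theorem lift_fieldOp_monomial (w : List (Fin d)) :
    FreeAlgebra.lift ℂ (fun i => fieldOp T H (e i)) (monomial w) =
      ((w.map e).map (fieldOp T H)).prod := by
  rw [monomial, map_list_prod, List.map_map, List.map_map]
  congr 2
  ext1 i
  simp

theorem annihilation_toFock_zero (ξ : E) (v : TPow E 0) :
    annihilation T (tomita H ξ) (toFock T 0 v) = 0 := by
  ext m
  rw [annihilation_apply T H ξ (toFock T 0 v) m 0, map_zero, map_zero]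
  · rfl
  · rw [map_zero, toFock_apply, Pi.single_eq_of_ne (by omega)]

theorem annihilation_toFock_succ (ξ : E) (n : ℕ) (v : TPow E (n + 1)) :
    annihilation T (tomita H ξ) (toFock T (n + 1) v) =
      toFock T n (annihilationComponent T H ξ n v) := by
  ext m
  rw [annihilation_apply T H ξ (toFock T (n + 1) v) m
    (Pi.single (M := fun j => TPow E j) (n + 1) v (m + 1))]
  · rw [toFock_apply]
    by_cases h : m = n
    · subst h; rw [Pi.single_eq_same, Pi.single_eq_same]
    · rw [Pi.single_eq_of_ne h, Pi.single_eq_of_ne (by omega), map_zero, map_zero]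
  · rw [toFock_apply]
    by_cases h : m = n
    · subst h; rw [Pi.single_eq_same, Pi.single_eq_same]
    · rw [Pi.single_eq_of_ne (by omega), Pi.single_eq_of_ne (by omega), map_zero]

/-- The vectors `p(X₁, …, X_d) Ω` for noncommutative polynomials `p`, where `X_i = X_T(e_i)`. -/
def polynomialVectors (e : Fin d → E) : Submodule ℂ (Fock T) :=
  LinearMap.range ((ContinuousLinearMap.apply ℂ (Fock T) (vacuum T)).toLinearMap ∘ₗ
    (FreeAlgebra.lift ℂ fun i => fieldOp T H (e i)).toLinearMap)

/-- The vacuum is cyclic: every vector of finite degree is obtained from it by a polynomial in the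
field operators, because `ξ ⊗ v` and `X_T(ξ) v` differ by a vector of lower degree. -/
theorem toFock_mem_polynomialVectors (he : IsRealOrthonormalBasis H e) (n : ℕ) (v : TPow E n) :
    toFock T n v ∈ polynomialVectors T H e := by
  have hX : ∀ i, ∀ F ∈ polynomialVectors T H e, fieldOp T H (e i) F ∈ polynomialVectors T H e := by
    rintro i _ ⟨p, rfl⟩
    exact ⟨FreeAlgebra.ι ℂ i * p, by simp⟩
  induction n using Nat.strong_induction_on with
  | _ n ih =>
  cases n with
  | zero =>
    rw [exists_smul_tpowOne v, map_smul]
    exact Submodule.smul_mem _ _ ⟨1, by simp [vacuum]⟩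
  | succ n =>
    induction v using tpow_succ_induction with
    | zero => rw [map_zero]; exact Submodule.zero_mem _
    | add x y hx hy => rw [map_add]; exact Submodule.add_mem _ hx hy
    | tcons ξ v =>
      rw [← he.basis.sum_repr ξ, tcons_sum_left, map_sum]
      refine Submodule.sum_mem _ fun i _ => ?_
      rw [tcons_smul_left, map_smul, he.basis_apply]
      refine Submodule.smul_mem _ _ ?_
      have h : toFock T (n + 1) (tcons n (e i) v) = fieldOp T H (e i) (toFock T n v) -
          annihilation T (tomita H (e i)) (toFock T n v) := by
        rw [← creation_toFock]
        exact (add_sub_cancel_right _ _).symm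
      rw [h]
      refine Submodule.sub_mem _ (hX i _ (ih n (by omega) v)) ?_
      cases n with
      | zero => rw [annihilation_toFock_zero]; exact Submodule.zero_mem _
      | succ k => rw [annihilation_toFock_succ]; exact ih k (by omega) _

theorem mem_closure_arakiWoods_vacuum (he : IsRealOrthonormalBasis H e) (F : Fock T) :
    F ∈ closure {v | ∃ a ∈ arakiWoods T H, v = a (vacuum T)} := by
  have hV : (polynomialVectors T H e : Set (Fock T)) ⊆
      {v | ∃ a ∈ arakiWoods T H, v = a (vacuum T)} := by
    rintro _ ⟨p, rfl⟩
    exact ⟨_, lift_fieldOp_mem_arakiWoods T H he.mem p, rfl⟩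
  refine closure_mono hV ?_
  have hs := lp.hasSum_single (p := 2) (by norm_num) F
  refine mem_closure_of_tendsto hs (Filter.Eventually.of_forall fun s => ?_)
  refine Submodule.sum_mem _ fun n _ => ?_
  have h := toFock_mem_polynomialVectors T H he n ((toFiber T n).symm (F n))
  rw [toFock] at h
  simpa using h

variable {T} in
/-- The conjugate relation for words in field operators. -/
theorem inner_conjugateVector_prod_fieldOp (hcrossing : IsCrossingSymmetric T H) (hT : IsBraided T)
    (ξ : E) (l : List E) :
    ⟪conjugateVector T H ξ, (l.map (fieldOp T H)).prod (vacuum T)⟫_ℂ =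
      ∑ k : Fin l.length, wordState T H (l.take k) * wordState T H (l.drop (k + 1)) *
        ⟪ξ, l.get k⟫_ℂ := by
  rw [inner_conjugateVector H hT ξ _ (wordVec T H l) (l.length + 1)
    (prod_fieldOp_vacuum_apply T H l) fun n hn => wordVec_of_length_lt l n (by omega),
    dualSum_wordVec_one T H (contraction_comp_twistAt_of_crossing hcrossing) hT, inner_sum]
  exact Finset.sum_congr rfl fun k _ => by rw [inner_smul_right, inner_tone]

variable {T H} in
theorem isConjugateSystem_conjugateVector (hcrossing : IsCrossingSymmetric T H)
    (hT : IsBraided T) (he : IsRealOrthonormalBasis H e) :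
    IsConjugateSystem (arakiWoods T H) (vacuum T) (fun i => fieldOp T H (e i))
      (quasiFreeDifferenceQuotient he.modularMatrix) fun i => conjugateVector T H (e i) := by
  refine fun i => ⟨mem_closure_arakiWoods_vacuum T H he _, fun p => ?_⟩
  let L : FreeAlgebra ℂ (Fin d) →ₗ[ℂ] ℂ := (innerSL ℂ (conjugateVector T H (e i))).toLinearMap ∘ₗ
    (ContinuousLinearMap.apply ℂ (Fock T) (vacuum T)).toLinearMap ∘ₗ
      (FreeAlgebra.lift ℂ fun i => fieldOp T H (e i)).toLinearMap
  suffices h : L = tensorState (vectorState (vacuum T)) (fun i => fieldOp T H (e i)) ∘ₗ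
      quasiFreeDifferenceQuotient he.modularMatrix i from DFunLike.congr_fun h p
  refine (FreeAlgebra.basisFreeMonoid ℂ (Fin d)).ext fun w => ?_
  obtain ⟨w, rfl⟩ := FreeMonoid.ofList.surjective w
  rw [basisFreeMonoid_ofList]
  have hL : L (monomial w) = ⟪conjugateVector T H (e i),
      FreeAlgebra.lift ℂ (fun i => fieldOp T H (e i)) (monomial w) (vacuum T)⟫_ℂ := rfl
  have hφ : ∀ w : List (Fin d), vectorState (vacuum T)
      (FreeAlgebra.lift ℂ (fun i => fieldOp T H (e i)) (monomial w)) = wordState T H (w.map e) :=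
    fun w => by rw [lift_fieldOp_monomial, vectorState_prod_fieldOp]
  have hts : ∀ u v : List (Fin d), tensorState (vectorState (vacuum T))
      (fun i => fieldOp T H (e i)) (monomial u ⊗ₜ[ℂ] monomial v) =
        wordState T H (u.map e) * wordState T H (v.map e) := fun u v => by
    rw [← hφ u, ← hφ v]; rfl
  rw [hL, lift_fieldOp_monomial, inner_conjugateVector_prod_fieldOp H hcrossing hT,
    LinearMap.comp_apply, quasiFreeDifferenceQuotient, he.two_smul_inv]
  simp only [LinearMap.sum_apply, LinearMap.smul_apply, freeDifferenceQuotient_monomial, map_sum,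
    map_smul, Finset.smul_sum, apply_ite (tensorState _ _), map_zero, hts]
  rw [Finset.sum_comm]
  simp only [smul_ite, smul_zero, Finset.sum_ite_eq, Finset.mem_univ, if_true]
  refine Fintype.sum_equiv (finCongr (List.length_map e)) _ _ fun k => ?_
  simp [List.map_take, List.map_drop, Matrix.gram_apply, mul_comm]

variable {T H} in
/-- Conjugate systems are unique, as the vacuum is cyclic for the polynomials in the field
operators. -/
theorem IsConjugateSystem.eq (he : IsRealOrthonormalBasis H e) {M : VonNeumannAlgebra (Fock T)}
    {D : Fin d → FreeAlgebra ℂ (Fin d) →ₗ[ℂ] FreeAlgebra ℂ (Fin d) ⊗[ℂ] FreeAlgebra ℂ (Fin d)}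
    {Θ Θ' : Fin d → Fock T}
    (h : IsConjugateSystem M (vacuum T) (fun i => fieldOp T H (e i)) D Θ)
    (h' : IsConjugateSystem M (vacuum T) (fun i => fieldOp T H (e i)) D Θ') : Θ = Θ' := by
  funext i
  refine ext_inner_toFock fun n v => ?_
  obtain ⟨p, hp⟩ := toFock_mem_polynomialVectors T H he n v
  rw [← inner_conj_symm, ← inner_conj_symm _ (Θ' i), ← hp]
  exact congrArg _ (((h i).2 p).trans ((h' i).2 p).symm)

end ConjugateSystem

end

end TwistedFock

theorem mainTheorem7 {E : Type*} [NormedAddCommGroup E] [InnerProductSpace ℂ E]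
    [FiniteDimensional ℂ E] (H : StandardSubspace E) (T : TwistedFock.StrictTwist E)
    (hcompatible : TwistedFock.IsCompatible T H) (hbraided : TwistedFock.IsBraided T)
    (hcrossing : TwistedFock.IsCrossingSymmetric T H)
    {d : ℕ} (e : Fin d → E) (he : TwistedFock.IsRealOrthonormalBasis H e) :
    let X : Fin d → (TwistedFock.Fock T →L[ℂ] TwistedFock.Fock T) :=
      fun i => TwistedFock.fieldOp T H (e i)
    let A : Matrix (Fin d) (Fin d) ℂ := he.modularMatrix
    let M : VonNeumannAlgebra (TwistedFock.Fock T) := TwistedFock.arakiWoods T H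
    let Ω : TwistedFock.Fock T := TwistedFock.vacuum T
    (∀ i, X i ∈ M ∧ IsSelfAdjoint (X i)) ∧
    A.PosDef ∧
    (∀ j k, TwistedFock.vectorState Ω (X k * X j) = ((2 : ℂ) • (1 + A)⁻¹) j k ∧
      TwistedFock.vectorState Ω (X k * X j) = ((2 : ℂ) • (A * (1 + A)⁻¹)) k j) ∧
    (∃ Θ : Fin d → TwistedFock.Fock T,
      TwistedFock.IsConjugateSystem M Ω X (TwistedFock.quasiFreeDifferenceQuotient A) Θ) ∧
    ∀ Θ : Fin d → TwistedFock.Fock T,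
      TwistedFock.IsConjugateSystem M Ω X (TwistedFock.quasiFreeDifferenceQuotient A) Θ →
      ∀ i, HasSum (fun n : ℕ => (-1 : ℂ) ^ n •
        TwistedFock.toFock T (2 * n + 1) (TwistedFock.conjugateTerm T H n (e i))) (Θ i) := by
  have hΘ := TwistedFock.isConjugateSystem_conjugateVector hcrossing hbraided he
  refine ⟨fun i => ⟨TwistedFock.fieldOp_mem_arakiWoods T H (he.mem i),
    TwistedFock.fieldOp_isSelfAdjoint T H (he.mem i)⟩, he.modularMatrix_posDef, fun j k => ?_,
    ⟨_, hΘ⟩, fun Θ hΘ' i => ?_⟩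
  · rw [he.two_smul_inv, he.two_smul_mul_inv, TwistedFock.vectorState_fieldOp_mul_fieldOp,
      TwistedFock.tomita_of_mem H (he.mem k)]
    exact ⟨rfl, rfl⟩
  · rw [TwistedFock.IsConjugateSystem.eq he hΘ' hΘ]
    exact (TwistedFock.summable_conjugateTerm H hbraided (e i)).hasSum
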